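/- Let $\Gamma$ be an abelian group and $\varepsilon:\Gamma\times\Gamma\to\mathbb C^*$ a commutation factor, i.e. $\varepsilon(i,j)\varepsilon(j,i)=1$, $\varepsilon(i,j+k)=\varepsilon(i,j)\varepsilon(i,k)$ and $\varepsilon(i+j,k)=\varepsilon(i,k)\varepsilon(j,k)$. Let $A=M_D(\mathbb C)=\bigoplus_{\alpha\in\Gamma}A^\alpha$ be a $\Gamma$-graded algebra whose grading is elementary: there is a map $\varphi:\{1,\dots,D\}\to\Gamma$ such that each matrix unit $E_{ij}$ is homogeneous of degree $\varphi(i)-\varphi(j)$. Put $[a,b]_\varepsilon=ab-\varepsilon(|a|,|b|)ba$ for homogeneous $a,b$, extended bilinearly, $\mathrm{tr}_\varepsilon(a)=\sum_i\varepsilon(\varphi(i),\varphi(i))a_{ii}$ and $\mathfrak{sl}_\varepsilon(D)=\ker\mathrm{tr}_\varepsilon$, a graded subspace of $A$ stable under $[\cdot,\cdot]_\varepsilon$. Let $\mathrm{Der}_\varepsilon(A)=\bigoplus_{\alpha}\mathrm{Der}^\alpha_\varepsilon(A)$, where $\mathrm{Der}^\alpha_\varepsilon(A)$ is the space of linear maps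 $X:A\to A$ of degree $\alpha$ with $X(ab)=X(a)b+\varepsilon(\alpha,|a|)\,aX(b)$ for $a$ homogeneous, with bracket $[X,Y]_\varepsilon=XY-\varepsilon(|X|,|Y|)YX$. Let $\Omega_\varepsilon(A)=\bigoplus_{n\ge0,\,k\in\Gamma}\Omega^{n,k}$, where $\Omega^{n,k}$ is the space of $n$-linear maps $\omega:\mathrm{Der}_\varepsilon(A)^n\to A$ such that, for homogeneous $X_i$, $\omega(X_1,\dots,X_n)\in A^{k+|X_1|+\dots+|X_n|}$; $\omega$ is multiplied by $-\varepsilon(|X_i|,|X_{i+1}|)$ when $X_i,X_{i+1}$ are exchanged, i.e. $\omega(\dots,X_i,X_{i+1},\dots)=-\varepsilon(|X_i|,|X_{i+1}|)\,\omega(\dots,X_{i+1},X_i,\dots)$; and $\omega(X_1,\dots,X_nz)=\omega(X_1,\dots,X_n)z$ for homogeneous $z$ in the $\varepsilon$-center $\{z:[z,b]_\varepsilon=0\ \forall b\in A\}$, where $(Xz)(a)=\varepsilon(|X|,|z|)zX(a)$. For $\omega$ of degree $(p,|\omega|)$, $\eta$ of degree $(q,|\eta|)$ and homogeneous $X_i$,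 the product and the differential are $$(\omega\eta)(X_1,\dots,X_{p+q})=\frac1{p!q!}\sum_{\sigma\in S_{p+q}}(-1)^{|\sigma|}f_1\;\omega(X_{\sigma(1)},\dots,X_{\sigma(p)})\,\eta(X_{\sigma(p+1)},\dots,X_{\sigma(p+q)}),$$ $$d\omega(X_1,\dots,X_{p+1})=\sum_{m}(-1)^{m+1}f_2\;X_m\cdot\omega(\dots\widehat{X_m}\dots)+\sum_{m<n}(-1)^{m+n}f_3\;\omega([X_m,X_n]_\varepsilon,\dots\widehat{X_m}\dots\widehat{X_n}\dots),$$ with $f_1=\prod_{m<n,\,\sigma(m)>\sigma(n)}\varepsilon(|X_{\sigma(n)}|,|X_{\sigma(m)}|)\prod_{m\le p}\varepsilon(|\eta|,|X_{\sigma(m)}|)$, $f_2=\varepsilon(|\omega|,|X_m|)\prod_{a<m}\varepsilon(|X_a|,|X_m|)$, $f_3=\varepsilon(|X_n|,|X_m|)\prod_{a<m}\varepsilon(|X_a|,|X_m|)\prod_{a<n}\varepsilon(|X_a|,|X_n|)$ and $X\cdot a=X(a)$. Let $\Omega_\varepsilon(\mathfrak{sl}_\varepsilon(D),A)=A\otimes\Lambda_\varepsilon(\mathfrak{sl}_\varepsilon(D)^*)$,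 where $\Lambda_\varepsilon(V)$ is the quotient of the tensor algebra of $V$ by the two-sided ideal generated by all $x\otimes y+\varepsilon(|x|,|y|)\,y\otimes x$ with $x,y\in V$ homogeneous, and where linear forms supported on the component of degree $-i$ have degree $i$. An element $a\otimes(\theta_1\wedge\dots\wedge\theta_n)$ is regarded as the $n$-linear map on $\mathfrak{sl}_\varepsilon(D)$ with values in $A$ given on homogeneous elements by $$(X_1,\dots,X_n)\mapsto\Big(\sum_{\sigma\in S_n}(-1)^{|\sigma|}\prod_{m<l,\,\sigma(m)<\sigma(l)}\varepsilon(|X_{\sigma(m)}|,|X_{\sigma(l)}|)\prod_m\theta_m(X_{\sigma(m)})\Big)a,$$ and the product and differential are given by the same formulas, now with $X_i\in\mathfrak{sl}_\varepsilon(D)$ and $X\cdot a=[X,a]_\varepsilon$. Suppose that $\mathrm{tr}_\varepsilon(1)=\sum_i\varepsilon(\varphi(i),\varphi(i))\ne0$. Then: 1. $\mathrm{ad}:\mathfrak{sl}_\varepsilon(D)\to\mathrm{Der}_\varepsilon(A)$, $\mathrm{ad}_a(b)=[a,b]_\varepsilon$, is an isomorphism of $\varepsilon$-Lie algebras. 2.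 The evaluation above identifies, for all $n\ge0$ and $k\in\Gamma$, the component of degree $(n,k)$ of $A\otimes\Lambda_\varepsilon(\mathfrak{sl}_\varepsilon(D)^*)$ with the space of $n$-linear maps $\mathfrak{sl}_\varepsilon(D)^n\to A$ satisfying the above degree and exchange conditions; $\Omega_\varepsilon(\mathfrak{sl}_\varepsilon(D),A)$ and $\Omega_\varepsilon(A)$ are $(\mathbb Z\times\Gamma)$-graded differential algebras, i.e. graded unital associative algebras for which $d$ has degree $(1,0)$, satisfies $d^2=0$ and $d(\omega\eta)=(d\omega)\eta+(-1)^p\omega\,d\eta$ for $\omega$ of degree $(p,k)$. 3. There is a push-forward $\mathrm{ad}_*:\Omega_\varepsilon(\mathfrak{sl}_\varepsilon(D),A)\to\Omega_\varepsilon(A)$, with $\mathrm{ad}_*(\omega)(\mathrm{ad}_{X_1},\dots,\mathrm{ad}_{X_n})=\omega(X_1,\dots,X_n)$ for $\omega$ of exterior degree $n$ and all $X_i\in\mathfrak{sl}_\varepsilon(D)$, and it is an isomorphism of $(\mathbb Z\times\Gamma)$-graded differential algebras. -/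

import Mathlib

open scoped TensorProduct DirectSum

set_option linter.unusedSectionVars false

noncomputable section

namespace EpsGraded

/-- A commutation factor on the abelian group `Γ` with values in the invertible elements of `K`. -/
structure CommutationFactor (Γ K : Type*) [AddCommGroup Γ] [Field K] where
  toFun : Γ → Γ → Kˣ
  mul_swap : ∀ i j, toFun i j * toFun j i = 1
  add_right : ∀ i j k, toFun i (j + k) = toFun i j * toFun i k
  add_left : ∀ i j k, toFun (i + j) k = toFun i k * toFun j k

instance {Γ K : Type*} [AddCommGroup Γ] [Field K] :
    CoeFun (CommutationFactor Γ K) (fun _ => Γ → Γ → Kˣ) := ⟨CommutationFactor.toFun⟩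

section General

variable {Γ K : Type*} [AddCommGroup Γ] [DecidableEq Γ] [Field K] (ε : CommutationFactor Γ K)

lemma factor_neg_neg (i j : Γ) : ε (-i) (-j) = ε i j := by
  have h0 : ∀ j, ε 0 j = 1 := fun j => by
    have := ε.add_left 0 0 j
    rw [add_zero] at this
    exact (mul_eq_left.mp this.symm)
  have h0' : ∀ j, ε j 0 = 1 := fun j => by
    have := ε.add_right j 0 0
    rw [add_zero] at this
    exact (mul_eq_left.mp this.symm)
  have h1 : ε (-i) (-j) * ε i (-j) = 1 := by rw [← ε.add_left, neg_add_cancel, h0]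
  have h2 : ε i j * ε i (-j) = 1 := by rw [← ε.add_right, add_neg_cancel, h0']
  exact mul_right_cancel (h1.trans h2.symm)

/-! ### Multilinear algebra on graded spaces -/

section Graded

variable {L : Type*} [AddCommGroup L] [Module K L] (ℒ : Γ → Submodule K L)
  [DirectSum.Decomposition ℒ]
variable {M : Type*} [AddCommGroup M] [Module K M]

/-- The linear map acting on the component of degree `j` as multiplication by `ε i j`. -/
def twist (i : Γ) : L →ₗ[K] L :=
  (DirectSum.toModule K Γ L fun j => (ε i j : K) • (ℒ j).subtype) ∘ₗ
    (DirectSum.decomposeLinearEquiv ℒ).toLinearMap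

lemma twist_apply (i : Γ) {j : Γ} {y : L} (hy : y ∈ ℒ j) :
    twist ε ℒ i y = (ε i j : K) • y := by
  lift y to ℒ j using hy
  simp [twist]

/-- For a bilinear map `B`, the bilinear map such that
`flip x y = ε |x| |y| B y x` for homogeneous `x`, `y`. -/
def epsFlip (B : L →ₗ[K] L →ₗ[K] M) : L →ₗ[K] L →ₗ[K] M :=
  (DirectSum.toModule K Γ (L →ₗ[K] M) fun i =>
    (LinearMap.lcomp K M (twist ε ℒ i)) ∘ₗ B.flip ∘ₗ (ℒ i).subtype) ∘ₗ
    (DirectSum.decomposeLinearEquiv ℒ).toLinearMap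

lemma epsFlip_apply (B : L →ₗ[K] L →ₗ[K] M) {i j : Γ} {x y : L} (hx : x ∈ ℒ i) (hy : y ∈ ℒ j) :
    epsFlip ε ℒ B x y = (ε i j : K) • B y x := by
  lift x to ℒ i using hx
  simp [epsFlip, twist_apply ε ℒ i hy]

/-- The `ε`-commutator of a bilinear product: the bilinear map such that
`[x, y] = B x y - ε |x| |y| B y x` for homogeneous `x`, `y`. -/
def epsComm (B : L →ₗ[K] L →ₗ[K] M) : L →ₗ[K] L →ₗ[K] M := B - epsFlip ε ℒ B

lemma epsComm_apply (B : L →ₗ[K] L →ₗ[K] M) {i j : Γ} {x y : L} (hx : x ∈ ℒ i) (hy : y ∈ ℒ j) :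
    epsComm ε ℒ B x y = B x y - (ε i j : K) • B y x := by
  simp [epsComm, epsFlip_apply ε ℒ B hx hy]

/-- Membership of all values of a bilinear map in a submodule may be checked on homogeneous
elements. -/
lemma bilin_mem (B : L →ₗ[K] L →ₗ[K] M) (S : Submodule K M)
    (h : ∀ i j x y, x ∈ ℒ i → y ∈ ℒ j → B x y ∈ S) (x y : L) : B x y ∈ S := by
  induction x using DirectSum.Decomposition.inductionOn ℒ with
  | zero => simp
  | add a b ha hb => rw [map_add]; exact S.add_mem ha hb
  | @homogeneous i a =>
    induction y using DirectSum.Decomposition.inductionOn ℒ with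
    | zero => simp
    | add a b ha hb => rw [map_add]; exact S.add_mem ha hb
    | @homogeneous j b => exact h i j a b a.2 b.2

/-- The multilinear map which on tuples of homogeneous elements of degrees `d` is given by `c d`. -/
def homExt (n : ℕ) : ((Fin n → Γ) → MultilinearMap K (fun _ : Fin n => L) M) →ₗ[K]
    MultilinearMap K (fun _ : Fin n => L) M :=
  MultilinearMap.compLinearMapₗ (fun _ => (DirectSum.decomposeLinearEquiv ℒ).toLinearMap) ∘ₗ
    (MultilinearMap.fromDirectSumEquiv (R := K) (ι := Fin n) (κ := fun _ => Γ)
      (M := fun _ i => ℒ i) (M' := M)).toLinearMap ∘ₗ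
    LinearMap.pi fun d => MultilinearMap.compLinearMapₗ (fun i => (ℒ (d i)).subtype) ∘ₗ
      LinearMap.proj d

lemma homExt_apply (n : ℕ) (c : (Fin n → Γ) → MultilinearMap K (fun _ : Fin n => L) M)
    (d : Fin n → Γ) (X : Fin n → L) (hX : ∀ i, X i ∈ ℒ (d i)) :
    homExt ℒ n c X = c d X := by
  lift X to (i : Fin n) → ℒ (d i) using hX
  simp only [homExt, LinearMap.comp_apply, MultilinearMap.compLinearMapₗ_apply,
    MultilinearMap.compLinearMap_apply, LinearEquiv.coe_coe,
    DirectSum.decomposeLinearEquiv_apply, DirectSum.decompose_coe, ← DirectSum.lof_eq_of K]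
  rw [MultilinearMap.fromDirectSumEquiv_lof]
  rfl

lemma homExt_eq_zero (n : ℕ) (c : (Fin n → Γ) → MultilinearMap K (fun _ : Fin n => L) M)
    (h : ∀ (d : Fin n → Γ) (X : Fin n → L), (∀ i, X i ∈ ℒ (d i)) → c d X = 0) :
    homExt ℒ n c = 0 := by
  have : (LinearMap.pi fun d => MultilinearMap.compLinearMapₗ (fun i => (ℒ (d i)).subtype) ∘ₗ
      LinearMap.proj d : ((Fin n → Γ) → MultilinearMap K (fun _ : Fin n => L) M) →ₗ[K]
        ((d : Fin n → Γ) → MultilinearMap K (fun i : Fin n => ℒ (d i)) M)) c = 0 := by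
    funext d
    ext X
    exact h d (fun i => X i) (fun i => (X i).2)
  simp only [homExt, LinearMap.comp_apply, this, map_zero]

end Graded

/-! ### The `ε`-exterior algebra and its elements as multilinear maps -/

section Exterior

variable {V : Type*} [AddCommGroup V] [Module K V] (𝒱 : Γ → Submodule K V)

/-- The two-sided ideal of the tensor algebra generated by the
`x ⊗ y + ε |x| |y| y ⊗ x`, with `x`, `y` homogeneous. -/
def exteriorIdeal : TwoSidedIdeal (TensorAlgebra K V) :=
  TwoSidedIdeal.span {t | ∃ i j, ∃ x ∈ 𝒱 i, ∃ y ∈ 𝒱 j,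
    t = TensorAlgebra.ι K x * TensorAlgebra.ι K y
      + (ε i j : K) • (TensorAlgebra.ι K y * TensorAlgebra.ι K x)}

/-- The `ε`-exterior algebra of a graded space. -/
abbrev EpsExterior : Type _ := TensorAlgebra K V ⧸ (exteriorIdeal ε 𝒱).asIdeal

/-- The element `x 0 ∧ ... ∧ x (n-1)` of the `ε`-exterior algebra. -/
def wedge {n : ℕ} (x : Fin n → V) : EpsExterior ε 𝒱 :=
  Ideal.Quotient.mk (exteriorIdeal ε 𝒱).asIdeal (TensorAlgebra.tprod K V n x)

end Exterior

section Evaluation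

variable {L : Type*} [AddCommGroup L] [Module K L] (ℒ : Γ → Submodule K L)

/-- The grading of the dual: `θ` has degree `i` if it vanishes on all components of degree
different from `-i`. -/
def dualGrading (i : Γ) : Submodule K (Module.Dual K L) where
  carrier := {θ | ∀ j, j ≠ -i → ∀ x ∈ ℒ j, θ x = 0}
  add_mem' ha hb j hj x hx := by simp [ha j hj x hx, hb j hj x hx]
  zero_mem' _ _ _ _ := rfl
  smul_mem' c _ ha j hj x hx := by simp [ha j hj x hx]

/-- The weight of a permutation in the evaluation of `θ₀ ∧ ... ∧ θₙ₋₁` on homogeneous elements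
of degrees `d`. -/
def evalFactor {n : ℕ} (d : Fin n → Γ) (σ : Equiv.Perm (Fin n)) : Kˣ :=
  ∏ a : Fin n × Fin n, if a.1 < a.2 then
    (if σ a.1 < σ a.2 then ε (d (σ a.1)) (d (σ a.2)) else 1) else 1

lemma evalFactor_swap {n : ℕ} (d : Fin n → Γ) (σ : Equiv.Perm (Fin n)) (i j : Fin n)
    (hij : (i : ℕ) + 1 = j) :
    evalFactor ε d σ = evalFactor ε d (σ * Equiv.swap i j) * ε (d (σ i)) (d (σ j)) := by
  set g : Fin n × Fin n → Kˣ := fun a => if σ a.1 < σ a.2 then ε (d (σ a.1)) (d (σ a.2)) else 1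
    with hg
  have hne : i ≠ j := by rintro rfl; omega
  have hlt : i < j := by rw [Fin.lt_def]; omega
  have h1 : evalFactor ε d (σ * Equiv.swap i j) =
      ∏ a : Fin n × Fin n, if Equiv.swap i j a.1 < Equiv.swap i j a.2 then g a else 1 := by
    unfold evalFactor
    refine Fintype.prod_equiv ((Equiv.swap i j).prodCongr (Equiv.swap i j)) _ _ ?_
    intro a
    simp only [hg, Equiv.prodCongr_apply, Prod.map_fst, Prod.map_snd, Equiv.swap_apply_self]
    rfl
  have h2 : ε (d (σ i)) (d (σ j)) = g (i, j) * (g (j, i))⁻¹ := by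
    rcases lt_trichotomy (σ i) (σ j) with h | h | h
    · simp [hg, h, h.not_gt]
    · exact absurd (σ.injective h) hne
    · simp only [hg, h, h.not_gt, if_true, if_false, one_mul]
      exact eq_inv_of_mul_eq_one_left (ε.mul_swap _ _)
  have h3 : ∏ a : Fin n × Fin n, ((if a = (i, j) then g a else 1) *
      (if a = (j, i) then (g a)⁻¹ else 1)) = g (i, j) * (g (j, i))⁻¹ := by
    rw [Finset.prod_mul_distrib, Finset.prod_ite_eq' , Finset.prod_ite_eq']
    simp
  rw [h1, h2, ← h3, ← Finset.prod_mul_distrib]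
  unfold evalFactor
  refine Finset.prod_congr rfl ?_
  rintro ⟨a, b⟩ -
  change (if a < b then g (a, b) else 1) = _
  by_cases h4 : (a, b) = (i, j)
  · have h4' : (a, b) ≠ (j, i) := by rw [h4]; simp [hne]
    obtain ⟨rfl, rfl⟩ := Prod.mk.inj h4
    rw [if_pos hlt, if_pos rfl, if_neg h4', if_neg (by simpa using hlt.le)]
    simp
  by_cases h5 : (a, b) = (j, i)
  · obtain ⟨rfl, rfl⟩ := Prod.mk.inj h5
    rw [if_neg hlt.not_gt, if_neg h4, if_pos rfl, if_pos (by simpa using hlt)]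
    simp
  rw [if_neg h4, if_neg h5, mul_one, mul_one]
  refine if_congr ?_ rfl rfl
  simp only [Prod.mk.injEq, Fin.ext_iff] at h4 h5
  simp only [Equiv.swap_apply_def, Fin.lt_def, Fin.ext_iff]
  split_ifs <;> omega

variable [DirectSum.Decomposition ℒ]

/-- The `ε`-alternating form defined by linear forms `θ 0, ..., θ (n-1)`: on homogeneous
`X 0, ..., X (n-1)` of degrees `d`, its value is
`∑ σ, sign σ * evalFactor d σ * ∏ m, θ m (X (σ m))`. When the `θ m` are homogeneous,
`evalFactor d σ` is, in the non-zero terms, the product of the `ε (d (σ n)) (d (σ m))` over the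
inversions `m < n` of `σ` and of the `ε |θ n| (d (σ m))` over all `m < n`, so that the form is
the product of the `θ m` for the graded product of forms. -/
def altForm (n : ℕ) : MultilinearMap K (fun _ : Fin n => Module.Dual K L)
    (MultilinearMap K (fun _ : Fin n => L) K) :=
  (homExt ℒ n ∘ₗ LinearMap.pi fun d => ∑ σ : Equiv.Perm (Fin n),
    (((Equiv.Perm.sign σ : ℤ) : K) * (evalFactor ε d σ : K)) •
      (MultilinearMap.domDomCongrLinearEquiv K K L K σ).toLinearMap).compMultilinearMap
    ((LinearMap.applyₗ (MultilinearMap.mkPiAlgebra K (Fin n) K)).compMultilinearMap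
      MultilinearMap.compLinearMapMultilinear)

lemma altForm_eq (n : ℕ) (θ : Fin n → Module.Dual K L) :
    altForm ε ℒ n θ = homExt ℒ n fun d => ∑ σ : Equiv.Perm (Fin n),
      (((Equiv.Perm.sign σ : ℤ) : K) * (evalFactor ε d σ : K)) •
        ((MultilinearMap.mkPiAlgebra K (Fin n) K).compLinearMap θ).domDomCongr σ := by
  simp only [altForm, LinearMap.compMultilinearMap_apply, LinearMap.comp_apply]
  congr 1
  funext d
  simp

lemma altForm_apply (n : ℕ) (θ : Fin n → Module.Dual K L) (d : Fin n → Γ) (X : Fin n → L)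
    (hX : ∀ i, X i ∈ ℒ (d i)) :
    altForm ε ℒ n θ X = ∑ σ : Equiv.Perm (Fin n),
      ((Equiv.Perm.sign σ : ℤ) : K) * (evalFactor ε d σ : K) * ∏ m, θ m (X (σ m)) := by
  rw [altForm_eq, homExt_apply ℒ n _ d X hX]
  simp

lemma altForm_swap (n : ℕ) (θ : Fin n → Module.Dual K L) (i j : Fin n) (hij : (i : ℕ) + 1 = j)
    (α β : Γ) (hi : θ i ∈ dualGrading ℒ α) (hj : θ j ∈ dualGrading ℒ β) :
    altForm ε ℒ n θ + (ε α β : K) • altForm ε ℒ n (θ ∘ Equiv.swap i j) = 0 := by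
  have hne : i ≠ j := by rintro rfl; omega
  rw [altForm_eq, altForm_eq, ← map_smul, ← map_add]
  refine homExt_eq_zero ℒ n _ ?_
  intro d X hX
  simp only [Pi.add_apply, Pi.smul_apply, _root_.add_apply, _root_.smul_apply,
    _root_.sum_apply, MultilinearMap.domDomCongr_apply,
    MultilinearMap.compLinearMap_apply, MultilinearMap.mkPiAlgebra_apply, smul_eq_mul,
    Function.comp_apply]
  rw [← Equiv.sum_comp (Equiv.mulRight (Equiv.swap i j))
    (fun σ : Equiv.Perm (Fin n) => ((Equiv.Perm.sign σ : ℤ) : K) * (evalFactor ε d σ : K) *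
      ∏ m, θ (Equiv.swap i j m) (X (σ m))), Finset.mul_sum, ← Finset.sum_add_distrib]
  refine Finset.sum_eq_zero fun σ _ => ?_
  have hprod : ∏ m, θ (Equiv.swap i j m) (X ((Equiv.mulRight (Equiv.swap i j) σ) m)) =
      ∏ m, θ m (X (σ m)) := by
    refine Fintype.prod_equiv (Equiv.swap i j) _ _ fun m => ?_
    simp
  rw [hprod]
  by_cases h1 : d (σ i) = -α
  · by_cases h2 : d (σ j) = -β
    · rw [evalFactor_swap ε d σ i j hij, h1, h2, factor_neg_neg]
      simp only [Equiv.coe_mulRight, Equiv.Perm.sign_mul, Equiv.Perm.sign_swap hne, Units.val_mul]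
      push_cast
      ring
    · have : ∏ m, θ m (X (σ m)) = 0 :=
        Finset.prod_eq_zero (Finset.mem_univ j) (hj _ h2 _ (hX _))
      rw [this]; ring
  · have : ∏ m, θ m (X (σ m)) = 0 :=
      Finset.prod_eq_zero (Finset.mem_univ i) (hi _ h1 _ (hX _))
    rw [this]; ring

/-- The form of arity `n` defined by an element of the tensor algebra of the dual. -/
def tensorForm (n : ℕ) : TensorAlgebra K (Module.Dual K L) →ₗ[K]
    MultilinearMap K (fun _ : Fin n => L) K :=
  PiTensorProduct.lift (altForm ε ℒ n) ∘ₗ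
    DirectSum.component K ℕ (fun n => ⨂[K]^n (Module.Dual K L)) n ∘ₗ
    TensorAlgebra.toDirectSum.toLinearMap

lemma tensorForm_tprod (n : ℕ) (θ : Fin n → Module.Dual K L) :
    tensorForm ε ℒ n (TensorAlgebra.tprod K _ n θ) = altForm ε ℒ n θ := by
  simp only [tensorForm, LinearMap.comp_apply, AlgHom.toLinearMap_apply,
    TensorAlgebra.toDirectSum_tensorPower_tprod]
  rw [← DirectSum.lof_eq_of K, DirectSum.component.lof_self, PiTensorProduct.lift.tprod]

lemma tensorForm_tprod_ne {n m : ℕ} (h : m ≠ n) (θ : Fin m → Module.Dual K L) :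
    tensorForm ε ℒ n (TensorAlgebra.tprod K _ m θ) = 0 := by
  simp only [tensorForm, LinearMap.comp_apply, AlgHom.toLinearMap_apply,
    TensorAlgebra.toDirectSum_tensorPower_tprod]
  rw [← DirectSum.lof_eq_of K, DirectSum.component.of, dif_neg h, map_zero]

lemma tensorForm_rel (n : ℕ) (l₁ l₂ : List (Module.Dual K L)) (α β : Γ) (θ η : Module.Dual K L)
    (hθ : θ ∈ dualGrading ℒ α) (hη : η ∈ dualGrading ℒ β) :
    tensorForm ε ℒ n ((l₁.map (TensorAlgebra.ι K)).prod *
      (TensorAlgebra.ι K θ * TensorAlgebra.ι K η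
        + (ε α β : K) • (TensorAlgebra.ι K η * TensorAlgebra.ι K θ)) *
      (l₂.map (TensorAlgebra.ι K)).prod) = 0 := by
  set l : List (Module.Dual K L) := l₁ ++ θ :: η :: l₂ with hl
  have key : ∀ (m : ℕ) (z : Fin m → Module.Dual K L), List.ofFn z = l →
      tensorForm ε ℒ n (TensorAlgebra.tprod K _ m z) + (ε α β : K) •
        tensorForm ε ℒ n (TensorAlgebra.tprod K _ m fun a => (l₁ ++ η :: θ :: l₂).getD a 0) = 0 := by
    intro m z hz
    have hm : m = l₁.length + (l₂.length + 2) := by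
      have := congrArg List.length hz
      simpa [hl] using this
    by_cases hmn : m = n
    · subst hmn
      have hi : l₁.length < m := by omega
      have hj : l₁.length + 1 < m := by omega
      have hget : ∀ a : Fin m, z a = l.getD a 0 := by
        intro a
        rw [← hz]
        simp
      have hsw : (fun a : Fin m => (l₁ ++ η :: θ :: l₂).getD (a : ℕ) 0) =
          z ∘ Equiv.swap ⟨l₁.length, hi⟩ ⟨l₁.length + 1, hj⟩ := by
        funext a
        simp only [Function.comp_apply, hget, Equiv.swap_apply_def, Fin.ext_iff]
        split_ifs with h1 h2
        · simp [hl, h1]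
        · simp [hl, h2]
        · rcases lt_or_ge (a : ℕ) l₁.length with h | h
          · simp [hl, List.getElem?_append_left h]
          · obtain ⟨b, hb⟩ : ∃ b, (a : ℕ) = l₁.length + (b + 2) :=
              ⟨a - l₁.length - 2, by omega⟩
            simp [hl, hb, List.getElem?_append_right]
      rw [tensorForm_tprod, tensorForm_tprod, hsw]
      refine altForm_swap ε ℒ m z _ _ rfl α β ?_ ?_
      · rw [hget]; simpa [hl] using hθ
      · rw [hget]; simpa [hl, List.getElem?_append_right] using hη
    · rw [tensorForm_tprod_ne ε ℒ hmn, tensorForm_tprod_ne ε ℒ hmn, smul_zero, add_zero]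
  have h := key l.length l.get (by simp)
  have hlen : (l₁ ++ η :: θ :: l₂).length = l.length := by simp [hl]
  have h2 : List.ofFn (fun a : Fin l.length => (l₁ ++ η :: θ :: l₂).getD (a : ℕ) 0) =
      l₁ ++ η :: θ :: l₂ := by
    refine List.ext_getElem (by simp only [List.length_ofFn, hlen]) fun a h1 h2 => ?_
    simp only [List.getElem_ofFn]
    exact List.getD_eq_getElem _ _ h2
  rw [← map_smul, ← map_add] at h
  convert h using 2
  rw [TensorAlgebra.tprod_apply, TensorAlgebra.tprod_apply]
  have e1 : ∀ (m : ℕ) (z : Fin m → Module.Dual K L),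
      List.ofFn (fun a => TensorAlgebra.ι K (z a)) = (List.ofFn z).map (TensorAlgebra.ι K) := by
    intro m z
    rw [List.map_ofFn]; rfl
  rw [e1, e1, h2, List.ofFn_get]
  simp [hl, mul_add, add_mul, mul_assoc]

lemma exteriorIdeal_le_ker (n : ℕ) :
    (exteriorIdeal ε (dualGrading ℒ)).asIdeal.restrictScalars K ≤
      LinearMap.ker (tensorForm ε ℒ n) := by
  have hspan : ∀ t : TensorAlgebra K (Module.Dual K L),
      t ∈ Submodule.span K (Set.range fun l : List (Module.Dual K L) =>
        (l.map (TensorAlgebra.ι K)).prod) := by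
    intro t
    induction t using TensorAlgebra.induction with
    | algebraMap r =>
      rw [Algebra.algebraMap_eq_smul_one]
      exact Submodule.smul_mem _ _ (Submodule.subset_span ⟨[], by simp⟩)
    | ι x => exact Submodule.subset_span ⟨[x], by simp⟩
    | mul a b ha hb =>
      have := Submodule.mul_mem_mul ha hb
      rw [Submodule.span_mul_span] at this
      refine Submodule.span_mono ?_ this
      rintro _ ⟨_, ⟨l, rfl⟩, _, ⟨l', rfl⟩, rfl⟩
      exact ⟨l ++ l', by simp⟩
    | add a b ha hb => exact Submodule.add_mem _ ha hb
  have main : ∀ t ∈ exteriorIdeal ε (dualGrading ℒ),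
      ∀ u v, tensorForm ε ℒ n (u * t * v) = 0 := by
    intro t ht
    induction ht using TwoSidedIdeal.span_induction with
    | mem t h =>
      obtain ⟨α, β, θ, hθ, η, hη, rfl⟩ := h
      intro u v
      induction hspan u using Submodule.span_induction with
      | mem _ h =>
        obtain ⟨l₁, rfl⟩ := h
        induction hspan v using Submodule.span_induction with
        | mem _ h =>
          obtain ⟨l₂, rfl⟩ := h
          exact tensorForm_rel ε ℒ n l₁ l₂ α β θ η hθ hη
        | zero => simp
        | add a b _ _ ha hb => rw [mul_add, map_add, ha, hb, add_zero]
        | smul c a _ ha => rw [mul_smul_comm, map_smul, ha, smul_zero]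
      | zero => simp
      | add a b _ _ ha hb => rw [add_mul, add_mul, map_add, ha, hb, add_zero]
      | smul c a _ ha => rw [smul_mul_assoc, smul_mul_assoc, map_smul, ha, smul_zero]
    | zero => simp
    | add a b _ _ ha hb => intro u v; rw [mul_add, add_mul, map_add, ha, hb, add_zero]
    | neg a _ ha => intro u v; rw [mul_neg, neg_mul, map_neg, ha, neg_zero]
    | left_absorb c a _ ha => intro u v; rw [← mul_assoc]; exact ha _ _
    | right_absorb c a _ ha =>
      intro u v
      rw [← mul_assoc, mul_assoc (u * a)]; exact ha _ _
  intro t ht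
  have := main t (by simpa using ht) 1 1
  simpa using this

/-- An element of the `ε`-exterior algebra of the dual, viewed as a multilinear form of arity `n`
(the forms of arity `n` come from the component of exterior degree `n`). -/
def exteriorForm (n : ℕ) : EpsExterior ε (dualGrading ℒ) →ₗ[K]
    MultilinearMap K (fun _ : Fin n => L) K :=
  Submodule.liftQ _ (tensorForm ε ℒ n) (exteriorIdeal_le_ker ε ℒ n) ∘ₗ
    (Submodule.Quotient.restrictScalarsEquiv K
      (exteriorIdeal ε (dualGrading ℒ)).asIdeal).symm.toLinearMap

lemma exteriorForm_wedge (n : ℕ) (θ : Fin n → Module.Dual K L) :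
    exteriorForm ε ℒ n (wedge ε _ θ) = altForm ε ℒ n θ := by
  rw [← tensorForm_tprod]
  rfl

variable {A : Type*} [AddCommGroup A] [Module K A]

/-- The evaluation of an element of `A ⊗ Λ_ε(L*)` as a multilinear map `Lⁿ → A`: it sends
`a ⊗ ξ` to `(X 0, ..., X (n-1)) ↦ ξ (X 0, ..., X (n-1)) • a`. -/
def eval (n : ℕ) : A ⊗[K] EpsExterior ε (dualGrading ℒ) →ₗ[K]
    MultilinearMap K (fun _ : Fin n => L) A :=
  TensorProduct.lift (LinearMap.mk₂ K
    (fun a ξ => (LinearMap.toSpanSingleton K A a).compMultilinearMap (exteriorForm ε ℒ n ξ))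
    (fun a b ξ => by ext; simp) (fun c a ξ => by ext X; simp only [_root_.smul_apply, LinearMap.compMultilinearMap_apply, LinearMap.toSpanSingleton_apply]; rw [smul_comm])
    (fun a ξ η => by ext; simp) (fun c a ξ => by ext; simp))

lemma eval_wedge (n : ℕ) (a : A) (θ : Fin n → Module.Dual K L) (d : Fin n → Γ) (X : Fin n → L)
    (hX : ∀ i, X i ∈ ℒ (d i)) :
    eval ε ℒ n (a ⊗ₜ wedge ε _ θ) X = (∑ σ : Equiv.Perm (Fin n),
      ((Equiv.Perm.sign σ : ℤ) : K) * (evalFactor ε d σ : K) * ∏ m, θ m (X (σ m))) • a := by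
  rw [← altForm_apply ε ℒ n θ d X hX, ← exteriorForm_wedge]
  rfl

end Evaluation

/-! ### `ε`-Lie algebras -/

section Lie

variable {L : Type*} [AddCommGroup L] [Module K L] (ℒ : Γ → Submodule K L)

/-- The axioms of an `ε`-Lie algebra for a bilinear product `br` on a graded space. -/
structure IsEpsLieAlgebra (br : L →ₗ[K] L →ₗ[K] L) : Prop where
  mem : ∀ i j, ∀ a ∈ ℒ i, ∀ b ∈ ℒ j, br a b ∈ ℒ (i + j)
  skew : ∀ i j, ∀ a ∈ ℒ i, ∀ b ∈ ℒ j, br a b = -((ε i j : K) • br b a)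
  jacobi : ∀ i j k, ∀ a ∈ ℒ i, ∀ b ∈ ℒ j, ∀ c ∈ ℒ k,
    br a (br b c) = br (br a b) c + (ε i j : K) • br b (br a c)

/-- A linear isomorphism is an isomorphism of `ε`-Lie algebras if it is homogeneous of degree `0`
and preserves the brackets. -/
structure IsEpsLieIso {L' : Type*} [AddCommGroup L'] [Module K L'] (ℒ' : Γ → Submodule K L')
    (br : L →ₗ[K] L →ₗ[K] L) (br' : L' →ₗ[K] L' →ₗ[K] L') (f : L ≃ₗ[K] L') : Prop where
  map_grading : ∀ i, (ℒ i).map (f : L →ₗ[K] L') = ℒ' i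
  map_bracket : ∀ a b, f (br a b) = br' (f a) (f b)

end Lie

/-! ### `ε`-derivations -/

section Derivations

lemma isInternal_comap {E : Type*} [AddCommGroup E] [Module K E] (P : Γ → Submodule K E)
    (hP : iSupIndep P) (S : Submodule K E) (hS : S ≤ ⨆ i, P i ⊓ S) :
    DirectSum.IsInternal fun i => (P i).comap S.subtype := by
  refine DirectSum.isInternal_submodule_of_iSupIndep_of_iSup_eq_top ?_ ?_
  · classical
    rw [iSupIndep_iff_forall_dfinsupp]
    rw [iSupIndep_def] at hP
    intro i x v hv
    have h1 : ((x : S) : E) ∈ ⨆ j, ⨆ _ : j ≠ i, P j := by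
      rw [← hv]
      change S.subtype _ ∈ _
      rw [DFinsupp.lsum_apply_apply, DFinsupp.sumAddHom_apply, DFinsupp.sum, map_sum]
      refine Submodule.sum_mem _ fun j _ => ?_
      by_cases hj : j = i
      · subst hj
        simp
      · exact Submodule.mem_iSup_of_mem j (Submodule.mem_iSup_of_mem hj
          (((DFinsupp.erase i v) j).2))
    have h2 := Submodule.disjoint_def.mp (hP i) _ x.2 h1
    exact Subtype.ext (Subtype.ext h2)
  · rw [eq_top_iff]
    have h1 : Submodule.map S.subtype ⊤ ≤
        Submodule.map S.subtype (⨆ i, (P i).comap S.subtype) := by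
      rw [Submodule.map_iSup, Submodule.map_top, Submodule.range_subtype]
      refine hS.trans (iSup_mono fun i => ?_)
      rw [Submodule.map_comap_subtype, inf_comm]
    exact (Submodule.map_le_map_iff_of_injective S.injective_subtype _ _).mp h1

variable {A : Type*} [Ring A] [Algebra K A] (𝒜 : Γ → Submodule K A) [GradedAlgebra 𝒜]

/-- The bracket of an `ε`-graded algebra: `[a, b] = a b - ε |a| |b| b a` for homogeneous `a, b`. -/
def epsBracket : A →ₗ[K] A →ₗ[K] A := epsComm ε 𝒜 (LinearMap.mul K A)

/-- The `ε`-center. -/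
def epsCenter : Submodule K A := LinearMap.ker (epsBracket ε 𝒜)

/-- The `ε`-derivations of degree `i`. -/
def homDer (i : Γ) : Submodule K (Module.End K A) where
  carrier := {X | (∀ j, ∀ a ∈ 𝒜 j, X a ∈ 𝒜 (i + j)) ∧
    ∀ j, ∀ a ∈ 𝒜 j, ∀ b, X (a * b) = X a * b + (ε i j : K) • (a * X b)}
  add_mem' := by
    rintro X Y ⟨hX, hX'⟩ ⟨hY, hY'⟩
    refine ⟨fun j a ha => Submodule.add_mem _ (hX j a ha) (hY j a ha), fun j a ha b => ?_⟩
    simp only [LinearMap.add_apply, hX' j a ha, hY' j a ha, add_mul, mul_add, smul_add]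
    abel
  zero_mem' := ⟨fun j a _ => Submodule.zero_mem _, fun j a _ b => by simp⟩
  smul_mem' := by
    rintro c X ⟨hX, hX'⟩
    refine ⟨fun j a ha => Submodule.smul_mem _ c (hX j a ha), fun j a ha b => ?_⟩
    simp only [LinearMap.smul_apply, hX' j a ha, smul_add, smul_mul_assoc, mul_smul_comm]
    rw [smul_comm c]

/-- The space of `ε`-derivations: sums of homogeneous ones. -/
def epsDer : Submodule K (Module.End K A) := ⨆ i, homDer ε 𝒜 i

/-- The grading of the space of `ε`-derivations. -/
def derGrading (i : Γ) : Submodule K (epsDer ε 𝒜) := (homDer ε 𝒜 i).comap (epsDer ε 𝒜).subtype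

lemma homDer_iSupIndep : iSupIndep (homDer ε 𝒜) := by
  classical
  rw [iSupIndep_iff_forall_dfinsupp]
  intro i X v hv
  ext a
  change (X : Module.End K A) a = 0
  induction a using DirectSum.Decomposition.inductionOn 𝒜 with
  | zero => simp
  | add a b ha hb => rw [map_add, ha, hb, add_zero]
  | @homogeneous j a =>
    have hmem : (X : Module.End K A) a ∈ 𝒜 (i + j) := X.2.1 j a a.2
    rw [← DirectSum.decompose_of_mem_same 𝒜 hmem, ← hv, DFinsupp.lsum_apply_apply,
      DFinsupp.sumAddHom_apply, DFinsupp.sum, LinearMap.sum_apply, DirectSum.decompose_sum,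
      DFinsupp.finsetSum_apply, AddSubmonoidClass.coe_finsetSum]
    refine Finset.sum_eq_zero fun k _ => ?_
    by_cases hk : k = i
    · subst hk
      simp
    · refine DirectSum.decompose_of_mem_ne 𝒜 (((DFinsupp.erase i v) k).2.1 j a a.2) ?_
      simpa using hk

instance derDecomposition : DirectSum.Decomposition (derGrading ε 𝒜) :=
  (isInternal_comap (homDer ε 𝒜) (homDer_iSupIndep ε 𝒜) (epsDer ε 𝒜)
    (iSup_le fun i => le_iSup_of_le i
      (le_inf le_rfl (le_iSup (homDer ε 𝒜) i)))).chooseDecomposition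

/-- The composition of `ε`-derivations as linear maps. -/
def derComp : epsDer ε 𝒜 →ₗ[K] epsDer ε 𝒜 →ₗ[K] Module.End K A :=
  (LinearMap.mul K (Module.End K A)).compl₁₂ (epsDer ε 𝒜).subtype (epsDer ε 𝒜).subtype

lemma derComm_mem (X Y : epsDer ε 𝒜) :
    epsComm ε (derGrading ε 𝒜) (derComp ε 𝒜) X Y ∈ epsDer ε 𝒜 := by
  refine bilin_mem (derGrading ε 𝒜) _ _ ?_ X Y
  rintro i j ⟨X, hX'⟩ ⟨Y, hY'⟩ hX hY
  rw [epsComm_apply ε _ _ hX hY]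
  obtain ⟨hX1, hX2⟩ : X ∈ homDer ε 𝒜 i := hX
  obtain ⟨hY1, hY2⟩ : Y ∈ homDer ε 𝒜 j := hY
  refine (le_iSup (homDer ε 𝒜) (i + j)) ⟨fun k a ha => ?_, fun k a ha b => ?_⟩
  · refine Submodule.sub_mem _ ?_ (Submodule.smul_mem _ _ ?_)
    · rw [add_assoc]; exact hX1 _ _ (hY1 _ _ ha)
    · rw [add_comm i, add_assoc]; exact hY1 _ _ (hX1 _ _ ha)
  · change X (Y (a * b)) - (ε i j : K) • Y (X (a * b)) =
      (X (Y a) - (ε i j : K) • Y (X a)) * b +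
        (ε (i + j) k : K) • (a * (X (Y b) - (ε i j : K) • Y (X b)))
    have hij : (ε i j : K) * (ε j i : K) = 1 := by
      rw [← Units.val_mul, ε.mul_swap, Units.val_one]
    rw [hX2 k a ha, hY2 k a ha, map_add, map_add, map_smul, map_smul, hX2 _ _ (hY1 k a ha),
      hY2 _ _ (hX1 k a ha), hX2 k a ha, hY2 k a ha, ε.add_right, ε.add_right, ε.add_left]
    simp only [Units.val_mul, smul_add, smul_sub, sub_mul, mul_sub, smul_mul_assoc, mul_smul_comm,
      smul_smul]
    have e1 : (ε i j : K) * ((ε j i : K) * (ε j k : K)) = ε j k := by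
      rw [← mul_assoc, hij, one_mul]
    rw [e1, mul_comm (ε j k : K) (ε i k : K),
      mul_comm (ε i j : K) ((ε i k : K) * _), mul_comm (ε i j : K) (ε i k : K)]
    have e2 : (ε i k : K) * ε j k * ε i j = (ε i j : K) * ((ε i k : K) * ε j k) := by ring
    rw [e2]
    abel

/-- The bracket of `ε`-derivations: `[X, Y] = X Y - ε |X| |Y| Y X` for homogeneous `X, Y`. -/
def derBracket : epsDer ε 𝒜 →ₗ[K] epsDer ε 𝒜 →ₗ[K] epsDer ε 𝒜 :=
  LinearMap.mk₂ K (fun X Y => ⟨epsComm ε (derGrading ε 𝒜) (derComp ε 𝒜) X Y, derComm_mem ε 𝒜 X Y⟩)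
    (fun X X' Y => Subtype.ext (by simp)) (fun c X Y => Subtype.ext (by simp))
    (fun X Y Y' => Subtype.ext (by simp)) (fun c X Y => Subtype.ext (by simp))

end Derivations

/-! ### Forms, their product and their differential -/

section Forms

variable {A : Type*} [Ring A] [Algebra K A] (𝒜 : Γ → Submodule K A)

section

variable {L : Type*} [AddCommGroup L] [Module K L] (ℒ : Γ → Submodule K L)

/-- The multilinear maps `Lⁿ → A` which are homogeneous of degree `k` and `ε`-alternating. -/
def altForms (n : ℕ) (k : Γ) : Submodule K (MultilinearMap K (fun _ : Fin n => L) A) where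
  carrier := {ω | ∀ (d : Fin n → Γ) (X : Fin n → L), (∀ i, X i ∈ ℒ (d i)) →
    ω X ∈ 𝒜 (k + ∑ i, d i) ∧
    ∀ i j : Fin n, (i : ℕ) + 1 = j →
      ω X = -((ε (d i) (d j) : K) • ω (X ∘ Equiv.swap i j))}
  add_mem' := by
    intro ω η hω hη d X hX
    refine ⟨Submodule.add_mem _ (hω d X hX).1 (hη d X hX).1, fun i j hij => ?_⟩
    rw [_root_.add_apply, _root_.add_apply, (hω d X hX).2 i j hij, (hη d X hX).2 i j hij, smul_add,
      neg_add]
  zero_mem' := fun d X _ => ⟨Submodule.zero_mem _, fun i j _ => by simp⟩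
  smul_mem' := by
    intro c ω hω d X hX
    refine ⟨Submodule.smul_mem _ c (hω d X hX).1, fun i j hij => ?_⟩
    rw [_root_.smul_apply, _root_.smul_apply, (hω d X hX).2 i j hij, smul_neg, smul_comm]

/-- The product over the inversions `m < n`, `σ n < σ m` of `σ` of the `ε (d (σ n)) (d (σ m))`. -/
def inversionFactor {n : ℕ} (d : Fin n → Γ) (σ : Equiv.Perm (Fin n)) : Kˣ :=
  ∏ a : Fin n × Fin n, if a.1 < a.2 ∧ σ a.2 < σ a.1 then ε (d (σ a.2)) (d (σ a.1)) else 1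

/-- The value of the product of a form `ω` of arity `p` and a form `η` of arity `q` and
degree `l` on homogeneous elements `X` of degrees `d`. -/
def mulValue (l : Γ) {p q : ℕ} (ω : (Fin p → L) → A) (η : (Fin q → L) → A)
    (d : Fin (p + q) → Γ) (X : Fin (p + q) → L) : A :=
  ((p.factorial : K) * (q.factorial : K))⁻¹ • ∑ σ : Equiv.Perm (Fin (p + q)),
    (((Equiv.Perm.sign σ : ℤ) : K) *
      ((inversionFactor ε d σ * ∏ m : Fin p, ε l (d (σ (Fin.castAdd q m))) : Kˣ) : K)) •
        (ω (fun m => X (σ (Fin.castAdd q m))) * η (fun m => X (σ (Fin.natAdd p m))))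

variable (br : L → L → L) (ρ : L → A → A)

/-- The first sum in the differential of a form `ω` of arity `p` and degree `k`:
the terms `± ρ (X m) (ω (X 0, ..., X m omitted, ..., X p))`. -/
def diffActionSum (k : Γ) {p : ℕ} (ω : (Fin p → L) → A) (d : Fin (p + 1) → Γ)
    (X : Fin (p + 1) → L) : A :=
  ∑ m : Fin (p + 1), (((-1) ^ (m : ℕ) * (ε k (d m) * ∏ a ∈ Finset.Iio m, ε (d a) (d m)) : Kˣ) : K) •
    ρ (X m) (ω fun j => X (m.succAbove j))

/-- The second sum in the differential of a form `ω` of arity `p`: the terms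
`± ω ([X m, X n], X 0, ..., X m and X n omitted, ..., X p)` for `m < n`. -/
def diffBracketSum : {p : ℕ} → ((Fin p → L) → A) → (Fin (p + 1) → Γ) → (Fin (p + 1) → L) → A
  | 0, _, _, _ => 0
  | p + 1, ω, d, X => ∑ n : Fin (p + 2), ∑ m : Fin (p + 1), if m.castSucc < n then
      (((-1) ^ ((m : ℕ) + (n : ℕ)) * (ε (d n) (d m.castSucc) *
        (∏ a ∈ Finset.Iio m.castSucc, ε (d a) (d m.castSucc)) *
        ∏ a ∈ Finset.Iio n, ε (d a) (d n)) : Kˣ) : K) •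
      ω (Fin.cons (br (X m.castSucc) (X n)) fun j : Fin p => X (n.succAbove (m.succAbove j)))
    else 0

/-- The value of the differential of a form `ω` of arity `p` and degree `k`
on homogeneous elements `X` of degrees `d`. -/
def diffValue (k : Γ) {p : ℕ} (ω : (Fin p → L) → A) (d : Fin (p + 1) → Γ)
    (X : Fin (p + 1) → L) : A :=
  diffActionSum ε ρ k ω d X + diffBracketSum ε br ω d X

end

/-! ### Graded differential algebras -/

/-- The axioms of a `(ℤ × Γ)`-graded differential algebra, concentrated in non-negative
`ℤ`-degrees: a graded unital associative algebra, with `d` of degree `(1, 0)` and square zero, which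
is a derivation for the commutation factor `((m, i), (n, j)) ↦ (-1) ^ (m * n) * ε i j`. -/
structure IsGradedDiffAlgebra {E : Type*} [AddCommMonoid E] [Module K E]
    (𝒢 : ℕ × Γ → Submodule K E) (mul : E →ₗ[K] E →ₗ[K] E) (one : E) (d : E →ₗ[K] E) : Prop where
  isInternal : DirectSum.IsInternal 𝒢
  mul_assoc : ∀ x y z, mul (mul x y) z = mul x (mul y z)
  one_mul : ∀ x, mul one x = x
  mul_one : ∀ x, mul x one = x
  one_mem : one ∈ 𝒢 (0, 0)
  mul_mem : ∀ p q, ∀ x ∈ 𝒢 p, ∀ y ∈ 𝒢 q, mul x y ∈ 𝒢 (p + q)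
  d_mem : ∀ p, ∀ x ∈ 𝒢 p, d x ∈ 𝒢 (p + (1, 0))
  d_mul : ∀ p, ∀ x ∈ 𝒢 p, ∀ y,
    d (mul x y) = mul (d x) y + ((-1) ^ p.1 * (ε 0 p.2 : K)) • mul x (d y)
  d_d : ∀ x, d (d x) = 0

/-- A linear isomorphism is an isomorphism of graded differential algebras if it preserves the
gradings, the products, the units and the differentials. -/
structure IsGradedDiffAlgebraIso {E F : Type*} [AddCommMonoid E] [Module K E] [AddCommMonoid F]
    [Module K F] (𝒢 : ℕ × Γ → Submodule K E) (mul : E →ₗ[K] E →ₗ[K] E) (one : E) (d : E →ₗ[K] E)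
    (ℋ : ℕ × Γ → Submodule K F) (mul' : F →ₗ[K] F →ₗ[K] F) (one' : F) (d' : F →ₗ[K] F)
    (f : E ≃ₗ[K] F) : Prop where
  map_grading : ∀ p, (𝒢 p).map (f : E →ₗ[K] F) = ℋ p
  map_mul : ∀ x y, f (mul x y) = mul' (f x) (f y)
  map_one : f one = one'
  map_d : ∀ x, f (d x) = d' (f x)

/-! ### The complex `A ⊗ Λ_ε(L*)` -/

section LieForms

variable {L : Type*} [AddCommGroup L] [Module K L] (ℒ : Γ → Submodule K L)

/-- The space `A ⊗ Λ_ε(L*)`. -/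
abbrev LieForms : Type _ := A ⊗[K] EpsExterior ε (dualGrading ℒ)

/-- The grading of `A ⊗ Λ_ε(L*)`: the component of degree `(n, k)` is spanned by the
`a ⊗ (θ 0 ∧ ... ∧ θ (n-1))` with `a` and the `θ i` homogeneous, of total degree `k`. -/
def lieFormsGrading (p : ℕ × Γ) : Submodule K (LieForms (A := A) ε ℒ) :=
  Submodule.span K {t | ∃ (i : Γ) (d : Fin p.1 → Γ) (a : A) (θ : Fin p.1 → Module.Dual K L),
    a ∈ 𝒜 i ∧ (∀ j, θ j ∈ dualGrading ℒ (d j)) ∧ i + ∑ j, d j = p.2 ∧ t = a ⊗ₜ wedge ε _ θ}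

variable [DirectSum.Decomposition ℒ]

/-- The product and the differential of `A ⊗ Λ_ε(L*)`, given on homogeneous elements by their
evaluations: `(ω η)(X) = mulValue ω η X` and `(d ω)(X) = diffValue ω X`. -/
structure IsLieFormsStructure (br : L → L → L) (ρ : L → A → A)
    (mul : LieForms (A := A) ε ℒ →ₗ[K] LieForms (A := A) ε ℒ →ₗ[K] LieForms (A := A) ε ℒ)
    (d : LieForms (A := A) ε ℒ →ₗ[K] LieForms (A := A) ε ℒ) : Prop where
  mul_mem : ∀ p q, ∀ ω ∈ lieFormsGrading ε 𝒜 ℒ p, ∀ η ∈ lieFormsGrading ε 𝒜 ℒ q,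
    mul ω η ∈ lieFormsGrading ε 𝒜 ℒ (p + q)
  eval_mul : ∀ p q, ∀ ω ∈ lieFormsGrading ε 𝒜 ℒ p, ∀ η ∈ lieFormsGrading ε 𝒜 ℒ q,
    ∀ (e : Fin (p.1 + q.1) → Γ) (X : Fin (p.1 + q.1) → L), (∀ i, X i ∈ ℒ (e i)) →
      eval ε ℒ (p.1 + q.1) (mul ω η) X =
        mulValue ε q.2 (eval ε ℒ p.1 ω) (eval ε ℒ q.1 η) e X
  d_mem : ∀ p, ∀ ω ∈ lieFormsGrading ε 𝒜 ℒ p, d ω ∈ lieFormsGrading ε 𝒜 ℒ (p + (1, 0))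
  eval_d : ∀ p, ∀ ω ∈ lieFormsGrading ε 𝒜 ℒ p,
    ∀ (e : Fin (p.1 + 1) → Γ) (X : Fin (p.1 + 1) → L), (∀ i, X i ∈ ℒ (e i)) →
      eval ε ℒ (p.1 + 1) (d ω) X = diffValue ε br ρ p.2 (eval ε ℒ p.1 ω) e X

end LieForms

/-! ### The differential calculus based on `ε`-derivations -/

section DerForms

variable [GradedAlgebra 𝒜]

/-- The space of `n`-linear maps from the `ε`-derivations to `A` which are homogeneous of
degree `k`, `ε`-alternating, and linear over the `ε`-center, where the product of a derivation `X`
by an element `z` of the `ε`-center is `(X z)(a) = ε |X| |z| z X(a)`. -/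
def derForms (p : ℕ × Γ) :
    Submodule K (MultilinearMap K (fun _ : Fin p.1 => epsDer ε 𝒜) A) where
  carrier := {ω | ω ∈ altForms (L := epsDer ε 𝒜) ε 𝒜 (derGrading ε 𝒜) p.1 p.2 ∧
    ∀ (d : Fin p.1 → Γ) (X : Fin p.1 → epsDer ε 𝒜), (∀ i, X i ∈ derGrading ε 𝒜 (d i)) →
      ∀ i : Fin p.1, (i : ℕ) + 1 = p.1 → ∀ j, ∀ z ∈ 𝒜 j, z ∈ epsCenter ε 𝒜 →
        ∀ Y : epsDer ε 𝒜,
          (∀ a, (Y : Module.End K A) a = (ε (d i) j : K) • (z * (X i : Module.End K A) a)) →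
          ω (Function.update X i Y) = ω X * z}
  add_mem' := by
    rintro ω η ⟨hω, hω'⟩ ⟨hη, hη'⟩
    refine ⟨Submodule.add_mem _ hω hη, fun d X hX i hi j z hz hz' Y hY => ?_⟩
    rw [_root_.add_apply, _root_.add_apply, hω' d X hX i hi j z hz hz' Y hY,
      hη' d X hX i hi j z hz hz' Y hY, add_mul]
  zero_mem' := ⟨Submodule.zero_mem _, fun d X hX i hi j z hz hz' Y hY => by simp⟩
  smul_mem' := by
    rintro c ω ⟨hω, hω'⟩
    refine ⟨Submodule.smul_mem _ c hω, fun d X hX i hi j z hz hz' Y hY => ?_⟩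
    rw [_root_.smul_apply, _root_.smul_apply, hω' d X hX i hi j z hz hz' Y hY, smul_mul_assoc]

/-- The `(ℤ × Γ)`-graded space `Ω_ε(A)` of the differential calculus based on
`ε`-derivations. -/
abbrev DerCalculus : Type _ := ⨁ p : ℕ × Γ, derForms ε 𝒜 p

/-- The grading of `Ω_ε(A)`. -/
def derCalculusGrading (p : ℕ × Γ) : Submodule K (DerCalculus ε 𝒜) :=
  LinearMap.range (DirectSum.lof K (ℕ × Γ) (fun p => derForms ε 𝒜 p) p)

/-- The unit of `Ω_ε(A)`: the unit of `A`, as a form of arity `0`. -/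
def derCalculusOne : DerCalculus ε 𝒜 :=
  DirectSum.lof K (ℕ × Γ) (fun p => derForms ε 𝒜 p) (0, 0)
    ⟨MultilinearMap.constOfIsEmpty K _ 1, fun _ _ _ =>
      ⟨by simpa using SetLike.GradedOne.one_mem, fun i => i.elim0⟩, fun _ _ _ i => i.elim0⟩

/-- The product and the differential of `Ω_ε(A)`, given on homogeneous elements by
`(ω η)(X) = mulValue ω η X` and `(d ω)(X) = diffValue ω X`. -/
structure IsDerCalculusStructure
    (mul : DerCalculus ε 𝒜 →ₗ[K] DerCalculus ε 𝒜 →ₗ[K] DerCalculus ε 𝒜)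
    (d : DerCalculus ε 𝒜 →ₗ[K] DerCalculus ε 𝒜) : Prop where
  mul_mem : ∀ p q, ∀ ω ∈ derCalculusGrading ε 𝒜 p, ∀ η ∈ derCalculusGrading ε 𝒜 q,
    mul ω η ∈ derCalculusGrading ε 𝒜 (p + q)
  mul_apply : ∀ p q, ∀ ω ∈ derCalculusGrading ε 𝒜 p, ∀ η ∈ derCalculusGrading ε 𝒜 q,
    ∀ (e : Fin (p.1 + q.1) → Γ) (X : Fin (p.1 + q.1) → epsDer ε 𝒜),
      (∀ i, X i ∈ derGrading ε 𝒜 (e i)) →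
      (mul ω η (p + q)).1 X = mulValue ε q.2 (ω p).1 (η q).1 e X
  d_mem : ∀ p, ∀ ω ∈ derCalculusGrading ε 𝒜 p, d ω ∈ derCalculusGrading ε 𝒜 (p + (1, 0))
  d_apply : ∀ p, ∀ ω ∈ derCalculusGrading ε 𝒜 p,
    ∀ (e : Fin (p.1 + 1) → Γ) (X : Fin (p.1 + 1) → epsDer ε 𝒜),
      (∀ i, X i ∈ derGrading ε 𝒜 (e i)) →
      (d ω (p + (1, 0))).1 X =
        diffValue ε (fun X Y => derBracket ε 𝒜 X Y) (fun X a => (X : Module.End K A) a)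
          p.2 (ω p).1 e X

/-- `F` is the push-forward along `f : L → Der_ε(A)`: for `ω` homogeneous of exterior
degree `n`, `F ω` is the form of the same degree with
`(F ω)(f X 0, ..., f X (n-1)) = ω (X 0, ..., X (n-1))`. -/
def IsPushforward {L : Type*} [AddCommGroup L] [Module K L] (ℒ : Γ → Submodule K L)
    [DirectSum.Decomposition ℒ] (f : L → epsDer ε 𝒜)
    (F : LieForms (A := A) ε ℒ → DerCalculus ε 𝒜) : Prop :=
  ∀ p, ∀ ω ∈ lieFormsGrading ε 𝒜 ℒ p, F ω ∈ derCalculusGrading ε 𝒜 p ∧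
    ∀ X : Fin p.1 → L, (F ω p).1 (fun i => f (X i)) = eval ε ℒ p.1 ω X

end DerForms

end Forms

end General

/-! ### Matrix algebras with an elementary grading -/

section Matrix

open Matrix

variable {Γ : Type*} [AddCommGroup Γ] [DecidableEq Γ] (ε : CommutationFactor Γ ℂ) {D : ℕ}
  (𝒜 : Γ → Submodule ℂ (Matrix (Fin D) (Fin D) ℂ)) (φ : Fin D → Γ)

/-- A grading of the matrix algebra is elementary, for the map `φ`, if each matrix unit `E_ij` is
homogeneous of degree `φ i - φ j`. -/
class IsElementaryGrading : Prop where
  single_mem : ∀ i j, Matrix.single i j (1 : ℂ) ∈ 𝒜 (φ i - φ j)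

/-- The linear form `a ↦ ∑ i, ε (φ i) (φ i) * a i i`. -/
def epsTrace : Matrix (Fin D) (Fin D) ℂ →ₗ[ℂ] ℂ where
  toFun a := ∑ i, (ε (φ i) (φ i) : ℂ) * a i i
  map_add' a b := by simp [mul_add, Finset.sum_add_distrib]
  map_smul' c a := by
    simp only [Matrix.smul_apply, smul_eq_mul, RingHom.id_apply, Finset.mul_sum]
    exact Finset.sum_congr rfl fun i _ => by ring

/-- The space `sl_ε(D)` of matrices with vanishing `ε`-trace. -/
def slEps : Submodule ℂ (Matrix (Fin D) (Fin D) ℂ) := LinearMap.ker (epsTrace ε φ)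

/-- The grading of `sl_ε(D)`. -/
def slGrading (i : Γ) : Submodule ℂ (slEps ε φ) := (𝒜 i).comap (slEps ε φ).subtype

variable [GradedAlgebra 𝒜] [IsElementaryGrading 𝒜 φ]

lemma degree_of_apply_ne_zero {γ : Γ} {a : Matrix (Fin D) (Fin D) ℂ} (ha : a ∈ 𝒜 γ)
    {i j : Fin D} (h : a i j ≠ 0) : φ i - φ j = γ := by
  have h1 : Matrix.single i j (a i j) ∈ 𝒜 (φ i - φ j) := by
    have := Submodule.smul_mem _ (a i j) (IsElementaryGrading.single_mem (𝒜 := 𝒜) (φ := φ) i j)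
    simpa using this
  have h2 : Matrix.single i j (a i j) ∈ 𝒜 γ := by
    have h3 := SetLike.GradedMul.mul_mem (SetLike.GradedMul.mul_mem
      (IsElementaryGrading.single_mem (𝒜 := 𝒜) (φ := φ) i i) ha)
      (IsElementaryGrading.single_mem (𝒜 := 𝒜) (φ := φ) j j)
    simpa [Matrix.single_mul_mul_single] using h3
  refine DirectSum.degree_eq_of_mem_mem 𝒜 h1 h2 ?_
  intro h0
  exact h (by simpa using congrFun (congrFun h0 i) j)

lemma epsTrace_eq_zero {γ : Γ} (hγ : γ ≠ 0) {a : Matrix (Fin D) (Fin D) ℂ} (ha : a ∈ 𝒜 γ) :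
    epsTrace ε φ a = 0 := by
  change ∑ i, (ε (φ i) (φ i) : ℂ) * a i i = 0
  refine Finset.sum_eq_zero fun i _ => ?_
  by_cases h : a i i = 0
  · rw [h, mul_zero]
  · exact absurd ((sub_self (φ i)).symm.trans (degree_of_apply_ne_zero 𝒜 φ ha h)).symm hγ

instance slDecomposition : DirectSum.Decomposition (slGrading ε 𝒜 φ) := by
  refine (isInternal_comap 𝒜 (DirectSum.Decomposition.isInternal 𝒜).submodule_iSupIndep
    (slEps ε φ) ?_).chooseDecomposition
  intro a ha
  have h0 : ∀ γ, γ ≠ 0 → (DirectSum.decompose 𝒜 a γ : Matrix (Fin D) (Fin D) ℂ) ∈ slEps ε φ :=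
    fun γ hγ => epsTrace_eq_zero ε 𝒜 φ hγ (DirectSum.decompose 𝒜 a γ).2
  have h1 : ∀ γ, (DirectSum.decompose 𝒜 a γ : Matrix (Fin D) (Fin D) ℂ) ∈ slEps ε φ := by
    intro γ
    by_cases hγ : γ = 0
    · subst hγ
      by_cases hs : (0 : Γ) ∈ (DirectSum.decompose 𝒜 a).support
      · have h2 := DirectSum.sum_support_decompose 𝒜 a
        rw [← Finset.add_sum_erase _ _ hs] at h2
        rw [eq_sub_of_add_eq h2]
        exact Submodule.sub_mem _ ha (Submodule.sum_mem _ fun i hi => h0 i (Finset.ne_of_mem_erase hi))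
      · rw [DFinsupp.notMem_support_iff.mp hs]
        exact Submodule.zero_mem _
    · exact h0 γ hγ
  rw [← DirectSum.sum_support_decompose 𝒜 a]
  exact Submodule.sum_mem _ fun i _ => Submodule.mem_iSup_of_mem i ⟨(DirectSum.decompose 𝒜 a i).2, h1 i⟩

lemma epsBracket_mem_slEps (a b : Matrix (Fin D) (Fin D) ℂ) :
    epsBracket ε 𝒜 a b ∈ slEps ε φ := by
  refine bilin_mem 𝒜 _ _ ?_ a b
  intro α β a b ha hb
  rw [epsBracket, epsComm_apply ε 𝒜 _ ha hb]
  change epsTrace ε φ (a * b - (ε α β : ℂ) • (b * a)) = 0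
  rw [map_sub, map_smul, sub_eq_zero]
  change ∑ i, (ε (φ i) (φ i) : ℂ) * (a * b) i i =
    (ε α β : ℂ) * ∑ j, (ε (φ j) (φ j) : ℂ) * (b * a) j j
  simp only [Matrix.mul_apply, Finset.mul_sum]
  rw [Finset.sum_comm]
  refine Finset.sum_congr rfl fun j _ => Finset.sum_congr rfl fun i _ => ?_
  by_cases hij : a i j = 0
  · simp [hij]
  by_cases hji : b j i = 0
  · simp [hji]
  have h1 := degree_of_apply_ne_zero 𝒜 φ ha hij
  have h2 := degree_of_apply_ne_zero 𝒜 φ hb hji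
  have h3 : ε (φ i) (φ i) = ε α β * ε (φ j) (φ j) := by
    have e1 : φ i = α + φ j := by rw [← h1]; abel
    have e2 : β = -α := by rw [← h1, ← h2]; abel
    have e3 : ε α (-α) = ε α α := by
      have h4 : ε α (-α) * ε α (α + α) = ε α α := by rw [← ε.add_right]; congr 1; abel
      rw [ε.add_right, ε.mul_swap, mul_one] at h4
      exact h4
    rw [e1, e2, e3, ε.add_left, ε.add_right, ε.add_right]
    calc ε α α * ε α (φ j) * (ε (φ j) α * ε (φ j) (φ j))
        = ε α α * (ε α (φ j) * ε (φ j) α) * ε (φ j) (φ j) := by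
          simp only [_root_.mul_assoc]
      _ = ε α α * ε (φ j) (φ j) := by rw [ε.mul_swap, _root_.mul_one]
  rw [h3]
  push_cast
  ring

/-- The bracket of `sl_ε(D)`. -/
def slBracket : slEps ε φ →ₗ[ℂ] slEps ε φ →ₗ[ℂ] slEps ε φ :=
  LinearMap.mk₂ ℂ (fun a b => ⟨epsBracket ε 𝒜 a b, epsBracket_mem_slEps ε 𝒜 φ a b⟩)
    (fun a a' b => Subtype.ext (by simp)) (fun c a b => Subtype.ext (by simp))
    (fun a b b' => Subtype.ext (by simp)) (fun c a b => Subtype.ext (by simp))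

end Matrix

end EpsGraded
end

/-!
The forms on `sl_ε(D)` and those on the `ε`-derivations are two presentations of one differential
calculus, which is developed first, for an arbitrary `ε`-Lie algebra `L` acting by `ε`-derivations
on a graded algebra `A`.

*The calculus.* A form is viewed as a function of lists of homogeneous elements of `L`. On such
functions there is the contraction by a homogeneous element `X`, which inserts `X` in the first
place. The product, the Lie derivative and the differential are defined by recursion on the number
of arguments, by prescribing their contractions: the contraction is an `ε`-antiderivation of the
product, and the contraction of `d f` by `X` is given by Cartan's formula. Each of the rules
(`formMul_assoc`, `lieDer_formMul`, `lieDer_lieDer`, `dif_lieDer`, `dif_formMul`, `dif_dif`) is then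
an induction on the number of arguments, the contractions of its two sides being equal by the
previous rules. The sum over permutations for the product is recovered in `mulValue_eq_formMul`,
by sorting the permutations according to the place of the first argument, and the formula for the
differential in `diffValue_eq_dif`. The functions coming from `ε`-alternating multilinear maps are
stable under these operations; their direct sum `Calculus` is a graded differential algebra
(`calculus_isGradedDiffAlgebra`).

*Exterior forms.* For `L` of finite dimension, evaluation identifies the component of degree
`(n, k)` of `A ⊗ Λ_ε(L*)` with the `ε`-alternating maps (`bijOn_eval`). Its inverse `evalInv` is
explicit in a homogeneous basis: an alternating map `ω` goes to the sum of the `ω(b_I) ⊗ b_I*` over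
all sequences `I` of basis vectors, with suitable weights. Division by `n!` takes care of
reorderings, and no choice of ordered sequences is needed, so that repetitions, which are allowed
for basis vectors with `ε(g, g) = -1`, need no special treatment. Hence `A ⊗ Λ_ε(L*)` is
isomorphic to `Calculus`.

*Derivations.* A homogeneous `ε`-derivation `X` of the matrix algebra is the bracket with
`∑ i, X(E_io) E_oi`, for a fixed index `o` (`exists_eq_epsBracket`), and the homogeneous elements of
the `ε`-center are scalars (`eq_smul_one_of_epsBracket_eq_zero`). As `tr_ε(1) ≠ 0`, the subspace
`sl_ε(D)` is a complement of the scalars, so that the adjoint representation is an isomorphism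
(`adjointEquiv`). Linearity over the `ε`-center holds automatically, and the pull-back along `ad`
identifies the calculus on the `ε`-derivations with `Calculus` as well (`derCalculusEquiv`). The
push-forward is the composite of the two identifications.
-/

noncomputable section

namespace EpsGraded

/-! ### Commutation factors -/

section Factor

variable {Γ K : Type*} [AddCommGroup Γ] [Field K] (ε : CommutationFactor Γ K)

lemma factor_mul_swap (i j : Γ) : (ε i j : K) * (ε j i : K) = 1 := by
  rw [← Units.val_mul, ε.mul_swap, Units.val_one]

lemma factor_add_right (i j k : Γ) : (ε i (j + k) : K) = ε i j * ε i k := by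
  rw [ε.add_right, Units.val_mul]

lemma factor_add_left (i j k : Γ) : (ε (i + j) k : K) = ε i k * ε j k := by
  rw [ε.add_left, Units.val_mul]

lemma factor_zero_left (j : Γ) : ε 0 j = 1 := by
  have := ε.add_left 0 0 j
  rw [add_zero] at this
  exact mul_eq_left.mp this.symm

lemma factor_zero_right (j : Γ) : ε j 0 = 1 := by
  have := ε.add_right j 0 0
  rw [add_zero] at this
  exact mul_eq_left.mp this.symm

end Factor

/-! ### Forms as functions of lists

Here `H` stands for the set of homogeneous elements of an `ε`-Lie algebra, and a form of arity `n`
is a function of lists in `H` which vanishes on the lists of other lengths. No linearity is needed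
for the calculus itself. -/

section ListForms

variable {Γ K : Type*} [AddCommGroup Γ] [Field K] (ε : CommutationFactor Γ K)
variable {H : Type*} (deg : H → Γ)

section Module

variable {M : Type*} [AddCommGroup M] [Module K M]

variable (K) in
/-- The contraction of a function of lists by an element: the insertion of this element in the
first place. -/
def contract (X : H) : (List H → M) →ₗ[K] (List H → M) :=
  LinearMap.funLeft K M (List.cons X)

lemma contract_apply (X : H) (f : List H → M) (t : List H) :
    contract K X f t = f (X :: t) := rfl

variable (K) in
/-- The sign `(-1) ^ n` in arity `n`. -/
def parity : (List H → M) →ₗ[K] (List H → M) where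
  toFun f t := (-1 : K) ^ t.length • f t
  map_add' f g := by ext t; simp
  map_smul' c f := by ext t; simp [smul_comm c]

lemma parity_apply (f : List H → M) (t : List H) :
    parity K f t = (-1 : K) ^ t.length • f t := rfl

lemma parity_parity (f : List H → M) : parity K (parity K f) = f := by
  ext t
  rw [parity_apply, parity_apply, smul_smul, ← mul_pow]
  simp

lemma contract_parity (X : H) (f : List H → M) :
    contract K X (parity K f) = -parity K (contract K X f) := by
  ext t
  simp [contract_apply, parity_apply, pow_succ]

/-- `f` is `ε`-alternating: it is multiplied by `-ε |X| |Y|` when two neighbours `X`, `Y` are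
exchanged. -/
def IsAlt (f : List H → M) : Prop :=
  ∀ s t X Y, f (s ++ X :: Y :: t) = -((ε (deg X) (deg Y) : K) • f (s ++ Y :: X :: t))

/-- `f` is supported on the lists of length `n`. -/
def HasArity (n : ℕ) (f : List H → M) : Prop := ∀ t, t.length ≠ n → f t = 0

variable {ε deg}

lemma IsAlt.contraction {f : List H → M} (hf : IsAlt ε deg f) (X : H) :
    IsAlt ε deg (contract K X f) := fun s t Y Z => hf (X :: s) t Y Z

lemma HasArity.contraction {f : List H → M} {n : ℕ} (hf : HasArity (n + 1) f) (X : H) :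
    HasArity n (contract K X f) := fun t ht => hf (X :: t) (by simpa using ht)

lemma HasArity.contraction_eq_zero {f : List H → M} (hf : HasArity 0 f) (X : H) :
    contract K X f = 0 := by
  ext t
  exact hf (X :: t) (by simp)

lemma HasArity.parity_eq {f : List H → M} {n : ℕ} (hf : HasArity n f) :
    parity K f = (-1 : K) ^ n • f := by
  ext t
  rw [parity_apply, Pi.smul_apply]
  by_cases h : t.length = n
  · rw [h]
  · rw [hf t h, smul_zero, smul_zero]

end Module

variable {A : Type*} [Ring A] [Algebra K A]

/-! ### The product -/

/-- The recursion `(f g)(X, ...) = ε l |X| (f(X, ...) g)(...) + ± (f g(X, ...))(...)`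
defining the product of `f` by a form `g` of degree `l`. -/
def mulAux : List H → Γ → (List H → A) → (List H → A) → A
  | [], _, f, g => f [] * g []
  | X :: t, l, f, g => (ε l (deg X) : K) • mulAux t l (contract K X f) g +
      mulAux t (l + deg X) (parity K f) (contract K X g)

/-- The product of functions of lists, the second one being of degree `l`. -/
def formMul (l : Γ) : (List H → A) →ₗ[K] (List H → A) →ₗ[K] (List H → A) :=
  LinearMap.mk₂ K (fun f g t => mulAux ε deg t l f g)
    (fun f f' g => by
      ext t
      change mulAux ε deg t l (f + f') g = mulAux ε deg t l f g + mulAux ε deg t l f' g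
      induction t generalizing l f f' g with
      | nil => simp [mulAux, add_mul]
      | cons X t ih => simp only [mulAux, map_add, ih, smul_add]; abel)
    (fun c f g => by
      ext t
      change mulAux ε deg t l (c • f) g = c • mulAux ε deg t l f g
      induction t generalizing l f g with
      | nil => simp [mulAux]
      | cons X t ih => simp only [mulAux, map_smul, ih, smul_add, smul_comm c])
    (fun f g g' => by
      ext t
      change mulAux ε deg t l f (g + g') = mulAux ε deg t l f g + mulAux ε deg t l f g'
      induction t generalizing l f g g' with
      | nil => simp [mulAux, mul_add]
      | cons X t ih => simp only [mulAux, map_add, ih, smul_add]; abel)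
    (fun c f g => by
      ext t
      change mulAux ε deg t l f (c • g) = c • mulAux ε deg t l f g
      induction t generalizing l f g with
      | nil => simp [mulAux]
      | cons X t ih => simp only [mulAux, map_smul, ih, smul_add, smul_comm c])

lemma formMul_nil (l : Γ) (f g : List H → A) : formMul ε deg l f g [] = f [] * g [] := rfl

/-- The contraction is an `ε`-antiderivation of the product. -/
lemma contract_formMul (l : Γ) (f g : List H → A) (X : H) :
    contract K X (formMul ε deg l f g) =
      (ε l (deg X) : K) • formMul ε deg l (contract K X f) g +
      formMul ε deg (l + deg X) (parity K f) (contract K X g) := rfl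

lemma formMul_cons (l : Γ) (f g : List H → A) (X : H) (t : List H) :
    formMul ε deg l f g (X :: t) =
      (ε l (deg X) : K) • formMul ε deg l (contract K X f) g t +
      formMul ε deg (l + deg X) (parity K f) (contract K X g) t := rfl

lemma parity_formMul (l : Γ) (f g : List H → A) :
    parity K (formMul ε deg l f g) =
      formMul ε deg l (parity K f) (parity K g) := by
  ext t
  induction t generalizing l f g with
  | nil => simp [parity_apply, formMul_nil]
  | cons X t ih =>
    have h1 := ih l (contract K X f) g
    have h2 := ih (l + deg X) (parity K f) (contract K X g)
    rw [parity_apply] at h1 h2 ⊢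
    simp only [formMul_cons, contract_parity, map_neg, List.length_cons, pow_succ,
      LinearMap.neg_apply, Pi.neg_apply, ← h1, ← h2]
    module

/-- Associativity, by induction on the number of arguments: by `contract_formMul`, the contractions
of both sides by an element are the same sums of triple products of forms with fewer arguments. -/
theorem formMul_assoc (l m : Γ) (f g h : List H → A) :
    formMul ε deg m (formMul ε deg l f g) h = formMul ε deg (l + m) f (formMul ε deg m g h) := by
  ext t
  induction t generalizing l m f g h with
  | nil => simp [formMul_nil, mul_assoc]
  | cons X t ih =>
    simp only [formMul_cons, contract_formMul, parity_formMul, map_add, map_smul, Pi.add_apply,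
      Pi.smul_apply, LinearMap.add_apply, LinearMap.smul_apply, ih]
    rw [factor_add_left, add_right_comm l, ← add_assoc l m]
    module

section

variable {ε deg}

lemma HasArity.mul {p q : ℕ} {f g : List H → A} (hf : HasArity p f) (hg : HasArity q g)
    (l : Γ) : HasArity (p + q) (formMul ε deg l f g) := by
  intro t
  induction t generalizing l p q f g with
  | nil =>
    intro ht
    rw [formMul_nil]
    rcases Nat.eq_zero_or_pos p with h | h
    · rw [hg [] (by simp at ht ⊢; omega), mul_zero]
    · rw [hf [] (by simp; omega), zero_mul]
  | cons X t ih =>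
    intro ht
    simp only [List.length_cons] at ht
    rw [formMul_cons, hf.parity_eq (K := K)]
    have h1 : formMul ε deg l (contract K X f) g t = 0 := by
      rcases p with _ | p
      · rw [hf.contraction_eq_zero]; simp
      · exact ih (hf.contraction X) hg l (by omega)
    have h2 : formMul ε deg (l + deg X) f (contract K X g) t = 0 := by
      rcases q with _ | q
      · rw [hg.contraction_eq_zero]; simp
      · exact ih hf (hg.contraction X) _ (by omega)
    simp [h1, h2]

lemma IsAlt.sign {f : List H → A} (hf : IsAlt ε deg f) : IsAlt ε deg (parity K f) := by
  intro s t X Y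
  simp only [parity_apply, hf s t X Y, List.length_append, List.length_cons, smul_neg]
  rw [smul_comm]

lemma IsAlt.add {f g : List H → A} (hf : IsAlt ε deg f) (hg : IsAlt ε deg g) :
    IsAlt ε deg (f + g) := by
  intro s t X Y
  rw [Pi.add_apply, hf s t X Y, hg s t X Y, Pi.add_apply, smul_add, neg_add]

lemma IsAlt.smul {f : List H → A} (hf : IsAlt ε deg f) (c : K) :
    IsAlt ε deg (c • f) := by
  intro s t X Y
  rw [Pi.smul_apply, hf s t X Y, Pi.smul_apply, smul_neg, smul_comm]

lemma IsAlt.contract_swap {f : List H → A} (hf : IsAlt ε deg f) (X Y : H) :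
    contract K Y (contract K X f) = -((ε (deg X) (deg Y) : K) •
      contract K X (contract K Y f)) := by
  ext t
  exact hf [] t X Y

lemma IsAlt.mul {f g : List H → A} (hf : IsAlt ε deg f) (hg : IsAlt ε deg g) (l : Γ) :
    IsAlt ε deg (formMul ε deg l f g) := by
  intro s
  induction s generalizing l f g with
  | nil =>
    intro t X Y
    have h1 := hf.contract_swap X Y
    have h2 := hg.contract_swap X Y
    replace h1 := congrFun (congrArg (fun u => formMul ε deg l u g) h1) t
    replace h2 := congrFun (congrArg (formMul ε deg (l + deg X + deg Y) f) h2) t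
    simp only [map_neg, map_smul, Pi.neg_apply, Pi.smul_apply, LinearMap.neg_apply,
      LinearMap.smul_apply] at h1 h2
    simp only [List.nil_append, formMul_cons, contract_parity, map_neg, LinearMap.neg_apply,
      Pi.neg_apply, h1, h2, parity_parity, factor_add_left, add_right_comm l (deg Y)]
    linear_combination (norm := module) (-(ε l (deg X) : K) * factor_mul_swap ε (deg X) (deg Y)) •
      formMul ε deg (l + deg Y) (parity K (contract K X f)) (contract K Y g) t
  | cons Z s ih =>
    intro t X Y
    simp only [List.cons_append, formMul_cons, ih (hf.contraction Z) hg l t X Y,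
      ih hf.sign (hg.contraction Z) _ t X Y]
    module

end

/-! ### The Lie derivative and the differential -/

variable (brk : H → H → H) (ρ : H → A →ₗ[K] A)

/-- The recursion defining the Lie derivative along `X` of a form `f` of degree `k`. -/
def lieAux : List H → Γ → H → (List H → A) → A
  | [], k, X, f => (ε k (deg X) : K) • ρ X (f [])
  | Y :: t, k, X, f => (ε (deg X) (deg Y) : K) • lieAux t (k + deg Y) X (contract K Y f) -
      f (brk X Y :: t)

/-- The Lie derivative along `X` of functions of lists of degree `k`, written as an operator acting
from the right: it differs by the factor `ε k |X|` from
`(Y₁, ...) ↦ X (f(Y₁, ...)) - ∑ ± f(Y₁, ..., [X, Yᵢ], ...)`. -/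
def lieDer (k : Γ) (X : H) : (List H → A) →ₗ[K] (List H → A) where
  toFun f t := lieAux ε deg brk ρ t k X f
  map_add' f g := by
    ext t
    change lieAux ε deg brk ρ t k X (f + g) =
      lieAux ε deg brk ρ t k X f + lieAux ε deg brk ρ t k X g
    induction t generalizing k f g with
    | nil => simp [lieAux]
    | cons Y t ih => simp only [lieAux, map_add, ih, smul_add, Pi.add_apply]; abel
  map_smul' c f := by
    ext t
    change lieAux ε deg brk ρ t k X (c • f) = c • lieAux ε deg brk ρ t k X f
    induction t generalizing k f with
    | nil => simp [lieAux, smul_comm c]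
    | cons Y t ih => simp only [lieAux, map_smul, ih, smul_sub, smul_comm c, Pi.smul_apply]

lemma lieDer_nil (k : Γ) (X : H) (f : List H → A) :
    lieDer ε deg brk ρ k X f [] = (ε k (deg X) : K) • ρ X (f []) := rfl

lemma contract_lieDer (k : Γ) (X Y : H) (f : List H → A) :
    contract K Y (lieDer ε deg brk ρ k X f) =
      (ε (deg X) (deg Y) : K) • lieDer ε deg brk ρ (k + deg Y) X (contract K Y f) -
        contract K (brk X Y) f := rfl

lemma lieDer_cons (k : Γ) (X Y : H) (f : List H → A) (t : List H) :
    lieDer ε deg brk ρ k X f (Y :: t) =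
      (ε (deg X) (deg Y) : K) • lieDer ε deg brk ρ (k + deg Y) X (contract K Y f) t -
        contract K (brk X Y) f t := rfl

/-- The recursion defining the differential of a form `f` of degree `k` by Cartan's formula. -/
def difAux : List H → Γ → (List H → A) → A
  | [], _, _ => 0
  | X :: t, k, f => lieDer ε deg brk ρ k X f t - difAux t (k + deg X) (contract K X f)

/-- The differential of functions of lists of degree `k`. -/
def dif (k : Γ) : (List H → A) →ₗ[K] (List H → A) where
  toFun f t := difAux ε deg brk ρ t k f
  map_add' f g := by
    ext t
    change difAux ε deg brk ρ t k (f + g) = difAux ε deg brk ρ t k f + difAux ε deg brk ρ t k g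
    induction t generalizing k f g with
    | nil => simp [difAux]
    | cons Y t ih => simp only [difAux, map_add, ih, Pi.add_apply]; abel
  map_smul' c f := by
    ext t
    change difAux ε deg brk ρ t k (c • f) = c • difAux ε deg brk ρ t k f
    induction t generalizing k f with
    | nil => simp [difAux]
    | cons Y t ih => simp only [difAux, map_smul, ih, smul_sub, Pi.smul_apply]

lemma dif_nil (k : Γ) (f : List H → A) : dif ε deg brk ρ k f [] = 0 := rfl

/-- Cartan's formula. -/
lemma contract_dif (k : Γ) (X : H) (f : List H → A) :
    contract K X (dif ε deg brk ρ k f) =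
      lieDer ε deg brk ρ k X f - dif ε deg brk ρ (k + deg X) (contract K X f) := rfl

lemma dif_cons (k : Γ) (X : H) (f : List H → A) (t : List H) :
    dif ε deg brk ρ k f (X :: t) =
      lieDer ε deg brk ρ k X f t - dif ε deg brk ρ (k + deg X) (contract K X f) t := rfl

lemma parity_lieDer (k : Γ) (X : H) (f : List H → A) :
    parity K (lieDer ε deg brk ρ k X f) = lieDer ε deg brk ρ k X (parity K f) := by
  ext t
  induction t generalizing k f with
  | nil => simp [parity_apply, lieDer_nil]
  | cons Y t ih =>
    have h1 := ih (k + deg Y) (contract K Y f)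
    rw [parity_apply] at h1 ⊢
    simp only [lieDer_cons, contract_parity, map_neg, Pi.neg_apply, List.length_cons, pow_succ,
      ← h1]
    rw [parity_apply]
    module

lemma parity_dif (k : Γ) (f : List H → A) :
    parity K (dif ε deg brk ρ k f) = -dif ε deg brk ρ k (parity K f) := by
  ext t
  induction t generalizing k f with
  | nil => simp [parity_apply, dif_nil]
  | cons Y t ih =>
    have h1 := ih (k + deg Y) (contract K Y f)
    rw [Pi.neg_apply, parity_apply] at h1 ⊢
    simp only [dif_cons, contract_parity, map_neg, Pi.neg_apply, List.length_cons, pow_succ,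
      ← parity_lieDer]
    rw [parity_apply, ← h1]
    module

section Arity

variable {ε deg brk ρ}

lemma HasArity.lieDer {p : ℕ} {f : List H → A} (hf : HasArity p f) (k : Γ) (X : H) :
    HasArity p (lieDer ε deg brk ρ k X f) := by
  intro t
  induction t generalizing k p f with
  | nil => intro ht; rw [lieDer_nil, hf [] ht]; simp
  | cons Y t ih =>
    intro ht
    rw [lieDer_cons]
    rcases p with _ | p
    · rw [hf.contraction_eq_zero, hf.contraction_eq_zero]; simp
    · rw [ih (hf.contraction Y) _ (by simpa using ht),
        hf.contraction (brk X Y) t (by simpa using ht)]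
      simp

lemma HasArity.dif {p : ℕ} {f : List H → A} (hf : HasArity p f) (k : Γ) :
    HasArity (p + 1) (dif ε deg brk ρ k f) := by
  intro t
  induction t generalizing k p f with
  | nil => intro ht; rfl
  | cons Y t ih =>
    intro ht
    simp only [List.length_cons] at ht
    rw [dif_cons, hf.lieDer k Y t (by omega)]
    rcases p with _ | p
    · rw [hf.contraction_eq_zero]; simp
    · rw [ih (hf.contraction Y) _ (by omega), sub_zero]

end Arity

/-! ### Compatibility with the gradings and with the Lie bracket -/

section Compatibility

variable (𝒜 : Γ → Submodule K A)

/-- `f` is homogeneous of degree `k`. -/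
def HasDegree (k : Γ) (f : List H → A) : Prop := ∀ t, f t ∈ 𝒜 (k + (t.map deg).sum)

/-- `f` is compatible with the antisymmetry of the bracket and with the Jacobi identity. This holds
if `f` is linear in each entry and the bracket is that of an `ε`-Lie algebra. -/
structure IsLieCompatible (f : List H → A) : Prop where
  skew : ∀ s t X Y, f (s ++ brk X Y :: t) = -((ε (deg X) (deg Y) : K) • f (s ++ brk Y X :: t))
  jacobi : ∀ s t X Y Z, f (s ++ brk X (brk Y Z) :: t) = f (s ++ brk (brk X Y) Z :: t) +
    (ε (deg X) (deg Y) : K) • f (s ++ brk Y (brk X Z) :: t)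

/-- `H` consists of homogeneous elements, acting on `A` by `ε`-derivations, and `brk` acts as the
`ε`-commutator. -/
structure IsDerAction : Prop where
  deg_brk : ∀ X Y, deg (brk X Y) = deg X + deg Y
  mem : ∀ X i, ∀ a ∈ 𝒜 i, ρ X a ∈ 𝒜 (deg X + i)
  leibniz : ∀ X i, ∀ a ∈ 𝒜 i, ∀ b, ρ X (a * b) = ρ X a * b + (ε (deg X) i : K) • (a * ρ X b)
  bracket : ∀ X Y a, ρ (brk X Y) a = ρ X (ρ Y a) - (ε (deg X) (deg Y) : K) • ρ Y (ρ X a)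

variable {ε deg brk ρ 𝒜}

lemma IsLieCompatible.contraction {f : List H → A} (hf : IsLieCompatible ε deg brk f) (X : H) :
    IsLieCompatible ε deg brk (contract K X f) :=
  ⟨fun s t Y Z => hf.skew (X :: s) t Y Z, fun s t Y Z W => hf.jacobi (X :: s) t Y Z W⟩

lemma HasDegree.contraction {k : Γ} {f : List H → A} (hf : HasDegree deg 𝒜 k f) (X : H) :
    HasDegree deg 𝒜 (k + deg X) (contract K X f) := by
  intro t
  have := hf (X :: t)
  rwa [List.map_cons, List.sum_cons, ← add_assoc] at this

lemma HasDegree.add {k : Γ} {f g : List H → A} (hf : HasDegree deg 𝒜 k f)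
    (hg : HasDegree deg 𝒜 k g) : HasDegree deg 𝒜 k (f + g) :=
  fun t => Submodule.add_mem _ (hf t) (hg t)

lemma HasDegree.smul {k : Γ} {f : List H → A} (hf : HasDegree deg 𝒜 k f) (c : K) :
    HasDegree deg 𝒜 k (c • f) :=
  fun t => Submodule.smul_mem _ c (hf t)

lemma HasDegree.sign {k : Γ} {f : List H → A} (hf : HasDegree deg 𝒜 k f) :
    HasDegree deg 𝒜 k (parity K f) :=
  fun t => Submodule.smul_mem _ _ (hf t)

lemma HasDegree.mul [SetLike.GradedMul 𝒜] {k l : Γ} {f g : List H → A}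
    (hf : HasDegree deg 𝒜 k f) (hg : HasDegree deg 𝒜 l g) :
    HasDegree deg 𝒜 (k + l) (formMul ε deg l f g) := by
  intro t
  induction t generalizing k l f g with
  | nil =>
    have := SetLike.GradedMul.mul_mem (hf []) (hg [])
    rw [formMul_nil]
    simpa using this
  | cons X t ih =>
    have h1 := ih (hf.contraction X) hg
    have h2 := ih hf.sign (hg.contraction X)
    rw [List.map_cons, List.sum_cons, formMul_cons]
    refine Submodule.add_mem _ (Submodule.smul_mem _ _ ?_) ?_
    · convert h1 using 2; abel
    · convert h2 using 2; abel

lemma HasDegree.lieDer (hρ : IsDerAction ε deg brk ρ 𝒜) {k : Γ} {f : List H → A}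
    (hf : HasDegree deg 𝒜 k f) (X : H) :
    HasDegree deg 𝒜 (k + deg X) (lieDer ε deg brk ρ k X f) := by
  intro t
  induction t generalizing k f with
  | nil =>
    have := hρ.mem X _ _ (hf [])
    rw [lieDer_nil]
    refine Submodule.smul_mem _ _ ?_
    convert this using 2; simp [add_comm]
  | cons Y t ih =>
    have h1 := ih (hf.contraction Y)
    have h2 := hf.contraction (brk X Y) t
    rw [lieDer_cons, List.map_cons, List.sum_cons]
    refine Submodule.sub_mem _ (Submodule.smul_mem _ _ ?_) ?_
    · convert h1 using 2; abel
    · convert h2 using 2; rw [hρ.deg_brk]; abel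

lemma HasDegree.dif (hρ : IsDerAction ε deg brk ρ 𝒜) {k : Γ} {f : List H → A}
    (hf : HasDegree deg 𝒜 k f) : HasDegree deg 𝒜 k (dif ε deg brk ρ k f) := by
  intro t
  induction t generalizing k f with
  | nil => exact Submodule.zero_mem _
  | cons X t ih =>
    rw [dif_cons, List.map_cons, List.sum_cons, ← add_assoc]
    exact Submodule.sub_mem _ (hf.lieDer hρ X t) (ih (hf.contraction X))

/-- The Lie derivative along `X` is an `ε`-derivation of the product. -/
lemma lieDer_formMul (hρ : IsDerAction ε deg brk ρ 𝒜) {k : Γ} {f : List H → A}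
    (hf : HasDegree deg 𝒜 k f) (l : Γ) (g : List H → A) (X : H) :
    lieDer ε deg brk ρ (k + l) X (formMul ε deg l f g) =
      (ε l (deg X) : K) • formMul ε deg l (lieDer ε deg brk ρ k X f) g +
        formMul ε deg (l + deg X) f (lieDer ε deg brk ρ l X g) := by
  ext t
  induction t generalizing k l f g with
  | nil =>
    have h0 : f [] ∈ 𝒜 k := by simpa using hf []
    simp only [lieDer_nil, formMul_nil, Pi.add_apply, Pi.smul_apply, hρ.leibniz X k _ h0,
      factor_add_left, smul_mul_assoc, mul_smul_comm]
    linear_combination (norm := module)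
      ((ε l (deg X) : K) * factor_mul_swap ε k (deg X)) • (f [] * ρ X (g []))
  | cons Y t ih =>
    have h1 := ih (hf.contraction Y) l g
    have h2 := ih hf.sign (l + deg Y) (contract K Y g)
    rw [add_right_comm] at h1
    rw [← add_assoc] at h2
    simp only [lieDer_cons, contract_formMul, map_add, map_smul, Pi.add_apply, Pi.smul_apply,
      h1, h2, formMul_cons, contract_lieDer, map_sub, LinearMap.sub_apply, Pi.sub_apply,
      LinearMap.smul_apply, hρ.deg_brk, factor_add_right, factor_add_left, ← parity_lieDer]
    rw [add_right_comm l (deg Y), ← add_assoc l]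
    linear_combination (norm := module) ((ε l (deg X) : K) * factor_mul_swap ε (deg X) (deg Y)) •
      formMul ε deg (l + deg Y) (parity K (lieDer ε deg brk ρ k X f)) (contract K Y g) t

/-- The Lie derivatives represent the bracket. -/
lemma lieDer_lieDer (hρ : IsDerAction ε deg brk ρ 𝒜) {f : List H → A}
    (hf : IsLieCompatible ε deg brk f) (k : Γ) (X Y : H) :
    lieDer ε deg brk ρ (k + deg X) Y (lieDer ε deg brk ρ k X f) =
      (ε (deg X) (deg Y) : K) •
        lieDer ε deg brk ρ (k + deg Y) X (lieDer ε deg brk ρ k Y f) -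
      lieDer ε deg brk ρ k (brk X Y) f := by
  ext t
  induction t generalizing k f with
  | nil =>
    simp only [lieDer_nil, Pi.sub_apply, Pi.smul_apply, hρ.bracket, hρ.deg_brk, map_smul,
      factor_add_right, factor_add_left]
    linear_combination (norm := module)
      (-(ε k (deg Y) : K) * ε k (deg X) * factor_mul_swap ε (deg X) (deg Y)) • (ρ X (ρ Y (f [])))
  | cons Z t ih =>
    have h1 := ih (hf.contraction Z) (k + deg Z)
    have h2 := hf.jacobi [] t X Y Z
    simp only [List.nil_append] at h2
    simp only [Pi.sub_apply, Pi.smul_apply, lieDer_cons, contract_lieDer, map_sub, map_smul,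
      hρ.deg_brk, factor_add_right, factor_add_left, contract_apply, h2,
      add_right_comm k (deg X), add_right_comm k (deg Y), h1, ← add_assoc]
    linear_combination (norm := module)
      ((ε (deg Y) (deg Z) : K) * factor_mul_swap ε (deg X) (deg Y)) •
      (lieDer ε deg brk ρ (k + deg Z + deg X) Y (contract K (brk X Z) f) t)

/-- The differential commutes with the Lie derivatives. -/
lemma dif_lieDer (hρ : IsDerAction ε deg brk ρ 𝒜) {f : List H → A}
    (hf : IsLieCompatible ε deg brk f) (k : Γ) (X : H) :
    dif ε deg brk ρ (k + deg X) (lieDer ε deg brk ρ k X f) =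
      lieDer ε deg brk ρ k X (dif ε deg brk ρ k f) := by
  ext t
  induction t generalizing k f with
  | nil => simp [dif_nil, lieDer_nil]
  | cons Y t ih =>
    have h1 := ih (hf.contraction Y) (k + deg Y)
    have h2 := lieDer_lieDer hρ hf k X Y
    simp only [dif_cons, lieDer_cons, h2, contract_lieDer, contract_dif, map_sub,
      map_smul, Pi.sub_apply, Pi.smul_apply, add_right_comm k (deg X), h1, hρ.deg_brk, ← add_assoc]
    module

/-- The differential squares to zero: by Cartan's formula, `contract X (d (d f))` is the sum of
`d (d (contract X f))`, which vanishes by induction, and of the difference of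
`lieDer X (d f)` and `d (lieDer X f)`, which vanishes by `dif_lieDer`. -/
theorem dif_dif (hρ : IsDerAction ε deg brk ρ 𝒜) {f : List H → A}
    (hf : IsLieCompatible ε deg brk f) (k : Γ) :
    dif ε deg brk ρ k (dif ε deg brk ρ k f) = 0 := by
  ext t
  induction t generalizing k f with
  | nil => rfl
  | cons X t ih =>
    have h1 := ih (hf.contraction X) (k + deg X)
    simp only [dif_cons, contract_dif, map_sub, Pi.sub_apply, h1, dif_lieDer hρ hf, Pi.zero_apply]
    module

/-- The Leibniz rule, by induction on the number of arguments: by Cartan's formula, it follows from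
the rules for the Lie derivative and for the contraction. -/
theorem dif_formMul (hρ : IsDerAction ε deg brk ρ 𝒜) {k : Γ} {f : List H → A}
    (hf : HasDegree deg 𝒜 k f) (l : Γ) (g : List H → A) :
    dif ε deg brk ρ (k + l) (formMul ε deg l f g) =
      formMul ε deg l (dif ε deg brk ρ k f) g +
        formMul ε deg l (parity K f) (dif ε deg brk ρ l g) := by
  ext t
  induction t generalizing k l f g with
  | nil => simp [formMul_nil, dif_nil]
  | cons X t ih =>
    have h1 := ih (hf.contraction X) l g
    have h2 := ih hf.sign (l + deg X) (contract K X g)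
    rw [add_right_comm] at h1
    rw [← add_assoc] at h2
    simp only [dif_cons, lieDer_formMul hρ hf, contract_formMul, map_add, map_smul, Pi.add_apply,
      Pi.smul_apply, h1, h2, formMul_cons, contract_dif, map_sub, LinearMap.sub_apply,
      Pi.sub_apply, parity_dif, contract_parity, map_neg, LinearMap.neg_apply, Pi.neg_apply,
      parity_parity]
    module

lemma IsAlt.lieDer (hρ : IsDerAction ε deg brk ρ 𝒜) {f : List H → A} (hf : IsAlt ε deg f)
    (k : Γ) (W : H) : IsAlt ε deg (lieDer ε deg brk ρ k W f) := by
  intro s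
  induction s generalizing k f with
  | nil =>
    intro t X Y
    have h1 := hf.contract_swap X Y
    have h2 := hf [] t X (brk W Y)
    have h3 := hf [] t (brk W X) Y
    simp only [List.nil_append] at h2 h3
    simp only [List.nil_append, lieDer_cons, Pi.smul_apply, h1, map_neg, map_smul, Pi.neg_apply,
      contract_apply, h2, h3, hρ.deg_brk, factor_add_right, factor_add_left,
      add_right_comm k (deg X)]
    linear_combination (norm := module) ((ε (deg X) (deg Y) : K) *
      factor_mul_swap ε (deg W) (deg X)) • f (brk W Y :: X :: t)
  | cons Z s ih =>
    intro t X Y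
    have h2 := hf.contraction (brk W Z) s t X Y
    simp only [List.cons_append, lieDer_cons, ih (hf.contraction Z) _ t X Y, h2]
    module

lemma IsAlt.dif (hρ : IsDerAction ε deg brk ρ 𝒜) {f : List H → A} (hf : IsAlt ε deg f)
    (hf' : IsLieCompatible ε deg brk f) (k : Γ) : IsAlt ε deg (dif ε deg brk ρ k f) := by
  intro s
  induction s generalizing k f with
  | nil =>
    intro t X Y
    have h1 := hf.contract_swap X Y
    have h2 := hf'.skew [] t X Y
    simp only [List.nil_append] at h2
    simp only [List.nil_append, dif_cons, lieDer_cons, contract_apply, h1, h2, map_neg, map_smul,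
      Pi.neg_apply, Pi.smul_apply, add_right_comm k (deg X)]
    linear_combination (norm := module) (factor_mul_swap ε (deg X) (deg Y)) •
      EpsGraded.lieDer ε deg brk ρ (k + deg X) Y (contract K X f) t
  | cons Z s ih =>
    intro t X Y
    simp only [List.cons_append, dif_cons, ih (hf.contraction Z) (hf'.contraction Z) _ t X Y,
      hf.lieDer hρ k Z s t X Y]
    module

end Compatibility

end ListForms
end EpsGraded

namespace EpsGraded

/-! ### Permutations and insertions -/

section Permutations

/-- The permutation of `Fin (n + 1)` which sends `i` to `0` and the other elements, in their order,
to the successors of the values of `τ`. -/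
def insertPerm {n : ℕ} (i : Fin (n + 1)) (τ : Equiv.Perm (Fin n)) : Equiv.Perm (Fin (n + 1)) :=
  (finSuccEquiv' i).trans ((Equiv.optionCongr τ).trans (finSuccEquiv' 0).symm)

lemma insertPerm_self {n : ℕ} (i : Fin (n + 1)) (τ : Equiv.Perm (Fin n)) :
    insertPerm i τ i = 0 := by
  simp [insertPerm]

lemma insertPerm_succAbove {n : ℕ} (i : Fin (n + 1)) (τ : Equiv.Perm (Fin n)) (j : Fin n) :
    insertPerm i τ (i.succAbove j) = (τ j).succ := by
  simp [insertPerm]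

lemma insertPerm_bijective (n : ℕ) : Function.Bijective
    (fun a : Fin (n + 1) × Equiv.Perm (Fin n) => insertPerm a.1 a.2) := by
  rw [Fintype.bijective_iff_injective_and_card]
  refine ⟨?_, by simp [Fintype.card_perm, Nat.factorial_succ]⟩
  rintro ⟨i, τ⟩ ⟨j, υ⟩ h
  simp only at h
  have hij : i = j := by
    apply (insertPerm i τ).injective
    rw [insertPerm_self, h, insertPerm_self]
  subst hij
  refine Prod.ext rfl (Equiv.ext fun k => Fin.succ_injective _ ?_)
  simp only
  rw [← insertPerm_succAbove i, h, insertPerm_succAbove]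

/-- The inversions of `insertPerm i τ` are those of `τ` and those of `0`, in place `i`, with the
elements in the places before `i`. -/
lemma prod_inversions_insertPerm {M : Type*} [CommMonoid M] {n : ℕ}
    (w : Fin (n + 1) → Fin (n + 1) → M) (i : Fin (n + 1)) (τ : Equiv.Perm (Fin n)) :
    (∏ a : Fin (n + 1) × Fin (n + 1), if a.1 < a.2 ∧ insertPerm i τ a.2 < insertPerm i τ a.1
      then w (insertPerm i τ a.2) (insertPerm i τ a.1) else 1) =
    (∏ j : Fin n, if j.castSucc < i then w 0 (τ j).succ else 1) *
      ∏ a : Fin n × Fin n,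
        if a.1 < a.2 ∧ τ a.2 < τ a.1 then w (τ a.2).succ (τ a.1).succ else 1 := by
  rw [Fintype.prod_prod_type, Fin.prod_univ_succAbove _ i, Fintype.prod_prod_type]
  simp only [one_mul, Fin.prod_univ_succAbove _ i, insertPerm_self, insertPerm_succAbove,
    Fin.succAbove_lt_succAbove_iff, Fin.succ_lt_succ_iff, Fin.succAbove_lt_iff_castSucc_lt,
    Fin.succ_pos, and_true, Finset.prod_mul_distrib, Fin.not_lt_zero, and_false, if_false,
    Finset.prod_const_one]

lemma sign_eq_prod_inversions {n : ℕ} (σ : Equiv.Perm (Fin n)) :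
    Equiv.Perm.sign σ = ∏ a : Fin n × Fin n, if a.1 < a.2 ∧ σ a.2 < σ a.1 then -1 else 1 := by
  rw [Equiv.Perm.sign_eq_prod_prod_Ioi, Fintype.prod_prod_type]
  refine Finset.prod_congr rfl fun i _ => ?_
  simp only [ite_and]
  rw [← Finset.prod_filter]
  refine Finset.prod_congr (by ext; simp) fun j hj => ?_
  have hne : σ i ≠ σ j := fun h => (Finset.mem_filter.mp hj).2.ne (σ.injective h)
  rcases lt_or_gt_of_ne hne with h | h
  · rw [if_pos h, if_neg h.not_gt]
  · rw [if_neg h.not_gt, if_pos h]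

end Permutations

section Antisymmetrization

variable {Γ K : Type*} [AddCommGroup Γ] [Field K] (ε : CommutationFactor Γ K)
variable {H : Type*} (deg : H → Γ)

/-- The factor `sign σ * inversionFactor d σ` by which an `ε`-alternating function changes under the
permutation `σ` of elements of degrees `d`. -/
def altFactor {n : ℕ} (d : Fin n → Γ) (σ : Equiv.Perm (Fin n)) : K :=
  ((Equiv.Perm.sign σ : ℤ) : K) * (inversionFactor ε d σ : K)

lemma altFactor_insertPerm {n : ℕ} (d : Fin (n + 1) → Γ) (i : Fin (n + 1))
    (τ : Equiv.Perm (Fin n)) : altFactor ε d (insertPerm i τ) =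
      (∏ j : Fin n with j.val < (i : ℕ), -(ε (d 0) (d (τ j).succ) : K)) *
        altFactor ε (fun j => d j.succ) τ := by
  have h1 : Equiv.Perm.sign (insertPerm i τ) =
      (∏ j : Fin n with j.val < (i : ℕ), (-1 : ℤˣ)) * Equiv.Perm.sign τ := by
    rw [sign_eq_prod_inversions, sign_eq_prod_inversions,
      prod_inversions_insertPerm (fun _ _ => (-1 : ℤˣ)), Finset.prod_filter]
    rfl
  have h2 : inversionFactor ε d (insertPerm i τ) =
      (∏ j : Fin n with j.val < (i : ℕ), ε (d 0) (d (τ j).succ)) *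
        inversionFactor ε (fun j => d j.succ) τ := by
    rw [inversionFactor, prod_inversions_insertPerm (fun a b => ε (d a) (d b)), Finset.prod_filter]
    rfl
  have h3 : (∏ j : Fin n with j.val < (i : ℕ), -(ε (d 0) (d (τ j).succ) : K)) =
      (∏ j : Fin n with j.val < (i : ℕ), (-1 : K)) *
        ∏ j : Fin n with j.val < (i : ℕ), (ε (d 0) (d (τ j).succ) : K) := by
    rw [← Finset.prod_mul_distrib]
    exact Finset.prod_congr rfl fun _ _ => (neg_one_mul _).symm
  simp only [altFactor, h1, h2, h3, Finset.prod_const, Units.val_mul, Units.val_pow_eq_pow_val,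
    Units.val_neg, Units.val_one, Units.coe_prod]
  push_cast
  ring

/-- The factor `∏ -ε |x| |y|`, over the first `i` entries `y` of `t`, by which an alternating
function of `x :: t` changes when `x` is moved past these entries. -/
def moveFactor (x : H) (i : ℕ) (t : List H) : K :=
  ((t.take i).map fun y => -(ε (deg x) (deg y) : K)).prod

lemma moveFactor_ofFn {n : ℕ} (x : H) (i : ℕ) (Y : Fin n → H) :
    moveFactor ε deg x i (List.ofFn Y) =
      ∏ j : Fin n with j.val < i, -(ε (deg x) (deg (Y j)) : K) := by
  rw [moveFactor, List.map_take, List.map_ofFn, List.prod_take_ofFn]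
  rfl

lemma ofFn_comp_insertPerm {n : ℕ} (X : Fin (n + 1) → H) (i : Fin (n + 1))
    (τ : Equiv.Perm (Fin n)) : List.ofFn (fun j => X (insertPerm i τ j)) =
      (List.ofFn fun j => X (τ j).succ).insertIdx i (X 0) := by
  refine List.ext_getElem ?_ fun j h1 h2 => ?_
  · rw [List.length_insertIdx_of_le_length (by simpa using Nat.lt_succ_iff.mp i.2)]
    simp
  · have hj : j < n + 1 := by simpa using h1
    rw [List.getElem_ofFn, List.getElem_insertIdx]
    simp only [List.getElem_ofFn]
    split_ifs with h3 h4
    · have : (⟨j, hj⟩ : Fin (n + 1)) = i.succAbove ⟨j, by omega⟩ := by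
        rw [Fin.succAbove_of_castSucc_lt _ _ (by simpa [Fin.lt_def] using h3)]
        rfl
      rw [this, insertPerm_succAbove]
    · have : (⟨j, hj⟩ : Fin (n + 1)) = i := Fin.ext h4
      rw [this, insertPerm_self]
    · have : (⟨j, hj⟩ : Fin (n + 1)) = i.succAbove ⟨j - 1, by omega⟩ := by
        rw [Fin.succAbove_of_le_castSucc _ _ (by simp [Fin.le_def]; omega)]
        ext
        simp; omega
      rw [this, insertPerm_succAbove]

variable {M : Type*} [AddCommGroup M] [Module K M]

/-- The antisymmetrization of a function of `n + 1` elements in terms of antisymmetrizations of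
functions of the last `n` ones. -/
lemma sum_altFactor_succ {n : ℕ} (X : Fin (n + 1) → H) (G : List H → M) :
    ∑ σ, altFactor ε (fun j => deg (X j)) σ • G (List.ofFn fun j => X (σ j)) =
      ∑ τ, altFactor ε (fun j => deg (X j.succ)) τ • ∑ i ∈ Finset.range (n + 1),
        moveFactor ε deg (X 0) i (List.ofFn fun j => X (τ j).succ) •
          G ((List.ofFn fun j => X (τ j).succ).insertIdx i (X 0)) := by
  rw [← (insertPerm_bijective n).sum_comp, Fintype.sum_prod_type, Finset.sum_comm]
  refine Finset.sum_congr rfl fun τ _ => ?_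
  rw [Finset.sum_range, Finset.smul_sum]
  refine Finset.sum_congr rfl fun i _ => ?_
  rw [altFactor_insertPerm, ofFn_comp_insertPerm, moveFactor_ofFn, smul_smul, mul_comm]

variable {ε deg}

lemma IsAlt.move {f : List H → M} (hf : IsAlt ε deg f) (x : H) (i : ℕ) (t : List H)
    (hi : i ≤ t.length) : moveFactor ε deg x i t • f (t.insertIdx i x) = f (x :: t) := by
  induction t generalizing i f with
  | nil =>
    obtain rfl : i = 0 := by simpa using hi
    simp [moveFactor]
  | cons y t ih =>
    rcases i with _ | i
    · simp [moveFactor]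
    · have h1 := ih (hf.contraction y) i (by simpa using hi)
      have h2 := hf [] t x y
      simp only [contract_apply] at h1
      rw [List.nil_append] at h2
      rw [h2, List.nil_append, ← h1, List.insertIdx_succ_cons]
      simp only [moveFactor, List.take_succ_cons, List.map_cons, List.prod_cons]
      module

/-- The effect of a permutation of the arguments on an alternating function: the case of neighbours
gives `IsAlt.move`, and every permutation of `n + 1` elements is an `insertPerm`. -/
lemma IsAlt.perm {f : List H → M} (hf : IsAlt ε deg f) {n : ℕ} (X : Fin n → H)
    (σ : Equiv.Perm (Fin n)) :
    altFactor ε (fun j => deg (X j)) σ • f (List.ofFn fun j => X (σ j)) = f (List.ofFn X) := by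
  induction n generalizing f with
  | zero =>
    have : altFactor ε (fun j => deg (X j)) σ = 1 := by
      simp [altFactor, Subsingleton.elim σ 1, inversionFactor]
    rw [this, one_smul]
    simp
  | succ n ih =>
    obtain ⟨⟨i, τ⟩, rfl⟩ := (insertPerm_bijective n).2 σ
    have h1 := ih (hf.contraction (X 0)) (fun j => X j.succ) τ
    simp only [contract_apply] at h1
    rw [List.ofFn_succ (f := X), ← h1, ← hf.move (X 0) i _ (by simpa using Nat.lt_succ_iff.mp i.2)]
    simp only
    rw [altFactor_insertPerm, ofFn_comp_insertPerm, moveFactor_ofFn, smul_smul, mul_comm]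

/-! ### The product as a sum over permutations -/

variable {A : Type*} [Ring A] [Algebra K A]

variable (ε deg) in
/-- The function whose antisymmetrization is, up to a factor, the product of a form `f` of arity `p`
and a form `g` of degree `l`. -/
def splitMul (p : ℕ) (l : Γ) (f g : List H → A) (t : List H) : A :=
  ((t.take p).map fun y => (ε l (deg y) : K)).prod • (f (t.take p) * g (t.drop p))

lemma splitMul_append (p : ℕ) (l : Γ) (f g : List H → A) (s u : List H) (hs : s.length = p) :
    splitMul ε deg p l f g (s ++ u) =
      (s.map fun y => (ε l (deg y) : K)).prod • (f s * g u) := by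
  simp [splitMul, ← hs]

lemma insertIdx_append_left (s u : List H) (i : ℕ) (x : H) (hi : i ≤ s.length) :
    (s ++ u).insertIdx i x = s.insertIdx i x ++ u := by
  induction s generalizing i with
  | nil =>
    obtain rfl : i = 0 := by simpa using hi
    simp
  | cons y s ih =>
    rcases i with _ | i
    · simp
    · simp [ih i (by simpa using hi)]

lemma insertIdx_append_right (s u : List H) (i : ℕ) (x : H) :
    (s ++ u).insertIdx (s.length + i) x = s ++ u.insertIdx i x := by
  induction s with
  | nil => simp
  | cons y s ih => simp [Nat.succ_add, ih]

lemma map_insertIdx_prod (F : H → K) (s : List H) (i : ℕ) (x : H) (hi : i ≤ s.length) :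
    ((s.insertIdx i x).map F).prod = F x * (s.map F).prod := by
  rw [((List.perm_insertIdx x s hi).map F).prod_eq]
  simp

/-- Insertion of `x` in the first `p` places contributes to the contraction of `f`. -/
lemma moveFactor_smul_splitMul_left {f : List H → A} (hf : IsAlt ε deg f) (g : List H → A) (l : Γ)
    (x : H) (s u : List H) (i : ℕ) (hi : i ≤ s.length) :
    moveFactor ε deg x i (s ++ u) •
      splitMul ε deg (s.length + 1) l f g ((s ++ u).insertIdx i x) =
    (ε l (deg x) : K) • splitMul ε deg s.length l (contract K x f) g (s ++ u) := by
  have h1 := hf.move x i s hi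
  have h2 : moveFactor ε deg x i (s ++ u) = moveFactor ε deg x i s := by
    simp only [moveFactor, List.take_append_of_le_length hi]
  rw [insertIdx_append_left s u i x hi,
    splitMul_append _ _ _ _ _ _ (List.length_insertIdx_of_le_length hi x),
    splitMul_append _ _ _ _ _ _ rfl, map_insertIdx_prod _ _ _ _ hi, contract_apply, ← h1, h2,
    smul_mul_assoc]
  module

/-- Insertion of `x` in a place after the first `p` ones contributes to the contraction of `g`. -/
lemma moveFactor_smul_splitMul_right (f : List H → A) {g : List H → A} (hg : IsAlt ε deg g) (l : Γ)
    (x : H) (s u : List H) (i : ℕ) (hi : i ≤ u.length) :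
    moveFactor ε deg x (s.length + i) (s ++ u) •
      splitMul ε deg s.length l f g ((s ++ u).insertIdx (s.length + i) x) =
    (-1 : K) ^ s.length • splitMul ε deg s.length (l + deg x) f (contract K x g) (s ++ u) := by
  have h1 := hg.move x i u hi
  have h2 : moveFactor ε deg x (s.length + i) (s ++ u) =
      (s.map fun y => -(ε (deg x) (deg y) : K)).prod * moveFactor ε deg x i u := by
    simp only [moveFactor, List.take_append, List.take_of_length_le (Nat.le_add_right _ _),
      Nat.add_sub_cancel_left, List.map_append, List.prod_append]
  have h3 : (s.map fun y => -(ε (deg x) (deg y) : K)).prod *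
      (s.map fun y => (ε l (deg y) : K)).prod =
      (-1 : K) ^ s.length * (s.map fun y => (ε (l + deg x) (deg y) : K)).prod := by
    clear h2
    induction s with
    | nil => simp
    | cons y s ih =>
      simp only [List.map_cons, List.prod_cons, List.length_cons, pow_succ]
      rw [factor_add_left]
      linear_combination (-(ε (deg x) (deg y) : K) * ε l (deg y)) * ih
  rw [insertIdx_append_right, splitMul_append _ _ _ _ _ _ rfl, splitMul_append _ _ _ _ _ _ rfl, h2,
    contract_apply, ← h1, mul_smul_comm, smul_smul, smul_smul, smul_smul, ← h3]
  congr 1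
  ring

/-- Insertion of `x` in all places: the first `p` places, and then the last `q` ones, contribute
equal terms. Together these are the two terms of the recursion for the product, which explains the
factor `p! q!` in `sum_altFactor_smul_splitMul`. -/
lemma sum_moveFactor_smul_splitMul {f g : List H → A} (hf : IsAlt ε deg f) (hg : IsAlt ε deg g)
    (l : Γ) (x : H) (t : List H) (p q : ℕ) (h : t.length + 1 = p + q) :
    ∑ i ∈ Finset.range (t.length + 1),
      moveFactor ε deg x i t • splitMul ε deg p l f g (t.insertIdx i x) =
    (p : K) • (ε l (deg x) : K) • splitMul ε deg (p - 1) l (contract K x f) g t +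
      (q : K) • (-1 : K) ^ p • splitMul ε deg p (l + deg x) f (contract K x g) t := by
  rw [h, Finset.sum_range_add]
  congr 1
  · have : ∀ i ∈ Finset.range p, moveFactor ε deg x i t •
        splitMul ε deg p l f g (t.insertIdx i x) =
        (ε l (deg x) : K) • splitMul ε deg (p - 1) l (contract K x f) g t := by
      intro i hi
      have hi := Finset.mem_range.mp hi
      have h1 : (t.take (p - 1)).length = p - 1 := by simp; omega
      have h2 := moveFactor_smul_splitMul_left hf g l x (t.take (p - 1)) (t.drop (p - 1)) i
        (by omega)
      rwa [List.take_append_drop, h1, Nat.sub_add_cancel (by omega)] at h2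
    rw [Finset.sum_congr rfl this, Finset.sum_const, Finset.card_range, ← Nat.cast_smul_eq_nsmul K]
  · have : ∀ i ∈ Finset.range q, moveFactor ε deg x (p + i) t •
        splitMul ε deg p l f g (t.insertIdx (p + i) x) =
        (-1 : K) ^ p • splitMul ε deg p (l + deg x) f (contract K x g) t := by
      intro i hi
      have hi := Finset.mem_range.mp hi
      have h1 : (t.take p).length = p := by simp; omega
      have h2 := moveFactor_smul_splitMul_right f hg l x (t.take p) (t.drop p) i
        (by simp; omega)
      rwa [List.take_append_drop, h1] at h2
    rw [Finset.sum_congr rfl this, Finset.sum_const, Finset.card_range, ← Nat.cast_smul_eq_nsmul K]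

/-- The antisymmetrization of `splitMul` is the product, up to the factor `p! q!`. -/
lemma sum_altFactor_smul_splitMul {f g : List H → A} (hf : IsAlt ε deg f) (hg : IsAlt ε deg g)
    {p q : ℕ} (hfp : HasArity p f) (hgq : HasArity q g) (l : Γ) {n : ℕ} (hn : n = p + q)
    (X : Fin n → H) :
    ∑ σ, altFactor ε (fun j => deg (X j)) σ • splitMul ε deg p l f g (List.ofFn fun j => X (σ j)) =
      ((p.factorial : K) * q.factorial) • formMul ε deg l f g (List.ofFn X) := by
  induction n generalizing p q f g l with
  | zero =>
    obtain ⟨rfl, rfl⟩ : p = 0 ∧ q = 0 := by omega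
    simp [altFactor, inversionFactor, splitMul, formMul_nil]
  | succ n ih =>
    rw [sum_altFactor_succ]
    have h1 : ∀ τ : Equiv.Perm (Fin n), ∑ i ∈ Finset.range (n + 1),
        moveFactor ε deg (X 0) i (List.ofFn fun j => X (τ j).succ) •
          splitMul ε deg p l f g ((List.ofFn fun j => X (τ j).succ).insertIdx i (X 0)) =
        (p : K) • (ε l (deg (X 0)) : K) •
          splitMul ε deg (p - 1) l (contract K (X 0) f) g (List.ofFn fun j => X (τ j).succ) +
        (q : K) • (-1 : K) ^ p • splitMul ε deg p (l + deg (X 0)) f (contract K (X 0) g)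
          (List.ofFn fun j => X (τ j).succ) := by
      intro τ
      have := sum_moveFactor_smul_splitMul hf hg l (X 0) (List.ofFn fun j => X (τ j).succ) p q
        (by simpa using hn)
      simpa only [List.length_ofFn] using this
    simp only [h1, smul_add, Finset.sum_add_distrib]
    have h2 : ∑ τ : Equiv.Perm (Fin n), altFactor ε (fun j => deg (X j.succ)) τ • (p : K) •
        (ε l (deg (X 0)) : K) •
          splitMul ε deg (p - 1) l (contract K (X 0) f) g (List.ofFn fun j => X (τ j).succ) =
        ((p.factorial : K) * q.factorial) • (ε l (deg (X 0)) : K) •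
          formMul ε deg l (contract K (X 0) f) g (List.ofFn fun j => X j.succ) := by
      rcases p with _ | p
      · rw [hfp.contraction_eq_zero]
        simp
      · have := ih (hf.contraction (X 0)) hg (hfp.contraction (X 0)) hgq l (by omega)
          (fun j => X j.succ)
        rw [Nat.add_sub_cancel, Nat.factorial_succ]
        calc _ = ((p + 1 : ℕ) : K) • (ε l (deg (X 0)) : K) • ∑ τ : Equiv.Perm (Fin n),
              altFactor ε (fun j => deg (X j.succ)) τ •
              splitMul ε deg p l (contract K (X 0) f) g (List.ofFn fun j => X (τ j).succ) := by
              simp only [Finset.smul_sum]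
              exact Finset.sum_congr rfl fun τ _ => by module
          _ = _ := by
              rw [this]
              push_cast
              module
    have h3 : ∑ τ : Equiv.Perm (Fin n), altFactor ε (fun j => deg (X j.succ)) τ • (q : K) •
        (-1 : K) ^ p • splitMul ε deg p (l + deg (X 0)) f (contract K (X 0) g)
          (List.ofFn fun j => X (τ j).succ) =
        ((p.factorial : K) * q.factorial) • (-1 : K) ^ p •
          formMul ε deg (l + deg (X 0)) f (contract K (X 0) g) (List.ofFn fun j => X j.succ) := by
      rcases q with _ | q
      · rw [hgq.contraction_eq_zero]
        simp
      · have := ih hf (hg.contraction (X 0)) hfp (hgq.contraction (X 0)) (l + deg (X 0)) (by omega)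
          (fun j => X j.succ)
        rw [Nat.factorial_succ]
        calc _ = ((q + 1 : ℕ) : K) • (-1 : K) ^ p • ∑ τ : Equiv.Perm (Fin n),
              altFactor ε (fun j => deg (X j.succ)) τ •
              splitMul ε deg p (l + deg (X 0)) f (contract K (X 0) g)
                (List.ofFn fun j => X (τ j).succ) := by
              simp only [Finset.smul_sum]
              exact Finset.sum_congr rfl fun τ _ => by module
          _ = _ := by
              rw [this]
              push_cast
              module
    rw [h2, h3, List.ofFn_succ, formMul_cons, hfp.parity_eq (K := K), map_smul,
      LinearMap.smul_apply, Pi.smul_apply, smul_add]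

end Antisymmetrization

end EpsGraded

namespace EpsGraded

/-! ### The explicit formulas for the product and the differential -/

section ExplicitFormulas

variable {Γ K : Type*} [AddCommGroup Γ] [Field K] {ε : CommutationFactor Γ K}
variable {H : Type*} {deg : H → Γ} {A : Type*} [Ring A] [Algebra K A]

lemma prod_Iio_fin_succ {M : Type*} [CommMonoid M] {n : ℕ} (i : Fin n) (F : Fin (n + 1) → M) :
    ∏ a ∈ Finset.Iio i.succ, F a = F 0 * ∏ a ∈ Finset.Iio i, F a.succ := by
  have h1 : Finset.Iio i.succ = Finset.univ.filter (· < i.succ) := by ext; simp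
  have h2 : Finset.Iio i = Finset.univ.filter (· < i) := by ext; simp
  rw [h1, h2, Finset.prod_filter, Finset.prod_filter, Fin.prod_univ_succ]
  simp

lemma ofFn_comp_cons {n : ℕ} {α : Type*} (x : α) (Y : Fin n → α) :
    List.ofFn (Fin.cons x Y : Fin (n + 1) → α) = x :: List.ofFn Y := by
  rw [List.ofFn_succ]
  simp

lemma comp_cons {n : ℕ} {α β : Type*} (v : α → β) (x : α) (Y : Fin n → α) :
    (fun j => v ((Fin.cons x Y : Fin (n + 1) → α) j)) = Fin.cons (v x) fun j => v (Y j) := by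
  funext j
  refine Fin.cases ?_ (fun j => ?_) j <;> simp

lemma comp_succAbove_succ {n : ℕ} {α : Type*} (X : Fin (n + 2) → α) (m : Fin (n + 1)) :
    (fun j => X (m.succ.succAbove j)) = Fin.cons (X 0) fun j => X (m.succAbove j).succ := by
  funext j
  refine Fin.cases ?_ (fun j => ?_) j <;> simp

variable {L : Type*} {val : H → L}

/-- The sum over permutations defining the product of `ω` and `η` is the recursively defined product
of the corresponding functions of lists. The map `val` relates the arguments of both: it is the
inclusion of the homogeneous elements, or its composite with the adjoint representation. -/
lemma mulValue_eq_formMul [CharZero K] {f g : List H → A} (hf : IsAlt ε deg f) (hg : IsAlt ε deg g)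
    {p q : ℕ} (hfp : HasArity p f) (hgq : HasArity q g) (l : Γ) (ω : (Fin p → L) → A)
    (η : (Fin q → L) → A) (hω : ∀ Y : Fin p → H, f (List.ofFn Y) = ω fun j => val (Y j))
    (hη : ∀ Y : Fin q → H, g (List.ofFn Y) = η fun j => val (Y j)) (X : Fin (p + q) → H) :
    mulValue ε l ω η (fun j => deg (X j)) (fun j => val (X j)) =
      formMul ε deg l f g (List.ofFn X) := by
  have h := sum_altFactor_smul_splitMul hf hg hfp hgq l rfl X
  have h0 : (p.factorial : K) * q.factorial ≠ 0 := by
    exact_mod_cast mul_ne_zero p.factorial_ne_zero q.factorial_ne_zero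
  rw [mulValue, inv_smul_eq_iff₀ h0, ← h]
  refine Finset.sum_congr rfl fun σ _ => ?_
  rw [List.ofFn_add, splitMul_append _ _ _ _ _ _ (List.length_ofFn), hω, hη, List.map_ofFn,
    List.prod_ofFn, smul_smul, altFactor]
  simp only [Units.val_mul, Units.coe_prod, Function.comp_apply, mul_assoc]
  rfl

variable {brk : H → H → H} {ρ : H → A →ₗ[K] A}

variable (ε deg brk) in
/-- The terms of the Lie derivative along `x` which involve the bracket, the brackets being moved to
the first place. -/
def bracketSum (x : H) (f : List H → A) {p : ℕ} (X : Fin p → H) : A :=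
  ∑ n : Fin p, ((-1 : K) ^ ((n : ℕ) + 1) * ∏ a ∈ Finset.Iio n, (ε (deg (X a)) (deg (X n)) : K)) •
    f (brk x (X n) :: (List.ofFn X).eraseIdx n)

/-- `bracketSum`, when the first element is split off: the other terms acquire a factor since the
bracket is moved past this element. -/
lemma bracketSum_succ (hbr : ∀ X Y, deg (brk X Y) = deg X + deg Y) {f : List H → A}
    (hf : IsAlt ε deg f) (x : H) {p : ℕ} (X : Fin (p + 1) → H) :
    bracketSum ε deg brk x f X = -f (brk x (X 0) :: List.ofFn fun j => X j.succ) +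
      (ε (deg x) (deg (X 0)) : K) •
        bracketSum ε deg brk x (contract K (X 0) f) fun j => X j.succ := by
  rw [bracketSum, Fin.sum_univ_succ, bracketSum, Finset.smul_sum, List.ofFn_succ]
  congr 1
  · have : Finset.Iio (0 : Fin (p + 1)) = ∅ := by ext; simp
    simp [this]
  · refine Finset.sum_congr rfl fun n _ => ?_
    have h1 := hf [] ((List.ofFn fun j => X j.succ).eraseIdx n) (brk x (X n.succ)) (X 0)
    rw [List.nil_append, List.nil_append, hbr, factor_add_left] at h1
    rw [Fin.val_succ, List.eraseIdx_cons_succ, h1, contract_apply, prod_Iio_fin_succ, pow_succ]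
    linear_combination (norm := module) ((-1 : K) ^ ((n : ℕ) + 1) *
      (∏ a ∈ Finset.Iio n, (ε (deg (X a.succ)) (deg (X n.succ)) : K)) * ε (deg x) (deg (X 0)) *
      factor_mul_swap ε (deg (X 0)) (deg (X n.succ))) •
      f (X 0 :: brk x (X n.succ) :: (List.ofFn fun j => X j.succ).eraseIdx n)

/-- The Lie derivative as an explicit sum. -/
lemma lieDer_eq_bracketSum (hbr : ∀ X Y, deg (brk X Y) = deg X + deg Y) {f : List H → A}
    (hf : IsAlt ε deg f) (k : Γ) (x : H) {p : ℕ} (X : Fin p → H) :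
    lieDer ε deg brk ρ k x f (List.ofFn X) =
      (ε k (deg x) : K) • ρ x (f (List.ofFn X)) + bracketSum ε deg brk x f X := by
  induction p generalizing k f with
  | zero => simp [lieDer_nil, bracketSum]
  | succ p ih =>
    rw [List.ofFn_succ, lieDer_cons, ih (hf.contraction _), bracketSum_succ hbr hf,
      contract_apply, contract_apply, factor_add_left]
    linear_combination (norm := module) ((ε k (deg x) : K) * factor_mul_swap ε (deg x)
      (deg (X 0))) • ρ x (f (X 0 :: List.ofFn fun j => X j.succ))

variable {ρ' : L → A → A} {br : L → L → L}

lemma diffActionSum_zero (k : Γ) (ω : (Fin 0 → L) → A) (d : Fin 1 → Γ) (X : Fin 1 → L) :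
    diffActionSum ε ρ' k ω d X = (ε k (d 0) : K) • ρ' (X 0) (ω fun j => X j.succ) := by
  have : Finset.Iio (0 : Fin 1) = ∅ := by ext; simp
  simp [diffActionSum, this]

/-- The first sum of the differential, when the first element is split off. -/
lemma diffActionSum_succ (k : Γ) {p : ℕ} (ω : (Fin (p + 1) → L) → A) (d : Fin (p + 2) → Γ)
    (X : Fin (p + 2) → L) :
    diffActionSum ε ρ' k ω d X = (ε k (d 0) : K) • ρ' (X 0) (ω fun j => X j.succ) -
      diffActionSum ε ρ' (k + d 0) (fun Y => ω (Fin.cons (X 0) Y)) (fun j => d j.succ)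
        (fun j => X j.succ) := by
  rw [diffActionSum, Fin.sum_univ_succ, diffActionSum, sub_eq_add_neg, ← Finset.sum_neg_distrib]
  congr 1
  · have : Finset.Iio (0 : Fin (p + 2)) = ∅ := by ext; simp
    simp [this]
  · refine Finset.sum_congr rfl fun n _ => ?_
    rw [comp_succAbove_succ, prod_Iio_fin_succ, ← neg_smul]
    congr 1
    simp only [Units.val_mul, Fin.val_succ, pow_succ, Units.val_neg, Units.val_one, factor_add_left]
    ring

/-- The second sum of the differential, when the first element is split off. -/
lemma diffBracketSum_succ (hbr : ∀ X Y, deg (brk X Y) = deg X + deg Y)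
    (hval : ∀ X Y, val (brk X Y) = br (val X) (val Y)) {f : List H → A} (hf : IsAlt ε deg f)
    {p : ℕ} (ω : (Fin (p + 1) → L) → A)
    (hω : ∀ Y : Fin (p + 1) → H, f (List.ofFn Y) = ω fun j => val (Y j)) (X : Fin (p + 2) → H) :
    diffBracketSum ε br ω (fun j => deg (X j)) (fun j => val (X j)) =
      bracketSum ε deg brk (X 0) f (fun j => X j.succ) -
      diffBracketSum ε br (fun Y => ω (Fin.cons (val (X 0)) Y)) (fun j => deg (X j.succ))
        (fun j => val (X j.succ)) := by
  have herase : ∀ {q : ℕ} (Y : Fin (q + 1) → H) (n : Fin (q + 1)),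
      (List.ofFn Y).eraseIdx n = List.ofFn fun j => Y (n.succAbove j) := by
    intro q Y n
    refine List.ext_getElem ?_ fun j h1 h2 => ?_
    · rw [List.length_eraseIdx_of_lt (by simpa using Nat.lt_succ_iff.mp n.2)]
      simp
    · have hj : j < q := by simpa using h2
      rw [List.getElem_eraseIdx]
      simp only [List.getElem_ofFn]
      split_ifs with h3
      · congr 1
        rw [Fin.succAbove_of_castSucc_lt _ _ (by simpa [Fin.lt_def] using h3)]
        rfl
      · congr 1
        rw [Fin.succAbove_of_le_castSucc _ _ (by simp [Fin.le_def]; omega)]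
        rfl
  have hω2 : ∀ (Z : H) (Y : Fin p → H),
      ω (Fin.cons (val Z) fun j => val (Y j)) = f (Z :: List.ofFn Y) := by
    intro Z Y
    rw [← ofFn_comp_cons, hω, comp_cons]
  -- the terms with `m = 0` form the `bracketSum`
  have h0 : diffBracketSum ε br ω (fun j => deg (X j)) (fun j => val (X j)) =
      ∑ n : Fin (p + 1), (((-1 : K) ^ ((n : ℕ) + 1) *
        ∏ a ∈ Finset.Iio n, (ε (deg (X a.succ)) (deg (X n.succ)) : K)) •
        f (brk (X 0) (X n.succ) :: (List.ofFn fun j => X j.succ).eraseIdx n) +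
      ∑ m : Fin p, if m.castSucc < n then
        (((-1) ^ ((m : ℕ) + 1 + (n + 1)) * (ε (deg (X n.succ)) (deg (X m.castSucc.succ)) *
        (∏ a ∈ Finset.Iio m.castSucc.succ, ε (deg (X a)) (deg (X m.castSucc.succ))) *
        ∏ a ∈ Finset.Iio n.succ, ε (deg (X a)) (deg (X n.succ))) : Kˣ) : K) •
        f (brk (X m.castSucc.succ) (X n.succ) ::
          List.ofFn fun j => X (n.succ.succAbove (m.succ.succAbove j))) else 0) := by
    rw [diffBracketSum, Fin.sum_univ_succ]
    simp only [Fin.not_lt_zero, if_false, Finset.sum_const_zero, zero_add]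
    refine Finset.sum_congr rfl fun n _ => ?_
    rw [Fin.sum_univ_succ]
    congr 1
    · rw [if_pos (by simp), herase, ← hval, hω2]
      have h1 : Finset.Iio (0 : Fin (p + 2)) = ∅ := by ext; simp
      have h2 : (fun j => X (n.succ.succAbove ((0 : Fin (p + 1)).succAbove j))) =
          fun j => X (n.succAbove j).succ := by
        funext j
        simp
      rw [h2, Fin.castSucc_zero, h1, prod_Iio_fin_succ]
      congr 1
      simp only [Finset.prod_empty, mul_one, Units.val_mul, Units.coe_prod, Fin.val_zero, zero_add,
        Fin.val_succ, Units.val_pow_eq_pow_val, Units.val_neg, Units.val_one]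
      linear_combination (-1 : K) ^ ((n : ℕ) + 1) *
        (∏ a ∈ Finset.Iio n, (ε (deg (X a.succ)) (deg (X n.succ)) : K)) *
        factor_mul_swap ε (deg (X n.succ)) (deg (X 0))
    · refine Finset.sum_congr rfl fun m _ => ?_
      rw [← hval, hω2]
      simp only [Fin.val_succ, Fin.castSucc_succ, Fin.succ_lt_succ_iff]
  -- in the other terms the bracket is exchanged with `X 0`
  rw [h0, Finset.sum_add_distrib, bracketSum, sub_eq_add_neg]
  congr 1
  rcases p with _ | p
  · simp [diffBracketSum]
  · rw [diffBracketSum, ← Finset.sum_neg_distrib]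
    refine Finset.sum_congr rfl fun n _ => ?_
    rw [← Finset.sum_neg_distrib]
    refine Finset.sum_congr rfl fun m _ => ?_
    by_cases hmn : m.castSucc < n
    · rw [if_pos hmn, if_pos hmn]
      have h1 : (fun j => X (n.succ.succAbove (m.succ.succAbove j))) =
          Fin.cons (X 0) fun j => X (n.succAbove (m.succAbove j)).succ := by
        rw [comp_succAbove_succ (fun j => X (n.succ.succAbove j))]
        simp
      have h2 := hf [] (List.ofFn fun j => X (n.succAbove (m.succAbove j)).succ)
        (brk (X m.castSucc.succ) (X n.succ)) (X 0)
      rw [List.nil_append, List.nil_append, hbr, factor_add_left] at h2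
      have h3 : (Fin.cons (br (val (X m.castSucc.succ)) (val (X n.succ)))
          fun j => val (X (n.succAbove (m.succAbove j)).succ) : Fin (p + 1) → L) =
          fun j => val ((Fin.cons (brk (X m.castSucc.succ) (X n.succ))
          fun j => X (n.succAbove (m.succAbove j)).succ : Fin (p + 1) → H) j) := by
        rw [comp_cons, hval]
      rw [h1, ofFn_comp_cons, h2, h3, hω2, ofFn_comp_cons, prod_Iio_fin_succ, prod_Iio_fin_succ]
      simp only [Units.val_mul, Units.coe_prod, Units.val_pow_eq_pow_val, Units.val_neg,
        Units.val_one, pow_add, pow_one]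
      have e1 := factor_mul_swap ε (deg (X 0)) (deg (X m.castSucc.succ))
      have e2 := factor_mul_swap ε (deg (X 0)) (deg (X n.succ))
      rw [← neg_smul, smul_smul, ← neg_smul]
      congr 1
      generalize (∏ a ∈ Finset.Iio n, (ε (deg (X a.succ)) (deg (X n.succ)) : K)) = c1
      generalize (∏ a ∈ Finset.Iio m.castSucc,
        (ε (deg (X a.succ)) (deg (X m.castSucc.succ)) : K)) = c2
      generalize (ε (deg (X 0)) (deg (X m.castSucc.succ)) : K) = a1 at *
      generalize (ε (deg (X 0)) (deg (X n.succ)) : K) = a2 at *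
      generalize (ε (deg (X m.castSucc.succ)) (deg (X 0)) : K) = b1 at *
      generalize (ε (deg (X n.succ)) (deg (X 0)) : K) = b2 at *
      linear_combination (-(-1 : K) ^ (m : ℕ) * (-1) ^ (n : ℕ) *
        (ε (deg (X n.succ)) (deg (X m.castSucc.succ)) : K) * c1 * c2) * (a2 * b2 * e1 + e2)
    · rw [if_neg hmn, if_neg hmn, neg_zero]

/-- The explicit formula for the differential of `ω` agrees with the recursion by Cartan's formula:
the terms involving the first argument form the Lie derivative along it, and the other ones the
differential of the contraction. For `val`, see `mulValue_eq_formMul`. -/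
lemma diffValue_eq_dif (hbr : ∀ X Y, deg (brk X Y) = deg X + deg Y)
    (hval : ∀ X Y, val (brk X Y) = br (val X) (val Y)) (hρ : ∀ X a, ρ X a = ρ' (val X) a)
    {f : List H → A} (hf : IsAlt ε deg f) (k : Γ) {p : ℕ} (ω : (Fin p → L) → A)
    (hω : ∀ Y : Fin p → H, f (List.ofFn Y) = ω fun j => val (Y j)) (X : Fin (p + 1) → H) :
    diffValue ε br ρ' k ω (fun j => deg (X j)) (fun j => val (X j)) =
      dif ε deg brk ρ k f (List.ofFn X) := by
  induction p generalizing k f with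
  | zero =>
    rw [diffValue, diffActionSum_zero, diffBracketSum, List.ofFn_succ, dif_cons, List.ofFn_zero,
      lieDer_nil, dif_nil, ← hρ, ← List.ofFn_zero (f := fun j : Fin 0 => X j.succ), hω]
    simp
  | succ p ih =>
    rw [List.ofFn_succ, dif_cons, lieDer_eq_bracketSum hbr hf, ← ih (hf.contraction _) _
      (fun Y => ω (Fin.cons (val (X 0)) Y)) ?_ (fun j => X j.succ), diffValue, diffActionSum_succ,
      diffBracketSum_succ hbr hval hf ω hω, diffValue, ← hρ, hω]
    · abel
    · intro Y
      rw [contract_apply, ← ofFn_comp_cons, hω, comp_cons]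

end ExplicitFormulas

end EpsGraded

namespace EpsGraded

/-! ### Multilinear forms and functions of lists of homogeneous elements -/

section FormSpace

variable {Γ K : Type*} [AddCommGroup Γ] [DecidableEq Γ] [Field K] (ε : CommutationFactor Γ K)
variable {A : Type*} [Ring A] [Algebra K A] (𝒜 : Γ → Submodule K A)
variable {L : Type*} [AddCommGroup L] [Module K L] (ℒ : Γ → Submodule K L)

/-- The homogeneous elements of a graded space, together with their degrees. -/
abbrev HomElt : Type _ := Σ γ, ℒ γ

variable {ℒ} in
/-- The underlying element of the graded space. -/
def HomElt.val (X : HomElt ℒ) : L := X.2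

variable {ℒ} in
lemma HomElt.ext {X Y : HomElt ℒ} (h : X.1 = Y.1) (h' : X.val = Y.val) : X = Y := by
  obtain ⟨i, x⟩ := X
  obtain ⟨j, y⟩ := Y
  obtain rfl : i = j := h
  exact Sigma.ext rfl (heq_of_eq (Subtype.ext h'))

variable {ℒ} in
/-- `f` is linear in each entry, the degree of this entry being fixed. -/
def IsSlotLinear (f : List (HomElt ℒ) → A) : Prop :=
  ∀ s t γ (c : K) (x y : ℒ γ), f (s ++ ⟨γ, c • x + y⟩ :: t) =
    c • f (s ++ ⟨γ, x⟩ :: t) + f (s ++ ⟨γ, y⟩ :: t)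

variable {ε 𝒜 ℒ}

lemma IsSlotLinear.contraction {f : List (HomElt ℒ) → A} (hf : IsSlotLinear f) (X : HomElt ℒ) :
    IsSlotLinear (contract K X f) := fun s t => hf (X :: s) t

lemma IsSlotLinear.contract_comb {f : List (HomElt ℒ) → A} (hf : IsSlotLinear f) (γ : Γ) (c : K)
    (x y : ℒ γ) : contract K ⟨γ, c • x + y⟩ f =
      c • contract K (⟨γ, x⟩ : HomElt ℒ) f + contract K (⟨γ, y⟩ : HomElt ℒ) f := by
  ext t
  exact hf [] t γ c x y

/-- Linearity in an entry, for elements whose degrees are only propositionally equal. -/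
lemma IsSlotLinear.comb {f : List (HomElt ℒ) → A} (hf : IsSlotLinear f) (s t : List (HomElt ℒ))
    {X Y Z : HomElt ℒ} (c : K) (hY : Y.1 = X.1) (hZ : Z.1 = X.1)
    (h : X.val = c • Y.val + Z.val) :
    f (s ++ X :: t) = c • f (s ++ Y :: t) + f (s ++ Z :: t) := by
  obtain ⟨i, x⟩ := X
  obtain ⟨j, y⟩ := Y
  obtain ⟨k, z⟩ := Z
  obtain rfl : j = i := hY
  obtain rfl : k = j := hZ
  rw [← hf s t]
  congr 3
  exact HomElt.ext rfl h

lemma IsSlotLinear.zero {f : List (HomElt ℒ) → A} (hf : IsSlotLinear f) (s t : List (HomElt ℒ))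
    {X : HomElt ℒ} (h : X.val = 0) : f (s ++ X :: t) = 0 := by
  have := hf.comb s t (X := X) (Y := X) (Z := X) 1 rfl rfl (by simp [h])
  rw [one_smul] at this
  exact left_eq_add.mp this

lemma IsSlotLinear.smul_eq {f : List (HomElt ℒ) → A} (hf : IsSlotLinear f) (s t : List (HomElt ℒ))
    {X Y : HomElt ℒ} (c : K) (hY : Y.1 = X.1) (h : X.val = c • Y.val) :
    f (s ++ X :: t) = c • f (s ++ Y :: t) := by
  rw [hf.comb s t (X := X) (Y := Y) (Z := ⟨X.1, 0⟩) c hY rfl (by rw [h]; simp [HomElt.val]),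
    hf.zero s t (X := ⟨X.1, 0⟩) rfl, add_zero]

lemma IsSlotLinear.sign {f : List (HomElt ℒ) → A} (hf : IsSlotLinear f) :
    IsSlotLinear (parity K f) := by
  intro s t γ c x y
  simp only [parity_apply, hf s t γ c x y, List.length_append, List.length_cons]
  module

lemma IsSlotLinear.mul {f g : List (HomElt ℒ) → A} (hf : IsSlotLinear f) (hg : IsSlotLinear g)
    (l : Γ) : IsSlotLinear (formMul ε Sigma.fst l f g) := by
  intro s
  induction s generalizing l f g with
  | nil =>
    intro t γ c x y
    simp only [List.nil_append, formMul_cons, hf.contract_comb, hg.contract_comb, map_add, map_smul,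
      LinearMap.add_apply, LinearMap.smul_apply, Pi.add_apply, Pi.smul_apply]
    module
  | cons Z s ih =>
    intro t γ c x y
    simp only [List.cons_append, formMul_cons, ih (hf.contraction Z) hg l t γ c x y,
      ih hf.sign (hg.contraction Z) _ t γ c x y]
    module

/-- The bracket of homogeneous elements. -/
def homBracket {br : L →ₗ[K] L →ₗ[K] L} (hL : IsEpsLieAlgebra ε ℒ br) (X Y : HomElt ℒ) :
    HomElt ℒ := ⟨X.1 + Y.1, br X.2 Y.2, hL.mem _ _ _ X.2.2 _ Y.2.2⟩

lemma homBracket_val {br : L →ₗ[K] L →ₗ[K] L} (hL : IsEpsLieAlgebra ε ℒ br) (X Y : HomElt ℒ) :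
    (homBracket hL X Y).val = br X.val Y.val := rfl

lemma IsSlotLinear.isLieCompatible {br : L →ₗ[K] L →ₗ[K] L} (hL : IsEpsLieAlgebra ε ℒ br)
    {f : List (HomElt ℒ) → A} (hf : IsSlotLinear f) :
    IsLieCompatible ε Sigma.fst (homBracket hL) f where
  skew s t X Y := by
    rw [← neg_smul]
    refine hf.smul_eq s t _ (add_comm _ _) ?_
    rw [homBracket_val, homBracket_val, neg_smul]
    exact hL.skew _ _ _ X.2.2 _ Y.2.2
  jacobi s t X Y Z := by
    rw [add_comm]
    refine hf.comb s t _ ?_ (add_assoc _ _ _) ?_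
    · change Y.1 + (X.1 + Z.1) = X.1 + (Y.1 + Z.1)
      abel
    · simp only [homBracket_val]
      rw [add_comm]
      exact hL.jacobi _ _ _ _ X.2.2 _ Y.2.2 _ Z.2.2

/-- The action of homogeneous elements on `A`. -/
def homAction (ρ : L →ₗ[K] A →ₗ[K] A) (X : HomElt ℒ) : A →ₗ[K] A := ρ X.val

section LieAlgebra

variable {br : L →ₗ[K] L →ₗ[K] L} (hL : IsEpsLieAlgebra ε ℒ br) (ρ : L →ₗ[K] A →ₗ[K] A)

lemma IsSlotLinear.contract_bracket_right {f : List (HomElt ℒ) → A} (hf : IsSlotLinear f)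
    (X : HomElt ℒ) (γ : Γ) (c : K) (x y : ℒ γ) :
    contract K (homBracket hL X ⟨γ, c • x + y⟩) f =
      c • contract K (homBracket hL X ⟨γ, x⟩) f + contract K (homBracket hL X ⟨γ, y⟩) f := by
  ext t
  exact hf.comb [] t c rfl rfl (by simp only [homBracket_val]; simp [HomElt.val])

lemma IsSlotLinear.contract_bracket_left {f : List (HomElt ℒ) → A} (hf : IsSlotLinear f)
    (X : HomElt ℒ) (γ : Γ) (c : K) (x y : ℒ γ) :
    contract K (homBracket hL ⟨γ, c • x + y⟩ X) f =
      c • contract K (homBracket hL ⟨γ, x⟩ X) f + contract K (homBracket hL ⟨γ, y⟩ X) f := by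
  ext t
  exact hf.comb [] t c rfl rfl (by simp only [homBracket_val]; simp [HomElt.val])

lemma IsSlotLinear.lieDer_comb {f : List (HomElt ℒ) → A} (hf : IsSlotLinear f) (k γ : Γ) (c : K)
    (x y : ℒ γ) : lieDer ε Sigma.fst (homBracket hL) (homAction ρ) k ⟨γ, c • x + y⟩ f =
      c • lieDer ε Sigma.fst (homBracket hL) (homAction ρ) k ⟨γ, x⟩ f +
        lieDer ε Sigma.fst (homBracket hL) (homAction ρ) k ⟨γ, y⟩ f := by
  ext t
  induction t generalizing k f with
  | nil =>
    simp only [lieDer_nil, homAction, HomElt.val, Pi.add_apply, Pi.smul_apply, Submodule.coe_add,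
      Submodule.coe_smul, map_add, map_smul, LinearMap.add_apply, LinearMap.smul_apply]
    module
  | cons Y t ih =>
    simp only [Pi.add_apply, Pi.smul_apply, lieDer_cons, ih (hf.contraction Y),
      hf.contract_bracket_left]
    module

lemma IsSlotLinear.lieDer {f : List (HomElt ℒ) → A} (hf : IsSlotLinear f) (k : Γ) (X : HomElt ℒ) :
    IsSlotLinear (lieDer ε Sigma.fst (homBracket hL) (homAction ρ) k X f) := by
  intro s
  induction s generalizing k f with
  | nil =>
    intro t γ c x y
    simp only [List.nil_append, lieDer_cons, hf.contract_comb, hf.contract_bracket_right,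
      map_add, map_smul, Pi.add_apply, Pi.smul_apply]
    module
  | cons Z s ih =>
    intro t γ c x y
    simp only [List.cons_append, lieDer_cons, ih (hf.contraction Z) _ t γ c x y,
      hf.contraction (homBracket hL X Z) s t γ c x y]
    module

lemma IsSlotLinear.dif {f : List (HomElt ℒ) → A} (hf : IsSlotLinear f) (k : Γ) :
    IsSlotLinear (dif ε Sigma.fst (homBracket hL) (homAction ρ) k f) := by
  intro s
  induction s generalizing k f with
  | nil =>
    intro t γ c x y
    simp only [List.nil_append, dif_cons, hf.lieDer_comb, hf.contract_comb, map_add,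
      map_smul, Pi.add_apply, Pi.smul_apply]
    module
  | cons Z s ih =>
    intro t γ c x y
    simp only [List.cons_append, dif_cons, ih (hf.contraction Z) _ t γ c x y,
      hf.lieDer hL ρ k Z s t γ c x y]
    module

end LieAlgebra

variable (ε 𝒜 ℒ) in
/-- The functions of lists which come from the `ε`-alternating multilinear maps of degree `p`. -/
def formSpace (p : ℕ × Γ) : Submodule K (List (HomElt ℒ) → A) where
  carrier := {f | HasArity p.1 f ∧ HasDegree Sigma.fst 𝒜 p.2 f ∧ IsAlt ε Sigma.fst f ∧
    IsSlotLinear f}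
  add_mem' := by
    rintro f g ⟨hf1, hf2, hf3, hf4⟩ ⟨hg1, hg2, hg3, hg4⟩
    refine ⟨fun t ht => ?_, hf2.add hg2, hf3.add hg3, fun s t γ c x y => ?_⟩
    · rw [Pi.add_apply, hf1 t ht, hg1 t ht, add_zero]
    · simp only [Pi.add_apply, hf4 s t γ c x y, hg4 s t γ c x y]
      module
  zero_mem' := ⟨fun _ _ => rfl, fun _ => Submodule.zero_mem _, fun _ _ _ _ => by simp,
    fun _ _ _ _ _ _ => by simp⟩
  smul_mem' := by
    rintro a f ⟨hf1, hf2, hf3, hf4⟩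
    refine ⟨fun t ht => ?_, hf2.smul a, hf3.smul a, fun s t γ c x y => ?_⟩
    · rw [Pi.smul_apply, hf1 t ht, smul_zero]
    · simp only [Pi.smul_apply, hf4 s t γ c x y]
      module

lemma formMul_mem [SetLike.GradedMul 𝒜] {p q : ℕ × Γ} {f g : List (HomElt ℒ) → A}
    (hf : f ∈ formSpace ε 𝒜 ℒ p) (hg : g ∈ formSpace ε 𝒜 ℒ q) :
    formMul ε Sigma.fst q.2 f g ∈ formSpace ε 𝒜 ℒ (p + q) :=
  ⟨hf.1.mul hg.1 _, hf.2.1.mul hg.2.1, hf.2.2.1.mul hg.2.2.1 _, hf.2.2.2.mul hg.2.2.2 _⟩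

lemma dif_mem {br : L →ₗ[K] L →ₗ[K] L} (hL : IsEpsLieAlgebra ε ℒ br) {ρ : L →ₗ[K] A →ₗ[K] A}
    (hρ : IsDerAction ε Sigma.fst (homBracket hL) (homAction ρ) 𝒜) {p : ℕ × Γ}
    {f : List (HomElt ℒ) → A} (hf : f ∈ formSpace ε 𝒜 ℒ p) :
    dif ε Sigma.fst (homBracket hL) (homAction ρ) p.2 f ∈ formSpace ε 𝒜 ℒ (p + (1, 0)) := by
  refine ⟨hf.1.dif _, ?_, hf.2.2.1.dif hρ (hf.2.2.2.isLieCompatible hL) _, hf.2.2.2.dif hL ρ _⟩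
  have := hf.2.1.dif hρ
  rwa [← add_zero p.2] at this ⊢

/-! ### Lists and tuples -/

lemma exists_ofFn_eq {α : Type*} {n : ℕ} (t : List α) (h : t.length = n) :
    ∃ Y : Fin n → α, t = List.ofFn Y := by
  subst h
  exact ⟨t.get, (List.ofFn_get t).symm⟩

lemma ofFn_update_eq {α : Type*} {n : ℕ} (Y : Fin n → α) (i : Fin n) (x : α) :
    List.ofFn (Function.update Y i x) =
      (List.ofFn Y).take i ++ x :: (List.ofFn Y).drop (i + 1) := by
  have h := List.set_eq_take_append_cons_drop (l := List.ofFn Y) (i := i) (a := x)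
  rw [if_pos (by simp)] at h
  rw [← h]
  refine List.ext_getElem (by simp) fun j h1 h2 => ?_
  simp only [List.getElem_ofFn, List.getElem_set, Function.update_apply, Fin.ext_iff, eq_comm]

variable (K) in
/-- The function of lists of homogeneous elements defined by a function of tuples. -/
def toList (n : ℕ) : MultilinearMap K (fun _ : Fin n => L) A →ₗ[K] (List (HomElt ℒ) → A) where
  toFun ω t := if h : t.length = n then ω fun i => (t.get (i.cast h.symm)).val else 0
  map_add' ω η := by
    ext t
    simp only [Pi.add_apply]
    split_ifs <;> simp
  map_smul' c ω := by
    ext t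
    simp only [Pi.smul_apply]
    split_ifs <;> simp

lemma toList_ofFn {n : ℕ} (ω : MultilinearMap K (fun _ : Fin n => L) A) (Y : Fin n → HomElt ℒ) :
    toList K n ω (List.ofFn Y) = ω fun i => (Y i).val := by
  simp [toList]

lemma toList_of_length_ne {n : ℕ} (ω : MultilinearMap K (fun _ : Fin n => L) A)
    {t : List (HomElt ℒ)} (h : t.length ≠ n) : toList K n ω t = 0 := by
  simp [toList, h]

/-- The tuples `Y` and `Y ∘ swap i j`, for neighbours `i` and `j`, as lists. -/
lemma ofFn_swap {α : Type*} {n : ℕ} (Y : Fin n → α) (i j : Fin n) (hij : (i : ℕ) + 1 = j) :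
    ∃ s u, s.length = (i : ℕ) ∧ List.ofFn Y = s ++ Y i :: Y j :: u ∧
      List.ofFn (Y ∘ Equiv.swap i j) = s ++ Y j :: Y i :: u := by
  have hj := j.2
  refine ⟨(List.ofFn Y).take i, (List.ofFn Y).drop (i + 2), by simp, ?_, ?_⟩
  · conv_lhs => rw [← List.take_append_drop i (List.ofFn Y)]
    rw [List.drop_eq_getElem_cons (by simp),
      List.drop_eq_getElem_cons (i := i + 1) (by simp; omega)]
    simp only [List.getElem_ofFn]
    congr
  · refine List.ext_getElem (by simp; omega) fun k h1 h2 => ?_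
    have hk : k < n := by simpa using h1
    simp only [List.getElem_ofFn, List.getElem_append, List.getElem_cons, Function.comp_apply,
      List.length_take, List.length_ofFn, List.getElem_take, List.getElem_drop,
      Equiv.swap_apply_def, Fin.ext_iff]
    have hmin : min (i : ℕ) n = i := by omega
    simp only [hmin]
    split_ifs with h3 h4 h5 h6 h7 h8 <;> first | omega | rfl | (congr 1; ext; simp; omega)

lemma toList_mem {p : ℕ × Γ} {ω : MultilinearMap K (fun _ : Fin p.1 => L) A}
    (hω : ω ∈ altForms ε 𝒜 ℒ p.1 p.2) : toList K p.1 ω ∈ formSpace ε 𝒜 ℒ p := by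
  have hne : ∀ t : List (HomElt ℒ), t.length ≠ p.1 → toList K p.1 ω t = 0 :=
    fun t ht => toList_of_length_ne ω ht
  refine ⟨hne, fun t => ?_, fun s t X Y => ?_, fun s t γ c x y => ?_⟩
  · by_cases ht : t.length = p.1
    · obtain ⟨Y, rfl⟩ := exists_ofFn_eq t ht
      rw [toList_ofFn, List.map_ofFn, List.sum_ofFn]
      exact (hω (fun i => (Y i).1) _ fun i => (Y i).2.2).1
    · rw [hne t ht]
      exact Submodule.zero_mem _
  · by_cases ht : (s ++ X :: Y :: t).length = p.1
    · obtain ⟨Z, hZ⟩ := exists_ofFn_eq _ ht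
      have hlen : s.length + (t.length + 2) = p.1 := by simpa [add_assoc] using ht
      obtain ⟨i, hi⟩ : ∃ i : Fin p.1, (i : ℕ) = s.length := ⟨⟨s.length, by omega⟩, rfl⟩
      obtain ⟨j, hj⟩ : ∃ j : Fin p.1, (j : ℕ) = s.length + 1 := ⟨⟨s.length + 1, by omega⟩, rfl⟩
      have hij : (i : ℕ) + 1 = j := by omega
      obtain ⟨s', u, h1, h2, h3⟩ := ofFn_swap Z i j hij
      obtain ⟨h4, h5⟩ := List.append_inj (hZ.trans h2) (by omega)
      obtain ⟨h6, h7, h8⟩ : X = _ ∧ Y = _ ∧ t = u := by simpa using h5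
      have h9 := (hω (fun i => (Z i).1) _ fun i => (Z i).2.2).2 i j hij
      rw [hZ, h4, h6, h7, h8, ← h3, toList_ofFn, toList_ofFn]
      exact h9
    · rw [hne _ ht, hne (s ++ Y :: X :: t) (by simpa using ht), smul_zero, neg_zero]
  · by_cases ht : (s ++ (⟨γ, x⟩ : HomElt ℒ) :: t).length = p.1
    · obtain ⟨Z, hZ⟩ := exists_ofFn_eq _ ht
      have hlen : s.length + (t.length + 1) = p.1 := by simpa using ht
      have key : ∀ W : HomElt ℒ, toList K p.1 ω (s ++ W :: t) =
          ω (Function.update (fun i => (Z i).val) ⟨s.length, by omega⟩ W.val) := by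
        intro W
        have h1 : s ++ W :: t = List.ofFn (Function.update Z ⟨s.length, by omega⟩ W) := by
          rw [ofFn_update_eq, ← hZ]
          simp
        rw [h1, toList_ofFn]
        congr 1
        funext i
        exact Function.apply_update (fun _ => HomElt.val) _ _ _ _
      rw [key, key, key, ← ω.map_update_smul, ← ω.map_update_add]
      rfl
    · rw [hne _ ht, hne _ (by simpa using ht), hne _ (by simpa using ht), smul_zero, add_zero]

variable [DirectSum.Decomposition ℒ]

/-- A multilinear map is determined by its values at homogeneous elements. -/
lemma multilinear_eq_zero {n : ℕ} (ω : MultilinearMap K (fun _ : Fin n => L) A)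
    (h : ∀ Y : Fin n → HomElt ℒ, ω (fun i => (Y i).val) = 0) : ω = 0 := by
  classical
  ext X
  have h1 : X = fun i => ∑ j ∈ (DirectSum.decompose ℒ (X i)).support,
      (DirectSum.decompose ℒ (X i) j : L) := by
    funext i
    exact (DirectSum.sum_support_decompose ℒ (X i)).symm
  rw [h1, MultilinearMap.map_sum_finset]
  refine Finset.sum_eq_zero fun r _ => ?_
  exact h fun i => ⟨r i, DirectSum.decompose ℒ (X i) (r i)⟩

lemma toList_injective (n : ℕ) : Function.Injective
    (toList K n : MultilinearMap K (fun _ : Fin n => L) A →ₗ[K] (List (HomElt ℒ) → A)) := by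
  rw [injective_iff_map_eq_zero]
  intro ω h
  refine multilinear_eq_zero (ℒ := ℒ) ω fun Y => ?_
  rw [← toList_ofFn, h]
  rfl

/-- A function of lists which is alternating and linear in each homogeneous entry comes from a
multilinear map: for each sequence of degrees it defines a multilinear map on the components of
these degrees, and these maps are glued by `homExt`. -/
lemma toList_surjective {p : ℕ × Γ} {f : List (HomElt ℒ) → A} (hf : f ∈ formSpace ε 𝒜 ℒ p) :
    ∃ ω ∈ altForms ε 𝒜 ℒ p.1 p.2, toList K p.1 ω = f := by
  have hslot : ∀ (d : Fin p.1 → Γ) (x : (i : Fin p.1) → ℒ (d i)) (i : Fin p.1) (y : ℒ (d i)),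
      (List.ofFn fun j => (⟨d j, Function.update x i y j⟩ : HomElt ℒ)) =
        (List.ofFn fun j => (⟨d j, x j⟩ : HomElt ℒ)).take i ++ (⟨d i, y⟩ : HomElt ℒ) ::
          (List.ofFn fun j => (⟨d j, x j⟩ : HomElt ℒ)).drop (i + 1) := by
    intro d x i y
    rw [← ofFn_update_eq]
    congr 1
    funext j
    by_cases h : j = i
    · subst h; simp
    · simp [h]
  let m : (d : Fin p.1 → Γ) → MultilinearMap K (fun i : Fin p.1 => ℒ (d i)) A := fun d =>
    MultilinearMap.mk' (fun x => f (List.ofFn fun j => (⟨d j, x j⟩ : HomElt ℒ)))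
      (fun x i y z => by
        rw [hslot, hslot, hslot]
        have := hf.2.2.2 ((List.ofFn fun j => (⟨d j, x j⟩ : HomElt ℒ)).take i)
          ((List.ofFn fun j => (⟨d j, x j⟩ : HomElt ℒ)).drop (i + 1)) (d i) 1 y z
        rwa [one_smul, one_smul] at this)
      (fun x i c y => by
        rw [hslot, hslot]
        exact hf.2.2.2.smul_eq _ _ _ rfl rfl)
  let ω := homExt ℒ p.1 fun d => (m d).compLinearMap fun i =>
    DirectSum.component K Γ (fun γ => ℒ γ) (d i) ∘ₗ
      (DirectSum.decomposeLinearEquiv ℒ).toLinearMap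
  have hω : ∀ Y : Fin p.1 → HomElt ℒ, ω (fun i => (Y i).val) = f (List.ofFn Y) := by
    intro Y
    change homExt ℒ p.1 _ _ = _
    rw [homExt_apply ℒ p.1 _ (fun i => (Y i).1) (fun i => (Y i).val) fun i => (Y i).2.2]
    simp only [m, MultilinearMap.compLinearMap_apply, MultilinearMap.mk'_apply,
      LinearMap.comp_apply, LinearEquiv.coe_coe, DirectSum.decomposeLinearEquiv_apply]
    congr 1
    refine congrArg _ (funext fun i => HomElt.ext rfl ?_)
    exact DirectSum.decompose_of_mem_same ℒ (Y i).2.2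
  refine ⟨ω, fun d X hX => ?_, ?_⟩
  · have h1 := hω fun i => ⟨d i, X i, hX i⟩
    have h1' : ω X = f (List.ofFn fun i => (⟨d i, X i, hX i⟩ : HomElt ℒ)) := h1
    refine ⟨?_, fun i j hij => ?_⟩
    · have h2 := hf.2.1 (List.ofFn fun i => (⟨d i, X i, hX i⟩ : HomElt ℒ))
      rw [List.map_ofFn, List.sum_ofFn] at h2
      rw [h1']
      exact h2
    · have h2 : ω (X ∘ Equiv.swap i j) =
          f (List.ofFn ((fun i => (⟨d i, X i, hX i⟩ : HomElt ℒ)) ∘ Equiv.swap i j)) :=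
        hω ((fun i => (⟨d i, X i, hX i⟩ : HomElt ℒ)) ∘ Equiv.swap i j)
      obtain ⟨s, u, -, h4, h5⟩ := ofFn_swap (fun i => (⟨d i, X i, hX i⟩ : HomElt ℒ)) i j hij
      rw [h1', h2, h4, h5]
      exact hf.2.2.1 s u _ _
  · ext t
    by_cases ht : t.length = p.1
    · obtain ⟨Y, rfl⟩ := exists_ofFn_eq t ht
      rw [toList_ofFn, hω]
    · rw [toList_of_length_ne ω ht, hf.1 t ht]

variable (ε 𝒜 ℒ) in
/-- The `ε`-alternating multilinear maps of degree `p` are the elements of `formSpace p`. -/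
def altFormsEquiv (p : ℕ × Γ) : altForms ε 𝒜 ℒ p.1 p.2 ≃ₗ[K] formSpace ε 𝒜 ℒ p :=
  LinearEquiv.ofBijective
    ((toList K p.1).restrict (p := altForms ε 𝒜 ℒ p.1 p.2) (q := formSpace ε 𝒜 ℒ p)
      fun _ h => toList_mem h)
    ⟨fun ω η h => Subtype.ext (toList_injective p.1 (congrArg Subtype.val h)), fun f => by
      obtain ⟨ω, h1, h2⟩ := toList_surjective f.2
      exact ⟨⟨ω, h1⟩, Subtype.ext h2⟩⟩

end FormSpace
end EpsGraded

namespace EpsGraded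

/-! ### The graded differential algebra of forms -/

section Calculus

variable {Γ K : Type*} [AddCommGroup Γ] [DecidableEq Γ] [Field K] (ε : CommutationFactor Γ K)
variable {A : Type*} [Ring A] [Algebra K A] (𝒜 : Γ → Submodule K A)
variable {L : Type*} [AddCommGroup L] [Module K L] (ℒ : Γ → Submodule K L)

lemma isInternal_range_lof {ι : Type*} [DecidableEq ι] (F : ι → Type*) [∀ i, AddCommGroup (F i)]
    [∀ i, Module K (F i)] :
    DirectSum.IsInternal fun i => LinearMap.range (DirectSum.lof K ι F i) := by
  refine DirectSum.isInternal_submodule_of_iSupIndep_of_iSup_eq_top ?_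
    DFinsupp.iSup_range_lsingle
  rw [iSupIndep_def]
  intro i
  rw [Submodule.disjoint_def]
  rintro _ ⟨x, rfl⟩ hx
  have : (⨆ j, ⨆ _ : j ≠ i, LinearMap.range (DirectSum.lof K ι F j)) ≤
      LinearMap.ker (DirectSum.component K ι F i) := by
    refine iSup₂_le fun j hj => ?_
    rintro _ ⟨y, rfl⟩
    rw [LinearMap.mem_ker, DirectSum.component.of, dif_neg hj]
  have h2 := this hx
  rw [LinearMap.mem_ker, DirectSum.component.lof_self] at h2
  rw [h2, map_zero]

/-- The direct sum of the spaces of forms. -/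
abbrev Calculus : Type _ := ⨁ p : ℕ × Γ, formSpace ε 𝒜 ℒ p

/-- The inclusion of the space of forms of degree `p`. -/
abbrev calculusOf (p : ℕ × Γ) : formSpace ε 𝒜 ℒ p →ₗ[K] Calculus ε 𝒜 ℒ :=
  DirectSum.lof K (ℕ × Γ) (fun p => formSpace ε 𝒜 ℒ p) p

/-- The grading of the direct sum of the spaces of forms. -/
def calculusGrading (p : ℕ × Γ) : Submodule K (Calculus ε 𝒜 ℒ) :=
  LinearMap.range (calculusOf ε 𝒜 ℒ p)

/-- A sum of forms as a function of lists. -/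
def realize : Calculus ε 𝒜 ℒ →ₗ[K] (List (HomElt ℒ) → A) :=
  DirectSum.toModule K (ℕ × Γ) _ fun p => (formSpace ε 𝒜 ℒ p).subtype

lemma realize_of (p : ℕ × Γ) (f : formSpace ε 𝒜 ℒ p) :
    realize ε 𝒜 ℒ (calculusOf ε 𝒜 ℒ p f) = f := by
  simp [realize]

/-- A sum of forms of different degrees is determined by its values: the arity is the number of
arguments, and the degree can be read off from the degrees of the arguments and of the values. -/
lemma realize_injective [GradedAlgebra 𝒜] : Function.Injective (realize ε 𝒜 ℒ) := by
  classical
  rw [injective_iff_map_eq_zero]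
  intro x hx
  refine DirectSum.ext_component K fun p => ?_
  rw [map_zero]
  refine Subtype.ext (funext fun t => ?_)
  change (x p : List (HomElt ℒ) → A) t = 0
  by_cases ht : t.length = p.1
  · have h1 : ∑ q ∈ DFinsupp.support x, (x q : List (HomElt ℒ) → A) t = 0 := by
      have h2 := congrFun hx t
      rw [← DirectSum.sum_support_of x, map_sum] at h2
      rw [Finset.sum_apply] at h2
      refine Eq.trans ?_ h2
      refine Finset.sum_congr rfl fun q _ => ?_
      exact (congrFun (realize_of ε 𝒜 ℒ q (x q)) t).symm
    set S := (t.map Sigma.fst).sum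
    -- among the values at `t`, only that of `x p` has a component of degree `p.2 + S`
    have h3 : ∀ q, (DirectSum.decompose 𝒜 ((x q : List (HomElt ℒ) → A) t) (p.2 + S) : A) =
        if q = p then (x p : List (HomElt ℒ) → A) t else 0 := by
      intro q
      by_cases hq : q = p
      · subst hq
        rw [if_pos rfl]
        exact DirectSum.decompose_of_mem_same 𝒜 ((x q).2.2.1 t)
      · rw [if_neg hq]
        by_cases hq1 : q.1 = p.1
        · refine DirectSum.decompose_of_mem_ne 𝒜 ((x q).2.2.1 t) ?_
          intro h4
          exact hq (Prod.ext hq1 (add_right_cancel h4))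
        · rw [(x q).2.1 t (by rw [ht]; exact Ne.symm hq1)]
          simp
    have h4 := congrArg (fun a => (DirectSum.decompose 𝒜 a (p.2 + S) : A)) h1
    simp only [DirectSum.decompose_sum, DirectSum.sum_apply, AddSubmonoidClass.coe_finsetSum, h3,
      Finset.sum_ite_eq', DirectSum.decompose_zero, DirectSum.zero_apply,
      ZeroMemClass.coe_zero] at h4
    by_cases hp : p ∈ DFinsupp.support x
    · rwa [if_pos hp] at h4
    · rw [DFinsupp.notMem_support_iff.mp hp]
      rfl
  · exact (x p).2.1 t ht

/-- The product of forms. -/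
def calculusMul [SetLike.GradedMul 𝒜] :
    Calculus ε 𝒜 ℒ →ₗ[K] Calculus ε 𝒜 ℒ →ₗ[K] Calculus ε 𝒜 ℒ :=
  DirectSum.toModule K (ℕ × Γ) _ fun p => LinearMap.flip (DirectSum.toModule K (ℕ × Γ) _ fun q =>
    LinearMap.flip (LinearMap.mk₂ K
      (fun (f : formSpace ε 𝒜 ℒ p) (g : formSpace ε 𝒜 ℒ q) => calculusOf ε 𝒜 ℒ (p + q)
        ⟨formMul ε Sigma.fst q.2 f.1 g.1, formMul_mem f.2 g.2⟩)
      (fun f f' g => by rw [← map_add]; congr 1; ext1; simp)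
      (fun c f g => by rw [← map_smul]; congr 1; ext1; simp)
      (fun f g g' => by rw [← map_add]; congr 1; ext1; simp)
      (fun c f g => by rw [← map_smul]; congr 1; ext1; simp)))

lemma calculusMul_of_of [SetLike.GradedMul 𝒜] (p q : ℕ × Γ) (f : formSpace ε 𝒜 ℒ p)
    (g : formSpace ε 𝒜 ℒ q) :
    calculusMul ε 𝒜 ℒ (calculusOf ε 𝒜 ℒ p f) (calculusOf ε 𝒜 ℒ q g) =
      calculusOf ε 𝒜 ℒ (p + q) ⟨formMul ε Sigma.fst q.2 f.1 g.1, formMul_mem f.2 g.2⟩ := by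
  simp [calculusMul]

lemma realize_mul_of [SetLike.GradedMul 𝒜] (x : Calculus ε 𝒜 ℒ) (q : ℕ × Γ)
    (g : formSpace ε 𝒜 ℒ q) :
    realize ε 𝒜 ℒ (calculusMul ε 𝒜 ℒ x (calculusOf ε 𝒜 ℒ q g)) =
      formMul ε Sigma.fst q.2 (realize ε 𝒜 ℒ x) g := by
  induction x using DirectSum.induction_on with
  | zero => simp
  | of p f =>
    change realize ε 𝒜 ℒ (calculusMul ε 𝒜 ℒ (calculusOf ε 𝒜 ℒ p f) _) =
      formMul ε Sigma.fst q.2 (realize ε 𝒜 ℒ (calculusOf ε 𝒜 ℒ p f)) g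
    rw [calculusMul_of_of, realize_of, realize_of]
  | add x y hx hy => simp only [map_add, LinearMap.add_apply, hx, hy]

variable (A) in
/-- The unit of the algebra of forms. -/
def unitForm : List (HomElt ℒ) → A
  | [] => 1
  | _ :: _ => 0

lemma contract_unitForm (X : HomElt ℒ) : contract K X (unitForm A ℒ) = 0 := rfl

lemma parity_unitForm : parity K (unitForm A ℒ) = unitForm A ℒ := by
  ext t
  rcases t with _ | ⟨X, t⟩ <;> simp [parity_apply, unitForm]

lemma unitForm_mem [SetLike.GradedOne 𝒜] : unitForm A ℒ ∈ formSpace ε 𝒜 ℒ (0, 0) := by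
  refine ⟨?_, ?_, ?_, ?_⟩
  · rintro (_ | ⟨X, t⟩) ht
    · exact absurd rfl ht
    · rfl
  · rintro (_ | ⟨X, t⟩)
    · simpa [unitForm] using SetLike.GradedOne.one_mem
    · exact Submodule.zero_mem _
  · rintro (_ | ⟨Z, s⟩) t X Y <;> simp [unitForm]
  · rintro (_ | ⟨Z, s⟩) t γ c x y <;> simp [unitForm]

lemma unitForm_formMul (l : Γ) (g : List (HomElt ℒ) → A) :
    formMul ε Sigma.fst l (unitForm A ℒ) g = g := by
  ext t
  induction t generalizing l g with
  | nil => simp [formMul_nil, unitForm]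
  | cons X t ih =>
    rw [formMul_cons, contract_unitForm, parity_unitForm, ih, map_zero]
    simp [contract_apply]

lemma formMul_unitForm (f : List (HomElt ℒ) → A) :
    formMul ε Sigma.fst 0 f (unitForm A ℒ) = f := by
  ext t
  induction t generalizing f with
  | nil => simp [formMul_nil, unitForm]
  | cons X t ih =>
    rw [formMul_cons, contract_unitForm, ih, map_zero, factor_zero_left]
    simp [contract_apply]

/-- The unit of the algebra of forms. -/
def calculusOne [SetLike.GradedOne 𝒜] : Calculus ε 𝒜 ℒ :=
  calculusOf ε 𝒜 ℒ (0, 0) ⟨unitForm A ℒ, unitForm_mem ε 𝒜 ℒ⟩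

variable {ε ℒ} {br : L →ₗ[K] L →ₗ[K] L} (hL : IsEpsLieAlgebra ε ℒ br) {ρ : L →ₗ[K] A →ₗ[K] A}
variable (hρ : IsDerAction ε Sigma.fst (homBracket hL) (homAction ρ) 𝒜)

/-- The differential of forms. -/
def calculusDif : Calculus ε 𝒜 ℒ →ₗ[K] Calculus ε 𝒜 ℒ :=
  DirectSum.toModule K (ℕ × Γ) _ fun p => calculusOf ε 𝒜 ℒ (p + (1, 0)) ∘ₗ
    (dif ε Sigma.fst (homBracket hL) (homAction ρ) p.2).restrict
      (p := formSpace ε 𝒜 ℒ p) (q := formSpace ε 𝒜 ℒ (p + (1, 0))) fun _ hf => dif_mem hL hρ hf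

lemma calculusDif_of (p : ℕ × Γ) (f : formSpace ε 𝒜 ℒ p) :
    calculusDif 𝒜 hL hρ (calculusOf ε 𝒜 ℒ p f) = calculusOf ε 𝒜 ℒ (p + (1, 0))
      ⟨dif ε Sigma.fst (homBracket hL) (homAction ρ) p.2 f.1, dif_mem hL hρ f.2⟩ := by
  simp [calculusDif]
  rfl

lemma realize_dif_of (p : ℕ × Γ) (f : formSpace ε 𝒜 ℒ p) :
    realize ε 𝒜 ℒ (calculusDif 𝒜 hL hρ (calculusOf ε 𝒜 ℒ p f)) =
      dif ε Sigma.fst (homBracket hL) (homAction ρ) p.2 f := by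
  rw [calculusDif_of, realize_of]

/-- Induction on elements of the direct sum of the spaces of forms. -/
lemma calculus_induction {P : Calculus ε 𝒜 ℒ → Prop} (h0 : P 0)
    (h : ∀ p f, P (calculusOf ε 𝒜 ℒ p f)) (hadd : ∀ x y, P x → P y → P (x + y))
    (x : Calculus ε 𝒜 ℒ) : P x :=
  DirectSum.induction_on x h0 h hadd

/-- The rules established for functions of lists make the direct sum of the spaces of forms a graded
differential algebra; they are carried over by `realize_injective`. -/
theorem calculus_isGradedDiffAlgebra [GradedAlgebra 𝒜] :
    IsGradedDiffAlgebra ε (calculusGrading ε 𝒜 ℒ) (calculusMul ε 𝒜 ℒ) (calculusOne ε 𝒜 ℒ)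
      (calculusDif 𝒜 hL hρ) where
  isInternal := isInternal_range_lof fun p => formSpace ε 𝒜 ℒ p
  mul_assoc x y z := by
    induction z using calculus_induction with
    | h0 => simp
    | hadd z w hz hw => simp only [map_add, hz, hw]
    | h r h =>
      induction y using calculus_induction with
      | h0 => simp
      | hadd z w hz hw => simp only [map_add, LinearMap.add_apply, hz, hw]
      | h q g =>
        apply realize_injective ε 𝒜 ℒ
        rw [realize_mul_of, realize_mul_of, calculusMul_of_of, realize_mul_of]
        exact formMul_assoc ε _ _ _ _ _ _
  one_mul x := by
    induction x using calculus_induction with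
    | h0 => simp
    | hadd z w hz hw => simp only [map_add, hz, hw]
    | h p f =>
      apply realize_injective ε 𝒜 ℒ
      rw [realize_mul_of, calculusOne, realize_of, realize_of, unitForm_formMul]
  mul_one x := by
    apply realize_injective ε 𝒜 ℒ
    rw [calculusOne, realize_mul_of]
    exact formMul_unitForm ε ℒ _
  one_mem := ⟨_, rfl⟩
  mul_mem := by
    rintro p q _ ⟨f, rfl⟩ _ ⟨g, rfl⟩
    rw [calculusMul_of_of]
    exact ⟨_, rfl⟩
  d_mem := by
    rintro p _ ⟨f, rfl⟩
    rw [calculusDif_of]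
    exact ⟨_, rfl⟩
  d_mul := by
    rintro p _ ⟨f, rfl⟩ y
    induction y using calculus_induction with
    | h0 => simp
    | hadd z w hz hw =>
      simp only [map_add, smul_add, hz, hw]
      abel
    | h q g =>
      apply realize_injective ε 𝒜 ℒ
      rw [factor_zero_left, calculusMul_of_of, realize_dif_of, map_add, map_smul, realize_mul_of,
        realize_dif_of, calculusDif_of 𝒜 hL hρ q, realize_mul_of, realize_of]
      have h1 := dif_formMul hρ f.2.2.1 q.2 g.1
      rw [f.2.1.parity_eq (K := K), map_smul, LinearMap.smul_apply] at h1
      have h2 : (q + (1, 0)).2 = q.2 := add_zero _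
      rw [h2, Units.val_one, mul_one]
      exact h1
  d_d x := by
    induction x using calculus_induction with
    | h0 => simp
    | hadd z w hz hw => simp only [map_add, hz, hw, add_zero]
    | h p f =>
      apply realize_injective ε 𝒜 ℒ
      rw [calculusDif_of, realize_dif_of, map_zero]
      have h2 : (p + (1, 0)).2 = p.2 := add_zero _
      rw [h2]
      exact dif_dif hρ (f.2.2.2.2.isLieCompatible hL) _

end Calculus

/-! ### Transport of graded differential algebras -/

section Transport

variable {Γ K : Type*} [AddCommGroup Γ] [DecidableEq Γ] [Field K] {ε : CommutationFactor Γ K}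
variable {E F G : Type*} [AddCommMonoid E] [Module K E] [AddCommMonoid F] [Module K F]
  [AddCommMonoid G] [Module K G]

/-- The product transported along a linear equivalence. -/
def transportMul (e : E ≃ₗ[K] F) (mul : E →ₗ[K] E →ₗ[K] E) : F →ₗ[K] F →ₗ[K] F :=
  (mul.compl₁₂ e.symm.toLinearMap e.symm.toLinearMap).compr₂ e.toLinearMap

lemma transportMul_apply (e : E ≃ₗ[K] F) (mul : E →ₗ[K] E →ₗ[K] E) (x y : F) :
    transportMul e mul x y = e (mul (e.symm x) (e.symm y)) := rfl

lemma isGradedDiffAlgebraIso_transport {𝒢 : ℕ × Γ → Submodule K E} {mul : E →ₗ[K] E →ₗ[K] E}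
    {one : E} {d : E →ₗ[K] E} (e : E ≃ₗ[K] F) {ℋ : ℕ × Γ → Submodule K F} {one' : F}
    (hgr : ∀ p, (𝒢 p).map (e : E →ₗ[K] F) = ℋ p) (hone : e one = one') :
    IsGradedDiffAlgebraIso 𝒢 mul one d ℋ (transportMul e mul) one' (e.conj d) e where
  map_grading := hgr
  map_mul x y := by simp [transportMul_apply]
  map_one := hone
  map_d x := by simp [LinearEquiv.conj_apply]

lemma IsGradedDiffAlgebraIso.symm_trans {𝒢 : ℕ × Γ → Submodule K E} {mul : E →ₗ[K] E →ₗ[K] E}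
    {one : E} {d : E →ₗ[K] E} {ℋ : ℕ × Γ → Submodule K F} {mul' : F →ₗ[K] F →ₗ[K] F} {one' : F}
    {d' : F →ₗ[K] F} {𝒥 : ℕ × Γ → Submodule K G} {mul'' : G →ₗ[K] G →ₗ[K] G} {one'' : G}
    {d'' : G →ₗ[K] G} {e : E ≃ₗ[K] F} {e' : E ≃ₗ[K] G}
    (h : IsGradedDiffAlgebraIso 𝒢 mul one d ℋ mul' one' d' e)
    (h' : IsGradedDiffAlgebraIso 𝒢 mul one d 𝒥 mul'' one'' d'' e') :
    IsGradedDiffAlgebraIso ℋ mul' one' d' 𝒥 mul'' one'' d'' (e.symm.trans e') where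
  map_grading p := by
    rw [← h'.map_grading p, ← h.map_grading p, ← Submodule.map_comp]
    congr 1
    ext x
    simp
  map_mul x y := by
    obtain ⟨x, rfl⟩ := e.surjective x
    obtain ⟨y, rfl⟩ := e.surjective y
    rw [← h.map_mul]
    simp [h'.map_mul]
  map_one := by
    rw [← h.map_one]
    simp [h'.map_one]
  map_d x := by
    obtain ⟨x, rfl⟩ := e.surjective x
    rw [← h.map_d]
    simp [h'.map_d]

lemma isInternal_map_equiv {ι : Type*} [DecidableEq ι] {𝒢 : ι → Submodule K E}
    (h : DirectSum.IsInternal 𝒢) (e : E ≃ₗ[K] F) :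
    DirectSum.IsInternal fun i => (𝒢 i).map (e : E →ₗ[K] F) := by
  have h1 : ⇑(DirectSum.coeAddMonoidHom fun i => (𝒢 i).map (e : E →ₗ[K] F)) ∘
      ⇑(DFinsupp.mapRange.linearEquiv fun i => e.submoduleMap (𝒢 i)) =
        ⇑e ∘ ⇑(DirectSum.coeAddMonoidHom 𝒢) := by
    funext x
    simp only [Function.comp_apply]
    induction x using DirectSum.induction_on with
    | zero => simp
    | of i x =>
      have h2 : (DFinsupp.mapRange.linearEquiv fun i => e.submoduleMap (𝒢 i))
          (DirectSum.of (fun i => 𝒢 i) i x) =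
            DirectSum.of (fun i => (𝒢 i).map (e : E →ₗ[K] F)) i (e.submoduleMap (𝒢 i) x) :=
        DFinsupp.mapRange_single (hf := fun _ => map_zero _)
      rw [h2, DirectSum.coeAddMonoidHom_of, DirectSum.coeAddMonoidHom_of]
      rfl
    | add x y hx hy => rw [map_add, map_add, map_add, map_add, hx, hy]
  exact (Function.Bijective.of_comp_iff _ (LinearEquiv.bijective _)).mp
    (h1 ▸ e.bijective.comp h)

lemma IsGradedDiffAlgebra.of_iso {𝒢 : ℕ × Γ → Submodule K E} {mul : E →ₗ[K] E →ₗ[K] E}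
    {one : E} {d : E →ₗ[K] E} {ℋ : ℕ × Γ → Submodule K F} {mul' : F →ₗ[K] F →ₗ[K] F} {one' : F}
    {d' : F →ₗ[K] F} {e : E ≃ₗ[K] F} (h : IsGradedDiffAlgebra ε 𝒢 mul one d)
    (he : IsGradedDiffAlgebraIso 𝒢 mul one d ℋ mul' one' d' e) :
    IsGradedDiffAlgebra ε ℋ mul' one' d' where
  isInternal := by
    have := isInternal_map_equiv h.isInternal e
    simpa only [he.map_grading] using this
  mul_assoc x y z := by
    obtain ⟨x, rfl⟩ := e.surjective x
    obtain ⟨y, rfl⟩ := e.surjective y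
    obtain ⟨z, rfl⟩ := e.surjective z
    simp only [← he.map_mul, h.mul_assoc]
  one_mul x := by
    obtain ⟨x, rfl⟩ := e.surjective x
    rw [← he.map_one, ← he.map_mul, h.one_mul]
  mul_one x := by
    obtain ⟨x, rfl⟩ := e.surjective x
    rw [← he.map_one, ← he.map_mul, h.mul_one]
  one_mem := by
    rw [← he.map_one, ← he.map_grading]
    exact ⟨_, h.one_mem, rfl⟩
  mul_mem p q := by
    simp only [← he.map_grading]
    rintro _ ⟨x, hx, rfl⟩ _ ⟨y, hy, rfl⟩
    exact ⟨_, h.mul_mem p q x hx y hy, he.map_mul x y⟩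
  d_mem p := by
    simp only [← he.map_grading]
    rintro _ ⟨x, hx, rfl⟩
    exact ⟨_, h.d_mem p x hx, he.map_d x⟩
  d_mul p := by
    simp only [← he.map_grading]
    rintro _ ⟨x, hx, rfl⟩ y
    obtain ⟨y, rfl⟩ := e.surjective y
    have := congrArg e (h.d_mul p x hx y)
    rw [LinearEquiv.coe_coe]
    simpa only [map_add, map_smul, he.map_d, he.map_mul] using this
  d_d x := by
    obtain ⟨x, rfl⟩ := e.surjective x
    rw [← he.map_d, ← he.map_d, h.d_d, map_zero]

end Transport
end EpsGraded

namespace EpsGraded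

/-! ### The weights of permutations in the evaluation of exterior products -/

section EvalFactor

variable {Γ K : Type*} [AddCommGroup Γ] [DecidableEq Γ] [Field K] (ε : CommutationFactor Γ K)

/-- The weight of `σ` at arguments of degrees `d` and that of the identity at the permuted arguments
differ by the factor of the inversions of `σ`. -/
lemma evalFactor_eq_mul_inversionFactor {n : ℕ} (d : Fin n → Γ) (σ : Equiv.Perm (Fin n)) :
    evalFactor ε d σ = evalFactor ε (fun a => d (σ a)) 1 * inversionFactor ε d σ := by
  rw [evalFactor, evalFactor, inversionFactor, ← Finset.prod_mul_distrib]
  refine Finset.prod_congr rfl fun a _ => ?_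
  by_cases h : a.1 < a.2
  · rcases lt_or_gt_of_ne (fun h' => h.ne (σ.injective h')) with h' | h'
    · simp [h, h', h'.not_gt]
    · simp [h, h', h'.not_gt, ε.mul_swap]
  · simp [h]

/-- The weights of the identity at the arguments and at the permuted arguments. -/
lemma evalFactor_one_eq {n : ℕ} (d : Fin n → Γ) (σ : Equiv.Perm (Fin n)) :
    evalFactor ε d 1 = evalFactor ε (fun a => d (σ a)) 1 * inversionFactor ε d σ ^ 2 := by
  set g : Fin n × Fin n → Kˣ := fun a => if σ a.1 < σ a.2 then ε (d (σ a.1)) (d (σ a.2)) else 1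
    with hg
  have h1 : evalFactor ε d 1 = ∏ a, g a := by
    rw [evalFactor, ← Equiv.prod_comp (σ.prodCongr σ)]
    refine Finset.prod_congr rfl fun a _ => ?_
    simp only [Equiv.prodCongr_apply, Prod.map_fst, Prod.map_snd, Equiv.Perm.coe_one, id, hg]
    split_ifs <;> rfl
  -- the diagonal does not contribute, and the pairs `a.2 < a.1` are the transposes of `a.1 < a.2`
  have h2 : ∏ a, g a = (∏ a : Fin n × Fin n, if a.1 < a.2 then g a else 1) *
      ∏ a : Fin n × Fin n, if a.1 < a.2 then g a.swap else 1 := by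
    have : ∏ a : Fin n × Fin n, (if a.1 < a.2 then g a.swap else 1) =
        ∏ a : Fin n × Fin n, if a.2 < a.1 then g a else 1 :=
      Fintype.prod_equiv (Equiv.prodComm _ _) _ _ fun a => rfl
    rw [this, ← Finset.prod_mul_distrib]
    refine Finset.prod_congr rfl fun a _ => ?_
    rcases lt_trichotomy a.1 a.2 with h | h | h
    · simp [h, h.not_gt]
    · simp [hg, h]
    · simp [h, h.not_gt]
  rw [h1, h2, evalFactor, inversionFactor, ← Finset.prod_pow, ← Finset.prod_mul_distrib,
    ← Finset.prod_mul_distrib]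
  refine Finset.prod_congr rfl fun a _ => ?_
  by_cases h : a.1 < a.2
  · rcases lt_or_gt_of_ne (fun h' => h.ne (σ.injective h')) with h' | h'
    · simp [hg, h, h', h'.not_gt]
    · simp [hg, h, h', h'.not_gt, pow_two, ← mul_assoc, ε.mul_swap]
  · simp [h]

lemma inversionFactor_neg {n : ℕ} (d : Fin n → Γ) (σ : Equiv.Perm (Fin n)) :
    inversionFactor ε (fun a => -d a) σ = inversionFactor ε d σ := by
  simp only [inversionFactor, factor_neg_neg ε]

/-- The effect on `evalFactor` of the exchange of two neighbouring arguments. -/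
lemma evalFactor_swap_mul {n : ℕ} (d : Fin n → Γ) (σ : Equiv.Perm (Fin n)) (i j : Fin n)
    (hij : (i : ℕ) + 1 = j) :
    evalFactor ε d σ =
      ε (d i) (d j) * evalFactor ε (d ∘ Equiv.swap i j) (Equiv.swap i j * σ) := by
  have hne : i ≠ j := by rintro rfl; omega
  have hlt : i < j := by rw [Fin.lt_def]; omega
  have h1 : evalFactor ε d σ = ∏ a : Fin n × Fin n,
      if σ.symm a.1 < σ.symm a.2 then (if a.1 < a.2 then ε (d a.1) (d a.2) else 1) else 1 := by
    refine Fintype.prod_equiv (σ.prodCongr σ) _ _ fun a => ?_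
    simp only [Equiv.prodCongr_apply, Prod.map_fst, Prod.map_snd, Equiv.symm_apply_apply]
  have h2 : evalFactor ε (d ∘ Equiv.swap i j) (Equiv.swap i j * σ) = ∏ a : Fin n × Fin n,
      if σ.symm a.1 < σ.symm a.2 then
        (if Equiv.swap i j a.1 < Equiv.swap i j a.2 then ε (d a.1) (d a.2) else 1) else 1 := by
    refine Fintype.prod_equiv (σ.prodCongr σ) _ _ fun a => ?_
    simp only [Equiv.prodCongr_apply, Prod.map_fst, Prod.map_snd, Equiv.symm_apply_apply,
      Function.comp_apply, Equiv.Perm.mul_apply, Equiv.swap_apply_self]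
  -- the factor `ε (d i) (d j)` belongs to that of the pairs `(i, j)`, `(j, i)` which `σ.symm` keeps
  -- ordered
  have h3 : ε (d i) (d j) = ∏ a : Fin n × Fin n,
      ((if a = (i, j) then (if σ.symm i < σ.symm j then ε (d i) (d j) else 1) else 1) *
        (if a = (j, i) then (if σ.symm j < σ.symm i then ε (d i) (d j) else 1) else 1)) := by
    rw [Finset.prod_mul_distrib, Finset.prod_ite_eq', Finset.prod_ite_eq']
    rcases lt_or_gt_of_ne (fun h' => hne (σ.symm.injective h')) with h' | h'
    · simp [h', h'.not_gt]
    · simp [h', h'.not_gt]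
  rw [h1, h2, h3, ← Finset.prod_mul_distrib]
  refine Finset.prod_congr rfl ?_
  rintro ⟨a, b⟩ -
  by_cases h4 : (a, b) = (i, j)
  · have h4' : (a, b) ≠ (j, i) := by rw [h4]; simp [hne]
    rw [if_pos h4, if_neg h4']
    obtain ⟨rfl, rfl⟩ := Prod.mk.inj h4
    simp [hlt, hlt.not_gt]
  by_cases h5 : (a, b) = (j, i)
  · rw [if_neg h4, if_pos h5]
    obtain ⟨rfl, rfl⟩ := Prod.mk.inj h5
    simp only [hlt.not_gt, Equiv.swap_apply_left, Equiv.swap_apply_right, hlt, if_true, if_false,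
      one_mul, ite_self]
    split_ifs
    · exact (ε.mul_swap _ _).symm
    · simp
  rw [if_neg h4, if_neg h5, one_mul, one_mul]
  congr 1
  refine if_congr ?_ rfl rfl
  simp only [Prod.mk.injEq, Fin.ext_iff] at h4 h5
  simp only [Equiv.swap_apply_def, Fin.lt_def, Fin.ext_iff]
  split_ifs <;> omega

end EvalFactor

/-! ### The exterior algebra and alternating maps -/

section Exterior

variable {Γ K : Type*} [AddCommGroup Γ] [DecidableEq Γ] [Field K] (ε : CommutationFactor Γ K)

section Wedge

variable {V : Type*} [AddCommGroup V] [Module K V] (𝒱 : Γ → Submodule K V)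

/-- The exterior product of a list of homogeneous elements. -/
def wedgeList (t : List (HomElt 𝒱)) : EpsExterior ε 𝒱 :=
  Ideal.Quotient.mk (exteriorIdeal ε 𝒱).asIdeal
    (t.map fun X : HomElt 𝒱 => TensorAlgebra.ι K X.val).prod

lemma wedgeList_ofFn {n : ℕ} (Y : Fin n → HomElt 𝒱) :
    wedgeList ε 𝒱 (List.ofFn Y) = wedge ε 𝒱 fun i => (Y i).val := by
  rw [wedgeList, wedge, TensorAlgebra.tprod_apply, List.map_ofFn]
  rfl

/-- The defining relations of the exterior algebra. -/
lemma isAlt_wedgeList : IsAlt ε Sigma.fst (wedgeList ε 𝒱) := by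
  intro s t (X : HomElt 𝒱) (Y : HomElt 𝒱)
  rw [eq_neg_iff_add_eq_zero]
  have h1 : TensorAlgebra.ι K X.val * TensorAlgebra.ι K Y.val +
      (ε X.1 Y.1 : K) • (TensorAlgebra.ι K Y.val * TensorAlgebra.ι K X.val) ∈
        exteriorIdeal ε 𝒱 :=
    TwoSidedIdeal.subset_span ⟨X.1, Y.1, X.val, X.2.2, Y.val, Y.2.2, rfl⟩
  have h2 := TwoSidedIdeal.mul_mem_right _ _
    (t.map fun X : HomElt 𝒱 => TensorAlgebra.ι K X.val).prod
    (TwoSidedIdeal.mul_mem_left _ (s.map fun X : HomElt 𝒱 => TensorAlgebra.ι K X.val).prod _ h1)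
  have h3 := Ideal.Quotient.eq_zero_iff_mem.mpr (TwoSidedIdeal.mem_asIdeal.mpr h2)
  refine Eq.trans ?_ h3
  have h4 : ∀ (c : K) (u : TensorAlgebra K V),
      c • (Ideal.Quotient.mk (exteriorIdeal ε 𝒱).asIdeal u : EpsExterior ε 𝒱) =
        Ideal.Quotient.mk (exteriorIdeal ε 𝒱).asIdeal (c • u) := fun _ _ => rfl
  rw [wedgeList, wedgeList, h4, ← map_add]
  congr 1
  simp only [List.map_append, List.map_cons, List.prod_append, List.prod_cons, mul_add, add_mul,
    mul_smul_comm, smul_mul_assoc, mul_assoc]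

/-- The exterior product, as a multilinear map. -/
def wedgeMultilinear (n : ℕ) : MultilinearMap K (fun _ : Fin n => V) (EpsExterior ε 𝒱) :=
  (Ideal.Quotient.mkₐ K (exteriorIdeal ε 𝒱).asIdeal).toLinearMap.compMultilinearMap
    (TensorAlgebra.tprod K V n)

lemma span_wedge : Submodule.span K {ξ | ∃ (n : ℕ) (θ : Fin n → V), ξ = wedge ε 𝒱 θ} = ⊤ := by
  have hspan : ∀ t : TensorAlgebra K V, t ∈ Submodule.span K (Set.range fun l : List V =>
      (l.map (TensorAlgebra.ι K)).prod) := by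
    intro t
    induction t using TensorAlgebra.induction with
    | algebraMap r =>
      rw [Algebra.algebraMap_eq_smul_one]
      exact Submodule.smul_mem _ _ (Submodule.subset_span ⟨[], by simp⟩)
    | ι x => exact Submodule.subset_span ⟨[x], by simp⟩
    | mul a b ha hb =>
      have := Submodule.mul_mem_mul ha hb
      rw [Submodule.span_mul_span] at this
      refine Submodule.span_mono ?_ this
      rintro _ ⟨_, ⟨l, rfl⟩, _, ⟨l', rfl⟩, rfl⟩
      exact ⟨l ++ l', by simp⟩
    | add a b ha hb => exact Submodule.add_mem _ ha hb
  rw [eq_top_iff]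
  intro ξ _
  obtain ⟨t, rfl⟩ := Ideal.Quotient.mk_surjective ξ
  have h1 := Submodule.mem_map_of_mem
    (f := (Ideal.Quotient.mkₐ K (exteriorIdeal ε 𝒱).asIdeal).toLinearMap) (hspan t)
  rw [Submodule.map_span] at h1
  refine Submodule.span_mono ?_ h1
  rintro _ ⟨_, ⟨l, rfl⟩, rfl⟩
  refine ⟨l.length, l.get, ?_⟩
  have h2 : List.ofFn (fun i => TensorAlgebra.ι K (l.get i)) = l.map (TensorAlgebra.ι K) := by
    rw [← Function.comp_def, ← List.map_ofFn, List.ofFn_get]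
  rw [wedge, TensorAlgebra.tprod_apply, h2]
  rfl

end Wedge

variable {A : Type*} [Ring A] [Algebra K A] (𝒜 : Γ → Submodule K A)
variable {L : Type*} [AddCommGroup L] [Module K L] (ℒ : Γ → Submodule K L)
  [DirectSum.Decomposition ℒ]

lemma eval_wedge_of_ne {n m : ℕ} (h : m ≠ n) (a : A) (θ : Fin m → Module.Dual K L) :
    eval ε ℒ n (a ⊗ₜ wedge ε _ θ) = 0 := by
  have h1 : exteriorForm ε ℒ n (wedge ε _ θ) = 0 := tensorForm_tprod_ne ε ℒ h θ
  ext X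
  change exteriorForm ε ℒ n (wedge ε _ θ) X • a = 0
  rw [h1]
  simp

/-- Forms of exterior degree different from `n` vanish on `n` arguments. -/
lemma eval_of_mem_ne {p : ℕ × Γ} {n : ℕ} (h : p.1 ≠ n) {x : LieForms (A := A) ε ℒ}
    (hx : x ∈ lieFormsGrading ε 𝒜 ℒ p) : eval ε ℒ n x = 0 := by
  have : lieFormsGrading ε 𝒜 ℒ p ≤ LinearMap.ker (eval (A := A) ε ℒ n) := by
    refine Submodule.span_le.mpr ?_
    rintro _ ⟨i, d, a, θ, -, -, -, rfl⟩
    exact eval_wedge_of_ne ε ℒ h a θ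
  exact this hx

lemma eval_wedge_mem_altForms {n : ℕ} {i k : Γ} (a : A) (ha : a ∈ 𝒜 i) (d : Fin n → Γ)
    (θ : Fin n → Module.Dual K L) (hθ : ∀ j, θ j ∈ dualGrading ℒ (d j)) (hk : i + ∑ j, d j = k) :
    eval ε ℒ n (a ⊗ₜ wedge ε _ θ) ∈ altForms ε 𝒜 ℒ n k := by
  intro e X hX
  refine ⟨?_, fun u v huv => ?_⟩
  · rw [eval_wedge ε ℒ n a θ e X hX]
    by_cases h : ∃ σ : Equiv.Perm (Fin n), ∀ m, e (σ m) = -d m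
    · obtain ⟨σ, hσ⟩ := h
      have : k + ∑ m, e m = i := by
        rw [← Equiv.sum_comp σ e, ← hk]
        simp only [hσ, Finset.sum_neg_distrib, add_neg_cancel_right]
      rw [this]
      exact Submodule.smul_mem _ _ ha
    · -- no product of the `θ m (X (σ m))` is nonzero unless the degrees match
      push Not at h
      have h0 : ∀ σ : Equiv.Perm (Fin n), ∏ m, θ m (X (σ m)) = 0 := fun σ =>
        (h σ).elim fun m hm => Finset.prod_eq_zero (Finset.mem_univ m) (hθ m _ hm _ (hX _))
      simp [h0]
  · have hne : u ≠ v := by rintro rfl; omega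
    rw [eval_wedge ε ℒ n a θ e X hX,
      eval_wedge ε ℒ n a θ (e ∘ Equiv.swap u v) (X ∘ Equiv.swap u v) fun j => hX _, smul_smul,
      ← neg_smul, Finset.mul_sum, ← Finset.sum_neg_distrib]
    congr 1
    refine Fintype.sum_equiv (Equiv.mulLeft (Equiv.swap u v)) _ _ fun σ => ?_
    rw [evalFactor_swap_mul ε e σ u v huv]
    simp only [Equiv.coe_mulLeft, Equiv.Perm.sign_mul, Equiv.Perm.sign_swap hne, Units.val_mul,
      Function.comp_apply, Equiv.Perm.mul_apply, Equiv.swap_apply_self, Units.val_neg,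
      Units.val_one]
    push_cast
    ring

lemma eval_mem_altForms {p : ℕ × Γ} {x : LieForms (A := A) ε ℒ}
    (hx : x ∈ lieFormsGrading ε 𝒜 ℒ p) : eval ε ℒ p.1 x ∈ altForms ε 𝒜 ℒ p.1 p.2 := by
  have : lieFormsGrading ε 𝒜 ℒ p ≤ (altForms ε 𝒜 ℒ p.1 p.2).comap (eval (A := A) ε ℒ p.1) := by
    refine Submodule.span_le.mpr ?_
    rintro _ ⟨i, d, a, θ, ha, hθ, hk, rfl⟩
    exact eval_wedge_mem_altForms ε 𝒜 ℒ a ha d θ hθ hk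
  exact this hx

end Exterior
end EpsGraded

namespace EpsGraded

/-! ### Exterior forms with values in the algebra are alternating maps -/

section HomogeneousBasis

variable {Γ K : Type*} [AddCommGroup Γ] [DecidableEq Γ] [Field K] (ε : CommutationFactor Γ K)
variable {A : Type*} [Ring A] [Algebra K A] (𝒜 : Γ → Submodule K A)
variable {L : Type*} [AddCommGroup L] [Module K L] (ℒ : Γ → Submodule K L)
  [DirectSum.Decomposition ℒ]

/-- A finite-dimensional graded space has a basis of homogeneous elements, whose dual basis is
homogeneous as well. -/
lemma exists_homogeneous_basis [FiniteDimensional K L] :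
    ∃ (n : ℕ) (b : Module.Basis (Fin n) K L) (g : Fin n → Γ),
      (∀ i, b i ∈ ℒ (g i)) ∧ ∀ i, b.coord i ∈ dualGrading ℒ (-g i) := by
  have h := DirectSum.Decomposition.isInternal ℒ
  let v := fun γ => Module.Basis.ofVectorSpace K (ℒ γ)
  have := Module.Finite.finite_basis (h.collectedBasis v)
  obtain ⟨n, ⟨e⟩⟩ := Finite.exists_equiv_fin (Σ γ, Module.Basis.ofVectorSpaceIndex K (ℒ γ))
  refine ⟨n, (h.collectedBasis v).reindex e, fun i => (e.symm i).1, fun i => ?_,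
    fun i j hj x hx => ?_⟩
  · rw [Module.Basis.reindex_apply]
    exact h.collectedBasis_mem v _
  · rw [neg_neg] at hj
    rw [Module.Basis.coord_apply, Module.Basis.repr_reindex_apply]
    exact h.collectedBasis_repr_of_mem_ne v hj hx

variable {ι : Type*} [Fintype ι] (b : Module.Basis ι K L) (g : ι → Γ)

/-- The map from multilinear maps to exterior forms which is the inverse of evaluation on
alternating maps: `ω` is the sum of the `ω (b I) ⊗ (b I)*` over all sequences `I` of `n` basis
vectors, each of them divided by `n!` and by the weight of the identity permutation in the
evaluation of `(b I)*` at `b I`. -/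
def evalInv (n : ℕ) : MultilinearMap K (fun _ : Fin n => L) A →ₗ[K] LieForms (A := A) ε ℒ where
  toFun ω := ∑ I : Fin n → ι, ((n.factorial : K) * (evalFactor ε (fun m => g (I m)) 1 : K))⁻¹ •
    ((ω fun m => b (I m)) ⊗ₜ[K] wedge ε (dualGrading ℒ) fun m => b.coord (I m))
  map_add' ω η := by
    simp only [_root_.add_apply, TensorProduct.add_tmul, smul_add, Finset.sum_add_distrib]
  map_smul' c ω := by
    simp only [_root_.smul_apply, Finset.smul_sum, RingHom.id_apply, ← TensorProduct.smul_tmul',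
      smul_comm c]

lemma evalInv_apply (n : ℕ) (ω : MultilinearMap K (fun _ : Fin n => L) A) :
    evalInv ε ℒ b g n ω =
      ∑ I : Fin n → ι, ((n.factorial : K) * (evalFactor ε (fun m => g (I m)) 1 : K))⁻¹ •
        ((ω fun m => b (I m)) ⊗ₜ[K] wedge ε (dualGrading ℒ) fun m => b.coord (I m)) := rfl

variable {ℒ b g}

lemma evalInv_mem (hc : ∀ i, b.coord i ∈ dualGrading ℒ (-g i)) {p : ℕ × Γ}
    {ω : MultilinearMap K (fun _ : Fin p.1 => L) A} (hb : ∀ i, b i ∈ ℒ (g i))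
    (hω : ω ∈ altForms ε 𝒜 ℒ p.1 p.2) :
    evalInv ε ℒ b g p.1 ω ∈ lieFormsGrading ε 𝒜 ℒ p := by
  rw [evalInv_apply]
  refine Submodule.sum_mem _ fun I _ => Submodule.smul_mem _ _ (Submodule.subset_span ?_)
  refine ⟨p.2 + ∑ m, g (I m), fun m => -g (I m), _, _,
    (hω (fun m => g (I m)) (fun m => b (I m)) fun m => hb _).1, fun m => hc _, ?_, rfl⟩
  rw [Finset.sum_neg_distrib, add_neg_cancel_right]

lemma prod_coord [DecidableEq ι] {n : ℕ} (I J : Fin n → ι) (σ : Equiv.Perm (Fin n)) :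
    ∏ m, b.coord (I m) (b (J (σ m))) = if I = J ∘ σ then 1 else 0 := by
  split_ifs with h
  · refine Finset.prod_eq_one fun m _ => ?_
    rw [h]
    simp
  · obtain ⟨m, hm⟩ := Function.ne_iff.mp h
    refine Finset.prod_eq_zero (Finset.mem_univ m) ?_
    rw [Module.Basis.coord_apply, Module.Basis.repr_self]
    exact Finsupp.single_eq_of_ne hm

lemma exteriorForm_coord [DecidableEq ι] (hb : ∀ i, b i ∈ ℒ (g i)) {n : ℕ} (I J : Fin n → ι) :
    exteriorForm ε ℒ n (wedge ε _ fun m => b.coord (I m)) (fun m => b (J m)) =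
      ∑ σ : Equiv.Perm (Fin n), ((Equiv.Perm.sign σ : ℤ) : K) *
        (evalFactor ε (fun m => g (J m)) σ : K) * if I = J ∘ σ then 1 else 0 := by
  rw [exteriorForm_wedge, altForm_apply ε ℒ n _ (fun m => g (J m)) _ fun m => hb _]
  simp only [prod_coord]

lemma eval_tmul (n : ℕ) (a : A) (ξ : EpsExterior ε (dualGrading ℒ)) (X : Fin n → L) :
    eval ε ℒ n (a ⊗ₜ ξ) X = exteriorForm ε ℒ n ξ X • a := rfl

variable [CharZero K]

/-- The coefficient with which the term of `σ` at the sequence `d` enters into the evaluation of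
`evalInv`, where it belongs to the permuted sequence. -/
lemma inv_mul_evalFactor_perm {n : ℕ} (d : Fin n → Γ) (σ : Equiv.Perm (Fin n)) :
    ((n.factorial : K) * (evalFactor ε (fun a => d (σ a)) 1 : K))⁻¹ *
      (((Equiv.Perm.sign σ : ℤ) : K) * (evalFactor ε d σ : K)) =
        (n.factorial : K)⁻¹ * altFactor ε d σ := by
  rw [evalFactor_eq_mul_inversionFactor ε d σ, altFactor, mul_inv, Units.val_mul]
  have := (evalFactor ε (fun a => d (σ a)) 1).ne_zero
  field_simp

lemma sign_mul_self {n : ℕ} (σ : Equiv.Perm (Fin n)) :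
    ((Equiv.Perm.sign σ : ℤ) : K) * ((Equiv.Perm.sign σ : ℤ) : K) = 1 := by
  rw [← Int.cast_mul, ← Units.val_mul, Int.units_mul_self, Units.val_one, Int.cast_one]

/-- The coefficient with which the term of `σ` at the sequence `d` enters into `evalInv` of an
evaluation, where it belongs to `d` itself and the exterior product is permuted by `σ`. -/
lemma inv_mul_evalFactor_one_mul_altFactor {n : ℕ} (d : Fin n → Γ) (σ : Equiv.Perm (Fin n)) :
    ((n.factorial : K) * (evalFactor ε d 1 : K))⁻¹ *
      (((Equiv.Perm.sign σ : ℤ) : K) * (evalFactor ε d σ : K)) * altFactor ε d σ =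
        (n.factorial : K)⁻¹ := by
  rw [evalFactor_eq_mul_inversionFactor ε d σ, evalFactor_one_eq ε d σ, altFactor, mul_inv]
  simp only [Units.val_mul, Units.val_pow_eq_pow_val]
  have h1 := (evalFactor ε (fun a => d (σ a)) 1).ne_zero
  have h2 := (inversionFactor ε d σ).ne_zero
  have h3 := sign_mul_self (K := K) σ
  have h4 : (n.factorial : K) ≠ 0 := by exact_mod_cast n.factorial_ne_zero
  field_simp
  linear_combination h3

lemma sum_perm_const {M : Type*} [AddCommGroup M] [Module K M] (n : ℕ) (x : M) :
    ∑ _σ : Equiv.Perm (Fin n), (n.factorial : K)⁻¹ • x = x := by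
  rw [Finset.sum_const, Finset.card_univ, Fintype.card_perm, Fintype.card_fin,
    ← Nat.cast_smul_eq_nsmul K, smul_smul, mul_inv_cancel₀, one_smul]
  exact_mod_cast n.factorial_ne_zero

/-- Evaluation is surjective onto the alternating maps: in the evaluation of `evalInv ω` at the
sequence `J` of basis vectors, the permutations of `J` contribute equal terms since `ω`
alternates. -/
lemma eval_evalInv (hb : ∀ i, b i ∈ ℒ (g i)) {p : ℕ × Γ}
    {ω : MultilinearMap K (fun _ : Fin p.1 => L) A} (hω : ω ∈ altForms ε 𝒜 ℒ p.1 p.2) :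
    eval ε ℒ p.1 (evalInv ε ℒ b g p.1 ω) = ω := by
  classical
  refine Module.Basis.ext_multilinear (fun _ => b) fun J => ?_
  have hperm := fun σ : Equiv.Perm (Fin p.1) => (toList_mem hω).2.2.1.perm
    (fun m => (⟨g (J m), b (J m), hb _⟩ : HomElt ℒ)) σ
  simp only [toList_ofFn] at hperm
  have key : ∀ σ : Equiv.Perm (Fin p.1),
      ∑ I : Fin p.1 → ι, ((p.1.factorial : K) * (evalFactor ε (fun m => g (I m)) 1 : K))⁻¹ •
        ((((Equiv.Perm.sign σ : ℤ) : K) * (evalFactor ε (fun m => g (J m)) σ : K) *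
          if I = J ∘ σ then 1 else 0) • ω fun m => b (I m)) =
      (p.1.factorial : K)⁻¹ • ω fun m => b (J m) := by
    intro σ
    rw [Finset.sum_eq_single (J ∘ σ) (fun I _ hI => by rw [if_neg hI]; simp) (by simp),
      if_pos rfl, mul_one, smul_smul]
    refine (congrArg (· • _) (inv_mul_evalFactor_perm ε (fun m => g (J m)) σ)).trans ?_
    rw [mul_smul]
    exact congrArg _ (hperm σ)
  simp only [evalInv_apply, map_sum, map_smul, _root_.sum_apply, _root_.smul_apply, eval_tmul,
    exteriorForm_coord ε hb, Finset.sum_smul, Finset.smul_sum]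
  rw [Finset.sum_comm]
  simp only [key]
  exact sum_perm_const _ _

/-- `evalInv` recovers the exterior products of elements of the dual basis. The sum over sequences
reduces to the permutations of `J`, and these contribute equal terms since exterior products
alternate. -/
lemma evalInv_eval_coord (hb : ∀ i, b i ∈ ℒ (g i))
    (hc : ∀ i, b.coord i ∈ dualGrading ℒ (-g i)) {n : ℕ} (a : A) (J : Fin n → ι) :
    evalInv ε ℒ b g n (eval ε ℒ n (a ⊗ₜ wedge ε _ fun m => b.coord (J m))) =
      a ⊗ₜ wedge ε _ fun m => b.coord (J m) := by
  classical
  have hperm : ∀ (I : Fin n → ι) (σ : Equiv.Perm (Fin n)), J = I ∘ σ →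
      altFactor ε (fun m => g (I m)) σ • wedge ε (dualGrading ℒ) (fun m => b.coord (J m)) =
        wedge ε (dualGrading ℒ) fun m => b.coord (I m) := by
    rintro I σ rfl
    have := (isAlt_wedgeList ε (dualGrading ℒ)).perm
      (fun m => (⟨-g (I m), b.coord (I m), hc _⟩ : HomElt (dualGrading ℒ))) σ
    rw [wedgeList_ofFn, wedgeList_ofFn] at this
    refine Eq.trans ?_ this
    simp only [altFactor, inversionFactor_neg]
    rfl
  have key : ∀ σ : Equiv.Perm (Fin n),
      ∑ I : Fin n → ι, ((n.factorial : K) * (evalFactor ε (fun m => g (I m)) 1 : K))⁻¹ •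
        ((((Equiv.Perm.sign σ : ℤ) : K) * (evalFactor ε (fun m => g (I m)) σ : K) *
          if J = I ∘ σ then 1 else 0) •
            (a ⊗ₜ[K] wedge ε (dualGrading ℒ) fun m => b.coord (I m))) =
      (n.factorial : K)⁻¹ • (a ⊗ₜ[K] wedge ε (dualGrading ℒ) fun m => b.coord (J m)) := by
    intro σ
    have hJ : J = (J ∘ σ.symm) ∘ σ := by
      funext m
      simp
    rw [Finset.sum_eq_single (J ∘ σ.symm) (fun I _ hI => ?_) (by simp), if_pos hJ, mul_one,
      ← hperm _ _ hJ, TensorProduct.tmul_smul, smul_smul, smul_smul]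
    · congr 1
      exact inv_mul_evalFactor_one_mul_altFactor ε (fun m => g ((J ∘ σ.symm) m)) σ
    · rw [if_neg]
      · simp
      · rintro rfl
        exact hI (by funext m; simp)
  simp only [evalInv_apply, eval_tmul, exteriorForm_coord ε hb, Finset.sum_smul, Finset.smul_sum,
    TensorProduct.sum_tmul, ← TensorProduct.smul_tmul']
  rw [Finset.sum_comm]
  simp only [key]
  exact sum_perm_const _ _

/-- Evaluation is injective on each exterior degree. -/
lemma evalInv_eval_wedge (hb : ∀ i, b i ∈ ℒ (g i))
    (hc : ∀ i, b.coord i ∈ dualGrading ℒ (-g i)) {n : ℕ} (a : A) (θ : Fin n → Module.Dual K L) :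
    evalInv ε ℒ b g n (eval ε ℒ n (a ⊗ₜ wedge ε _ θ)) = a ⊗ₜ wedge ε _ θ := by
  classical
  have h : (evalInv ε ℒ b g n ∘ₗ eval ε ℒ n ∘ₗ TensorProduct.mk K A _ a).compMultilinearMap
      (wedgeMultilinear ε (dualGrading ℒ) n) =
        (TensorProduct.mk K A _ a).compMultilinearMap (wedgeMultilinear ε (dualGrading ℒ) n) := by
    refine Module.Basis.ext_multilinear (fun _ => b.dualBasis) fun J => ?_
    simp only [Module.Basis.coe_dualBasis]
    exact evalInv_eval_coord ε hb hc a J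
  exact congrArg (fun f => f θ) h

lemma evalInv_eval (hb : ∀ i, b i ∈ ℒ (g i))
    (hc : ∀ i, b.coord i ∈ dualGrading ℒ (-g i)) {p : ℕ × Γ} {x : LieForms (A := A) ε ℒ}
    (hx : x ∈ lieFormsGrading ε 𝒜 ℒ p) : evalInv ε ℒ b g p.1 (eval ε ℒ p.1 x) = x := by
  have : lieFormsGrading ε 𝒜 ℒ p ≤ LinearMap.eqLocus
      (evalInv ε ℒ b g p.1 ∘ₗ eval (A := A) ε ℒ p.1) LinearMap.id := by
    refine Submodule.span_le.mpr ?_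
    rintro _ ⟨i, d, a, θ, -, -, -, rfl⟩
    exact evalInv_eval_wedge ε hb hc a θ
  exact this hx

/-- The graded components of `A ⊗ Λ_ε(L*)` span it: exterior products of arbitrary linear forms are
combinations of those of a homogeneous dual basis. -/
lemma iSup_lieFormsGrading [DirectSum.Decomposition 𝒜] (hb : ∀ i, b i ∈ ℒ (g i))
    (hc : ∀ i, b.coord i ∈ dualGrading ℒ (-g i)) : ⨆ p, lieFormsGrading ε 𝒜 ℒ p = ⊤ := by
  rw [eq_top_iff]
  rintro x -
  have hwedge : ∀ i, ∀ a ∈ 𝒜 i, ∀ (n : ℕ) (θ : Fin n → Module.Dual K L),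
      a ⊗ₜ wedge ε _ θ ∈ ⨆ p, lieFormsGrading ε 𝒜 ℒ p := by
    intro i a ha n θ
    rw [← evalInv_eval_wedge ε hb hc a θ, evalInv_apply]
    refine Submodule.sum_mem _ fun I _ => Submodule.smul_mem _ _ (Submodule.mem_iSup_of_mem
      (n, i + ∑ m, -g (I m)) (Submodule.subset_span ?_))
    exact ⟨i, fun m => -g (I m), _, _, Submodule.smul_mem _ _ ha, fun m => hc _, rfl, rfl⟩
  induction x using TensorProduct.induction_on with
  | zero => exact Submodule.zero_mem _
  | add x y hx hy => exact Submodule.add_mem _ hx hy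
  | tmul a ξ =>
    have hξ : ξ ∈ Submodule.span K {ξ | ∃ (n : ℕ) (θ : Fin n → Module.Dual K L),
        ξ = wedge ε (dualGrading ℒ) θ} := by
      rw [span_wedge]
      trivial
    induction hξ using Submodule.span_induction with
    | mem ξ h =>
      obtain ⟨n, θ, rfl⟩ := h
      induction a using DirectSum.Decomposition.inductionOn 𝒜 with
      | zero => simp
      | add a a' ha ha' => rw [TensorProduct.add_tmul]; exact Submodule.add_mem _ ha ha'
      | homogeneous a => exact hwedge _ _ a.2 _ _
    | zero => simp
    | add ξ η _ _ hξ hη => rw [TensorProduct.tmul_add]; exact Submodule.add_mem _ hξ hη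
    | smul c ξ _ hξ => rw [TensorProduct.tmul_smul]; exact Submodule.smul_mem _ c hξ

end HomogeneousBasis

/-! ### Exterior forms as a model of the calculus -/

section LieFormsEquiv

variable {Γ K : Type*} [AddCommGroup Γ] [DecidableEq Γ] [Field K] (ε : CommutationFactor Γ K)
variable {A : Type*} [Ring A] [Algebra K A] (𝒜 : Γ → Submodule K A)
variable {L : Type*} [AddCommGroup L] [Module K L] (ℒ : Γ → Submodule K L)
  [DirectSum.Decomposition ℒ] [FiniteDimensional K L] [CharZero K]

/-- Evaluation identifies the forms of degree `(n, k)` with the alternating maps. -/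
theorem bijOn_eval (p : ℕ × Γ) : Set.BijOn (eval (A := A) ε ℒ p.1)
    (lieFormsGrading ε 𝒜 ℒ p) (altForms ε 𝒜 ℒ p.1 p.2) := by
  obtain ⟨_, b, g, hb, hc⟩ := exists_homogeneous_basis ℒ
  refine ⟨fun x hx => eval_mem_altForms ε 𝒜 ℒ hx, fun x hx y hy h => ?_, fun ω hω =>
    ⟨_, evalInv_mem ε 𝒜 hc hb hω, eval_evalInv ε 𝒜 hb hω⟩⟩
  rw [← evalInv_eval ε 𝒜 hb hc hx, ← evalInv_eval ε 𝒜 hb hc hy]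
  exact congrArg _ h

/-- The linear equivalence between forms of degree `p` and alternating maps. -/
def evalEquiv (p : ℕ × Γ) : lieFormsGrading (A := A) ε 𝒜 ℒ p ≃ₗ[K] formSpace ε 𝒜 ℒ p :=
  (LinearEquiv.ofBijective ((eval (A := A) ε ℒ p.1).restrict (p := lieFormsGrading ε 𝒜 ℒ p)
      (q := altForms ε 𝒜 ℒ p.1 p.2) fun _ h => eval_mem_altForms ε 𝒜 ℒ h)
    (bijOn_eval ε 𝒜 ℒ p).bijective).trans (altFormsEquiv ε 𝒜 ℒ p)

lemma evalEquiv_apply (p : ℕ × Γ) (x : lieFormsGrading (A := A) ε 𝒜 ℒ p) :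
    (evalEquiv ε 𝒜 ℒ p x : List (HomElt ℒ) → A) = toList K p.1 (eval ε ℒ p.1 x) := rfl

/-- The map from sums of forms, viewed as functions of lists, to `A ⊗ Λ_ε(L*)`. -/
def toLieForms : Calculus ε 𝒜 ℒ →ₗ[K] LieForms (A := A) ε ℒ :=
  DirectSum.toModule K (ℕ × Γ) _ fun p =>
    (lieFormsGrading ε 𝒜 ℒ p).subtype ∘ₗ (evalEquiv ε 𝒜 ℒ p).symm.toLinearMap

lemma toLieForms_of (p : ℕ × Γ) (f : formSpace ε 𝒜 ℒ p) :
    toLieForms ε 𝒜 ℒ (calculusOf ε 𝒜 ℒ p f) = (evalEquiv ε 𝒜 ℒ p).symm f := by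
  simp [toLieForms]

/-- The map to `A ⊗ Λ_ε(L*)` respects the values at homogeneous elements. -/
lemma toList_eval_toLieForms (n : ℕ) (x : Calculus ε 𝒜 ℒ) (Y : Fin n → HomElt ℒ) :
    eval ε ℒ n (toLieForms ε 𝒜 ℒ x) (fun i => (Y i).val) = realize ε 𝒜 ℒ x (List.ofFn Y) := by
  induction x using calculus_induction with
  | h0 => simp
  | hadd x y hx hy => simp only [map_add, _root_.add_apply, Pi.add_apply, hx, hy]
  | h p f =>
    rw [toLieForms_of, realize_of]
    obtain ⟨x, rfl⟩ := (evalEquiv ε 𝒜 ℒ p).surjective f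
    rw [LinearEquiv.symm_apply_apply, evalEquiv_apply]
    by_cases h : p.1 = n
    · subst h
      rw [toList_ofFn]
    · rw [toList_of_length_ne _ (by simpa using Ne.symm h), eval_of_mem_ne ε 𝒜 ℒ h x.2]
      rfl

/-- Both a sum of forms and its image are determined by the values, which agree by
`toList_eval_toLieForms`. -/
lemma toLieForms_bijective [GradedAlgebra 𝒜] : Function.Bijective (toLieForms ε 𝒜 ℒ) := by
  constructor
  · rw [injective_iff_map_eq_zero]
    intro x hx
    refine realize_injective ε 𝒜 ℒ ?_
    funext t
    obtain ⟨n, Y, rfl⟩ : ∃ (n : ℕ) (Y : Fin n → HomElt ℒ), t = List.ofFn Y :=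
      ⟨_, exists_ofFn_eq t rfl⟩
    rw [← toList_eval_toLieForms, hx]
    simp
  · obtain ⟨_, b, g, hb, hc⟩ := exists_homogeneous_basis ℒ
    rw [← LinearMap.range_eq_top, eq_top_iff, ← iSup_lieFormsGrading ε 𝒜 hb hc]
    refine iSup_le fun p x hx => ⟨calculusOf ε 𝒜 ℒ p (evalEquiv ε 𝒜 ℒ p ⟨x, hx⟩), ?_⟩
    rw [toLieForms_of, LinearEquiv.symm_apply_apply]

/-- The space of sums of forms, viewed as functions of lists, is `A ⊗ Λ_ε(L*)`. -/
def lieFormsEquiv [GradedAlgebra 𝒜] : Calculus ε 𝒜 ℒ ≃ₗ[K] LieForms (A := A) ε ℒ :=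
  LinearEquiv.ofBijective (toLieForms ε 𝒜 ℒ) (toLieForms_bijective ε 𝒜 ℒ)

variable [GradedAlgebra 𝒜]

lemma lieFormsEquiv_of (p : ℕ × Γ) (f : formSpace ε 𝒜 ℒ p) :
    lieFormsEquiv ε 𝒜 ℒ (calculusOf ε 𝒜 ℒ p f) = (evalEquiv ε 𝒜 ℒ p).symm f :=
  toLieForms_of ε 𝒜 ℒ p f

lemma map_lieFormsEquiv (p : ℕ × Γ) : (calculusGrading ε 𝒜 ℒ p).map
    (lieFormsEquiv ε 𝒜 ℒ : Calculus ε 𝒜 ℒ →ₗ[K] LieForms (A := A) ε ℒ) =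
      lieFormsGrading ε 𝒜 ℒ p := by
  ext x
  constructor
  · rintro ⟨_, ⟨f, rfl⟩, rfl⟩
    rw [LinearEquiv.coe_coe, lieFormsEquiv_of]
    exact Subtype.property _
  · intro hx
    refine ⟨_, ⟨evalEquiv ε 𝒜 ℒ p ⟨x, hx⟩, rfl⟩, ?_⟩
    rw [LinearEquiv.coe_coe, lieFormsEquiv_of, LinearEquiv.symm_apply_apply]

lemma lieFormsEquiv_symm {p : ℕ × Γ} {x : LieForms (A := A) ε ℒ}
    (hx : x ∈ lieFormsGrading ε 𝒜 ℒ p) : (lieFormsEquiv ε 𝒜 ℒ).symm x =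
      calculusOf ε 𝒜 ℒ p (evalEquiv ε 𝒜 ℒ p ⟨x, hx⟩) := by
  rw [LinearEquiv.symm_apply_eq, lieFormsEquiv_of, LinearEquiv.symm_apply_apply]

lemma eval_lieFormsEquiv (n : ℕ) (x : Calculus ε 𝒜 ℒ) (Y : Fin n → HomElt ℒ) :
    eval ε ℒ n (lieFormsEquiv ε 𝒜 ℒ x) (fun i => (Y i).val) = realize ε 𝒜 ℒ x (List.ofFn Y) :=
  toList_eval_toLieForms ε 𝒜 ℒ n x Y

lemma lieFormsEquiv_one : lieFormsEquiv ε 𝒜 ℒ (calculusOne ε 𝒜 ℒ) = 1 ⊗ₜ[K] 1 := by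
  have h1 : (1 : A) ⊗ₜ[K] (1 : EpsExterior ε (dualGrading ℒ)) =
      1 ⊗ₜ wedge ε _ (fun i : Fin 0 => i.elim0) := by
    rw [wedge, TensorAlgebra.tprod_apply]
    rfl
  have h : (1 : A) ⊗ₜ[K] (1 : EpsExterior ε (dualGrading ℒ)) ∈ lieFormsGrading ε 𝒜 ℒ (0, 0) := by
    rw [h1]
    exact Submodule.subset_span ⟨0, fun i => i.elim0, 1, fun i => i.elim0,
      SetLike.GradedOne.one_mem, fun i => i.elim0, by simp, rfl⟩
  rw [← LinearEquiv.eq_symm_apply, lieFormsEquiv_symm ε 𝒜 ℒ h, calculusOne]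
  congr 1
  refine Subtype.ext ?_
  rw [evalEquiv_apply]
  funext t
  cases t with
  | nil =>
    change (1 : A) = eval ε ℒ 0 (1 ⊗ₜ 1) _
    rw [h1, eval_wedge ε ℒ 0 1 _ (fun i => i.elim0) _ fun i => i.elim0]
    simp [evalFactor]
  | cons X t =>
    exact (toList_of_length_ne (n := 0) (eval ε ℒ 0 (1 ⊗ₜ 1)) (t := X :: t) (by simp)).symm

variable {ε ℒ} {br : L →ₗ[K] L →ₗ[K] L} (hL : IsEpsLieAlgebra ε ℒ br) {ρ : L →ₗ[K] A →ₗ[K] A}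
variable (hρ : IsDerAction ε Sigma.fst (homBracket hL) (homAction ρ) 𝒜)

lemma eval_transportMul {p q : ℕ × Γ} {x y : LieForms (A := A) ε ℒ}
    (hx : x ∈ lieFormsGrading ε 𝒜 ℒ p) (hy : y ∈ lieFormsGrading ε 𝒜 ℒ q) {n : ℕ}
    (Y : Fin n → HomElt ℒ) :
    eval ε ℒ n (transportMul (lieFormsEquiv ε 𝒜 ℒ) (calculusMul ε 𝒜 ℒ) x y)
        (fun i => (Y i).val) =
      formMul ε Sigma.fst q.2 (toList K p.1 (eval ε ℒ p.1 x)) (toList K q.1 (eval ε ℒ q.1 y))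
        (List.ofFn Y) := by
  rw [transportMul_apply, eval_lieFormsEquiv, lieFormsEquiv_symm ε 𝒜 ℒ hx,
    lieFormsEquiv_symm ε 𝒜 ℒ hy, realize_mul_of, realize_of, evalEquiv_apply, evalEquiv_apply]

lemma eval_conj_calculusDif {p : ℕ × Γ} {x : LieForms (A := A) ε ℒ}
    (hx : x ∈ lieFormsGrading ε 𝒜 ℒ p) {n : ℕ} (Y : Fin n → HomElt ℒ) :
    eval ε ℒ n ((lieFormsEquiv ε 𝒜 ℒ).conj (calculusDif 𝒜 hL hρ) x) (fun i => (Y i).val) =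
      dif ε Sigma.fst (homBracket hL) (homAction ρ) p.2 (toList K p.1 (eval ε ℒ p.1 x))
        (List.ofFn Y) := by
  rw [LinearEquiv.conj_apply_apply, eval_lieFormsEquiv, lieFormsEquiv_symm ε 𝒜 ℒ hx,
    realize_dif_of, evalEquiv_apply]

lemma isGradedDiffAlgebraIso_lieFormsEquiv :
    IsGradedDiffAlgebraIso (calculusGrading ε 𝒜 ℒ) (calculusMul ε 𝒜 ℒ) (calculusOne ε 𝒜 ℒ)
      (calculusDif 𝒜 hL hρ) (lieFormsGrading ε 𝒜 ℒ)
      (transportMul (lieFormsEquiv ε 𝒜 ℒ) (calculusMul ε 𝒜 ℒ)) (1 ⊗ₜ[K] 1)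
      ((lieFormsEquiv ε 𝒜 ℒ).conj (calculusDif 𝒜 hL hρ)) (lieFormsEquiv ε 𝒜 ℒ) :=
  isGradedDiffAlgebraIso_transport (lieFormsEquiv ε 𝒜 ℒ)
    (map_lieFormsEquiv ε 𝒜 ℒ) (lieFormsEquiv_one ε 𝒜 ℒ)

lemma lieForms_isGradedDiffAlgebra :
    IsGradedDiffAlgebra ε (lieFormsGrading ε 𝒜 ℒ)
      (transportMul (lieFormsEquiv ε 𝒜 ℒ) (calculusMul ε 𝒜 ℒ)) (1 ⊗ₜ[K] 1)
      ((lieFormsEquiv ε 𝒜 ℒ).conj (calculusDif 𝒜 hL hρ)) :=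
  (calculus_isGradedDiffAlgebra 𝒜 hL hρ).of_iso (isGradedDiffAlgebraIso_lieFormsEquiv 𝒜 hL hρ)

/-- The product and the differential carried over to `A ⊗ Λ_ε(L*)` are given by the explicit
formulas. -/
theorem isLieFormsStructure_transport : IsLieFormsStructure ε 𝒜 ℒ (fun X Y => br X Y)
    (fun X a => ρ X a) (transportMul (lieFormsEquiv ε 𝒜 ℒ) (calculusMul ε 𝒜 ℒ))
    ((lieFormsEquiv ε 𝒜 ℒ).conj (calculusDif 𝒜 hL hρ)) where
  mul_mem := (lieForms_isGradedDiffAlgebra 𝒜 hL hρ).mul_mem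
  eval_mul p q ω hω η hη e X hX := by
    have hf := toList_mem (eval_mem_altForms ε 𝒜 ℒ hω)
    have hg := toList_mem (eval_mem_altForms ε 𝒜 ℒ hη)
    refine (eval_transportMul 𝒜 hω hη fun i => ⟨e i, X i, hX i⟩).trans ?_
    exact (mulValue_eq_formMul (val := HomElt.val) hf.2.2.1 hg.2.2.1 hf.1 hg.1 q.2 _ _
      (fun Z => toList_ofFn _ Z) (fun Z => toList_ofFn _ Z) fun i => ⟨e i, X i, hX i⟩).symm
  d_mem := (lieForms_isGradedDiffAlgebra 𝒜 hL hρ).d_mem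
  eval_d p ω hω e X hX := by
    have hf := toList_mem (eval_mem_altForms ε 𝒜 ℒ hω)
    refine (eval_conj_calculusDif 𝒜 hL hρ hω fun i => ⟨e i, X i, hX i⟩).trans ?_
    exact (diffValue_eq_dif (val := HomElt.val) (br := fun X Y => br X Y)
      (ρ' := fun X a => ρ X a) hρ.deg_brk (homBracket_val hL) (fun _ _ => rfl)
      hf.2.2.1 p.2 _ (fun Z => toList_ofFn _ Z) fun i => ⟨e i, X i, hX i⟩).symm

end LieFormsEquiv
end EpsGraded

namespace EpsGraded

/-! ### Inner `ε`-derivations -/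

section Inner

variable {Γ K : Type*} [AddCommGroup Γ] [DecidableEq Γ] [Field K] (ε : CommutationFactor Γ K)
variable {A : Type*} [Ring A] [Algebra K A] (𝒜 : Γ → Submodule K A) [GradedAlgebra 𝒜]

lemma epsBracket_apply {i j : Γ} {a b : A} (ha : a ∈ 𝒜 i) (hb : b ∈ 𝒜 j) :
    epsBracket ε 𝒜 a b = a * b - (ε i j : K) • (b * a) := by
  rw [epsBracket, epsComm_apply ε 𝒜 _ ha hb]
  rfl

lemma epsBracket_mem {i j : Γ} {a b : A} (ha : a ∈ 𝒜 i) (hb : b ∈ 𝒜 j) :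
    epsBracket ε 𝒜 a b ∈ 𝒜 (i + j) := by
  rw [epsBracket_apply ε 𝒜 ha hb]
  refine Submodule.sub_mem _ (SetLike.GradedMul.mul_mem ha hb) (Submodule.smul_mem _ _ ?_)
  rw [add_comm]
  exact SetLike.GradedMul.mul_mem hb ha

/-- The bracket with a homogeneous element is an `ε`-derivation. -/
lemma epsBracket_mul {i j : Γ} {a b : A} (ha : a ∈ 𝒜 i) (hb : b ∈ 𝒜 j) (c : A) :
    epsBracket ε 𝒜 a (b * c) =
      epsBracket ε 𝒜 a b * c + (ε i j : K) • (b * epsBracket ε 𝒜 a c) := by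
  induction c using DirectSum.Decomposition.inductionOn 𝒜 with
  | zero => simp
  | add c c' hc hc' => simp only [mul_add, map_add, hc, hc', smul_add]; abel
  | @homogeneous k c =>
    rw [epsBracket_apply ε 𝒜 ha (SetLike.GradedMul.mul_mem hb c.2), epsBracket_apply ε 𝒜 ha hb,
      epsBracket_apply ε 𝒜 ha c.2, factor_add_right]
    simp only [sub_mul, mul_sub, smul_sub, smul_mul_assoc, mul_smul_comm, smul_smul, mul_assoc]
    abel

lemma epsBracket_skew {i j : Γ} {a b : A} (ha : a ∈ 𝒜 i) (hb : b ∈ 𝒜 j) :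
    epsBracket ε 𝒜 a b = -((ε i j : K) • epsBracket ε 𝒜 b a) := by
  rw [epsBracket_apply ε 𝒜 ha hb, epsBracket_apply ε 𝒜 hb ha, smul_sub, smul_smul,
    factor_mul_swap, one_smul, neg_sub]

/-- The Jacobi identity, the third element being arbitrary. -/
lemma epsBracket_bracket {i j : Γ} {a b : A} (ha : a ∈ 𝒜 i) (hb : b ∈ 𝒜 j) (c : A) :
    epsBracket ε 𝒜 (epsBracket ε 𝒜 a b) c = epsBracket ε 𝒜 a (epsBracket ε 𝒜 b c) -
      (ε i j : K) • epsBracket ε 𝒜 b (epsBracket ε 𝒜 a c) := by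
  induction c using DirectSum.Decomposition.inductionOn 𝒜 with
  | zero => simp
  | add c c' hc hc' => simp only [map_add, hc, hc', smul_add]; abel
  | @homogeneous k c =>
    rw [epsBracket_apply ε 𝒜 (epsBracket_mem ε 𝒜 ha hb) c.2,
      epsBracket_apply ε 𝒜 ha (epsBracket_mem ε 𝒜 hb c.2),
      epsBracket_apply ε 𝒜 hb (epsBracket_mem ε 𝒜 ha c.2), epsBracket_apply ε 𝒜 ha hb,
      epsBracket_apply ε 𝒜 ha c.2, epsBracket_apply ε 𝒜 hb c.2, factor_add_right,
      factor_add_left, factor_add_right]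
    simp only [sub_mul, mul_sub, smul_sub, smul_mul_assoc, mul_smul_comm, smul_smul, mul_assoc]
    have h := factor_mul_swap ε i j
    linear_combination (norm := module) (-(ε j k : K) * h) • (a * (c * b) : A) +
      ((ε i k : K) * (ε j k : K) * h) • (c * (a * b) : A)

lemma epsBracket_mem_homDer {i : Γ} {a : A} (ha : a ∈ 𝒜 i) :
    epsBracket ε 𝒜 a ∈ homDer ε 𝒜 i :=
  ⟨fun _ _ hb => epsBracket_mem ε 𝒜 ha hb, fun _ _ hb c => epsBracket_mul ε 𝒜 ha hb c⟩

lemma epsBracket_mem_epsDer (a : A) : epsBracket ε 𝒜 a ∈ epsDer ε 𝒜 := by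
  induction a using DirectSum.Decomposition.inductionOn 𝒜 with
  | zero => rw [map_zero]; exact Submodule.zero_mem _
  | add a b ha hb => rw [map_add]; exact Submodule.add_mem _ ha hb
  | @homogeneous i a => exact le_iSup (homDer ε 𝒜) i (epsBracket_mem_homDer ε 𝒜 a.2)

lemma epsBracket_one_left (b : A) : epsBracket ε 𝒜 1 b = 0 := by
  induction b using DirectSum.Decomposition.inductionOn 𝒜 with
  | zero => simp
  | add a b ha hb => rw [map_add, ha, hb, add_zero]
  | @homogeneous i b =>
    rw [epsBracket_apply ε 𝒜 SetLike.GradedOne.one_mem b.2, factor_zero_left, Units.val_one,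
      one_smul, one_mul, mul_one, sub_self]

/-- A homogeneous map between graded spaces which is bijective on each component is bijective. -/
lemma bijective_of_homogeneous {L L' : Type*} [AddCommGroup L] [Module K L] [AddCommGroup L']
    [Module K L'] (ℒ : Γ → Submodule K L) [DirectSum.Decomposition ℒ] (ℒ' : Γ → Submodule K L')
    [DirectSum.Decomposition ℒ'] (F : L →ₗ[K] L') (hF : ∀ i, ∀ x ∈ ℒ i, F x ∈ ℒ' i)
    (hinj : ∀ i, ∀ x ∈ ℒ i, F x = 0 → x = 0) (hsurj : ∀ i, ∀ y ∈ ℒ' i, ∃ x ∈ ℒ i, F x = y) :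
    Function.Bijective F := by
  classical
  constructor
  · rw [injective_iff_map_eq_zero]
    intro x hx
    have hdec : ∀ i, (DirectSum.decompose ℒ' (F x) i : L') = F (DirectSum.decompose ℒ x i) := by
      intro i
      clear hx
      induction x using DirectSum.Decomposition.inductionOn ℒ with
      | zero => simp
      | add x y hx hy => simp [hx, hy]
      | @homogeneous j x =>
        by_cases h : j = i
        · subst h
          rw [DirectSum.decompose_of_mem_same ℒ' (hF _ _ x.2),
            DirectSum.decompose_of_mem_same ℒ x.2]
        · rw [DirectSum.decompose_of_mem_ne ℒ' (hF _ _ x.2) h,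
            DirectSum.decompose_of_mem_ne ℒ x.2 h, map_zero]
    rw [← DirectSum.sum_support_decompose ℒ x]
    refine Finset.sum_eq_zero fun i _ => hinj i _ (Subtype.property _) ?_
    rw [← hdec, hx]
    simp
  · intro y
    induction y using DirectSum.Decomposition.inductionOn ℒ' with
    | zero => exact ⟨0, map_zero F⟩
    | add y y' hy hy' =>
      obtain ⟨x, rfl⟩ := hy
      obtain ⟨x', rfl⟩ := hy'
      exact ⟨x + x', map_add F x x'⟩
    | homogeneous y =>
      obtain ⟨x, -, hx⟩ := hsurj _ _ y.2
      exact ⟨x, hx⟩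

/-- An isomorphism of `ε`-Lie algebras carries the axioms over. -/
lemma IsEpsLieAlgebra.of_iso {L L' : Type*} [AddCommGroup L] [Module K L] [AddCommGroup L']
    [Module K L'] {ℒ : Γ → Submodule K L} {ℒ' : Γ → Submodule K L'} {br : L →ₗ[K] L →ₗ[K] L}
    {br' : L' →ₗ[K] L' →ₗ[K] L'} (h : IsEpsLieAlgebra ε ℒ br) {f : L ≃ₗ[K] L'}
    (hf : IsEpsLieIso ℒ ℒ' br br' f) : IsEpsLieAlgebra ε ℒ' br' where
  mem i j := by
    simp only [← hf.map_grading]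
    rintro _ ⟨a, ha, rfl⟩ _ ⟨b, hb, rfl⟩
    exact ⟨_, h.mem i j a ha b hb, hf.map_bracket a b⟩
  skew i j := by
    simp only [← hf.map_grading]
    rintro _ ⟨a, ha, rfl⟩ _ ⟨b, hb, rfl⟩
    have := congrArg f (h.skew i j a ha b hb)
    rwa [map_neg, map_smul, hf.map_bracket, hf.map_bracket] at this
  jacobi i j k := by
    simp only [← hf.map_grading]
    rintro _ ⟨a, ha, rfl⟩ _ ⟨b, hb, rfl⟩ _ ⟨c, hc, rfl⟩
    have := congrArg f (h.jacobi i j k a ha b hb c hc)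
    simpa only [LinearEquiv.coe_coe, map_add, map_smul, hf.map_bracket] using this

end Inner

/-! ### The `ε`-derivations of a matrix algebra -/

section MatrixDerivations

variable {Γ : Type*} [AddCommGroup Γ] [DecidableEq Γ] (ε : CommutationFactor Γ ℂ) {D : ℕ}
  (𝒜 : Γ → Submodule ℂ (Matrix (Fin D) (Fin D) ℂ)) (φ : Fin D → Γ) [GradedAlgebra 𝒜]
  [IsElementaryGrading 𝒜 φ]

lemma mul_single_one {n : ℕ} (b : Matrix (Fin n) (Fin n) ℂ) (j o : Fin n) :
    b * Matrix.single j o 1 = ∑ i, b i j • Matrix.single i o (1 : ℂ) := by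
  ext k l
  simp [Matrix.mul_apply, Matrix.sum_apply, Matrix.single_apply, ite_and]

lemma single_one_mul {n : ℕ} (b : Matrix (Fin n) (Fin n) ℂ) (o i : Fin n) :
    Matrix.single o i 1 * b = ∑ j, b i j • Matrix.single o j (1 : ℂ) := by
  ext k l
  simp [Matrix.mul_apply, Matrix.sum_apply, Matrix.single_apply, ite_and]

lemma sum_single_one {n : ℕ} : ∑ j : Fin n, Matrix.single j j (1 : ℂ) = 1 := by
  ext k l
  simp [Matrix.sum_apply, Matrix.single_apply, Matrix.one_apply, ite_and, eq_comm]

/-- A homogeneous `ε`-derivation `X` of a matrix algebra is inner: it is the bracket with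
`∑ i, X (E_io) * E_oi`, for any fixed index `o`. -/
lemma exists_eq_epsBracket (φ : Fin D → Γ) [IsElementaryGrading 𝒜 φ] (o : Fin D) {α : Γ}
    {X : Module.End ℂ (Matrix (Fin D) (Fin D) ℂ)}
    (hX : X ∈ homDer ε 𝒜 α) : ∃ a ∈ 𝒜 α, X = epsBracket ε 𝒜 a := by
  have hE := IsElementaryGrading.single_mem (𝒜 := 𝒜) (φ := φ)
  have ha : ∑ i, X (Matrix.single i o 1) * Matrix.single o i 1 ∈ 𝒜 α := by
    refine Submodule.sum_mem _ fun i _ => ?_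
    have := SetLike.GradedMul.mul_mem (hX.1 _ _ (hE i o)) (hE o i)
    rwa [add_assoc, sub_add_sub_cancel, sub_self, add_zero] at this
  refine ⟨_, ha, LinearMap.ext fun b => ?_⟩
  induction b using DirectSum.Decomposition.inductionOn 𝒜 with
  | zero => simp
  | add b b' hb hb' => rw [map_add, map_add, hb, hb']
  | @homogeneous β b =>
    -- both sides of this equation are `∑ i j, b i j • X (E_io) * E_oj`
    have h1 : (∑ i, X (Matrix.single i o 1) * Matrix.single o i 1) *
        (b : Matrix (Fin D) (Fin D) ℂ) =
          ∑ j, X ((b : Matrix (Fin D) (Fin D) ℂ) * Matrix.single j o 1) * Matrix.single o j 1 := by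
      have h3 : ∀ i, X (Matrix.single i o 1) * Matrix.single o i 1 *
          (b : Matrix (Fin D) (Fin D) ℂ) = ∑ j, (b : Matrix (Fin D) (Fin D) ℂ) i j •
            (X (Matrix.single i o 1) * Matrix.single o j 1) := by
        intro i
        rw [mul_assoc, single_one_mul, Finset.mul_sum]
        simp only [mul_smul_comm]
      have h4 : ∀ j, X ((b : Matrix (Fin D) (Fin D) ℂ) * Matrix.single j o 1) *
          Matrix.single o j 1 = ∑ i, (b : Matrix (Fin D) (Fin D) ℂ) i j •
            (X (Matrix.single i o 1) * Matrix.single o j 1) := by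
        intro j
        rw [mul_single_one (b : Matrix (Fin D) (Fin D) ℂ) j o, map_sum, Finset.sum_mul]
        simp only [map_smul, smul_mul_assoc]
      simp only [Finset.sum_mul, h3, h4]
      exact Finset.sum_comm
    have h2 : ∀ j, X ((b : Matrix _ _ ℂ) * Matrix.single j o 1) * Matrix.single o j 1 =
        X b * Matrix.single j j 1 + (ε α β : ℂ) •
          ((b : Matrix _ _ ℂ) * (X (Matrix.single j o 1) * Matrix.single o j 1)) := by
      intro j
      rw [hX.2 β b b.2, add_mul, mul_assoc, Matrix.single_mul_single_same, mul_one, smul_mul_assoc,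
        mul_assoc]
    rw [epsBracket_apply ε 𝒜 ha b.2, h1]
    simp only [h2, Finset.sum_add_distrib, ← Finset.smul_sum, ← Finset.mul_sum, sum_single_one,
      mul_one, add_sub_cancel_right]

/-- The homogeneous elements of the `ε`-center of a matrix algebra are scalars. -/
lemma eq_smul_one_of_epsBracket_eq_zero (φ : Fin D → Γ) [IsElementaryGrading 𝒜 φ] {γ : Γ}
    {a : Matrix (Fin D) (Fin D) ℂ} (ha : a ∈ 𝒜 γ)
    (h : epsBracket ε 𝒜 a = 0) : ∃ c : ℂ, a = c • 1 := by
  have hE := IsElementaryGrading.single_mem (𝒜 := 𝒜) (φ := φ)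
  have h0 : ∀ i j, a * Matrix.single i j 1 = (ε γ (φ i - φ j) : ℂ) • (Matrix.single i j 1 * a) := by
    intro i j
    rw [← sub_eq_zero, ← epsBracket_apply ε 𝒜 ha (hE i j), h]
    rfl
  by_cases hγ : γ = 0
  · subst hγ
    have h1 : ∀ i j, i ≠ j → Commute (Matrix.single i j 1) a := by
      intro i j _
      have := h0 i j
      rw [factor_zero_left, Units.val_one, one_smul] at this
      exact this.symm
    obtain ⟨c, hc⟩ := Matrix.mem_range_scalar_of_commute_single h1
    exact ⟨c, by rw [← hc, Matrix.smul_one_eq_diagonal]; rfl⟩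
  · -- an element of nonzero degree has no diagonal entries, and commutes with the `E_jj`
    refine ⟨0, ?_⟩
    ext i j
    rw [zero_smul, Matrix.zero_apply]
    by_cases hij : i = j
    · subst hij
      by_contra h1
      exact hγ ((degree_of_apply_ne_zero 𝒜 φ ha h1).symm.trans (sub_self _))
    · have h1 := congrFun (congrFun (h0 j j) i) j
      rw [sub_self, factor_zero_right, Units.val_one, one_smul] at h1
      simpa [Matrix.mul_apply, Matrix.single_apply, hij, Ne.symm hij, eq_comm] using h1

/-- The adjoint representation of `sl_ε(D)`. -/
def adjoint : slEps ε φ →ₗ[ℂ] epsDer ε 𝒜 :=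
  LinearMap.codRestrict (epsDer ε 𝒜) (epsBracket ε 𝒜 ∘ₗ (slEps ε φ).subtype)
    fun a => epsBracket_mem_epsDer ε 𝒜 a

lemma coe_adjoint (a : slEps ε φ) :
    (adjoint ε 𝒜 φ a : Module.End ℂ (Matrix (Fin D) (Fin D) ℂ)) = epsBracket ε 𝒜 a := rfl

variable {φ}

lemma adjoint_mem {i : Γ} {a : slEps ε φ} (ha : a ∈ slGrading ε 𝒜 φ i) :
    adjoint ε 𝒜 φ a ∈ derGrading ε 𝒜 i :=
  epsBracket_mem_homDer ε 𝒜 ha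

variable {ε}

lemma nonempty_of_epsTrace_ne_zero {φ : Fin D → Γ} (htr : epsTrace ε φ 1 ≠ 0) :
    Nonempty (Fin D) := by
  by_contra h
  rw [not_nonempty_iff] at h
  exact htr (by rw [Subsingleton.elim (1 : Matrix (Fin D) (Fin D) ℂ) 0, map_zero])

/-- A homogeneous `ε`-derivation is the bracket with an element of `sl_ε(D)`: the trace of the
element of the matrix algebra by which it is represented is removed by subtracting a scalar. -/
lemma exists_adjoint_eq (htr : epsTrace ε φ 1 ≠ 0) {i : Γ} {X : epsDer ε 𝒜}
    (hX : X ∈ derGrading ε 𝒜 i) : ∃ a ∈ slGrading ε 𝒜 φ i, adjoint ε 𝒜 φ a = X := by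
  obtain ⟨o⟩ := nonempty_of_epsTrace_ne_zero htr
  obtain ⟨a, ha, h⟩ := exists_eq_epsBracket ε 𝒜 φ o (show X.1 ∈ homDer ε 𝒜 i from hX)
  -- the scalar matrices are central, and not contained in `sl_ε(D)`
  set c : ℂ := epsTrace ε φ a / epsTrace ε φ 1 with hc
  have hmem : a - c • 1 ∈ 𝒜 i := by
    by_cases hi : i = 0
    · subst hi
      exact Submodule.sub_mem _ ha (Submodule.smul_mem _ _ SetLike.GradedOne.one_mem)
    · rw [hc, epsTrace_eq_zero ε 𝒜 φ hi ha, zero_div, zero_smul, sub_zero]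
      exact ha
  have hsl : a - c • 1 ∈ slEps ε φ := by
    rw [slEps, LinearMap.mem_ker, map_sub, map_smul, hc, smul_eq_mul, div_mul_cancel₀ _ htr,
      sub_self]
  refine ⟨⟨_, hsl⟩, hmem, Subtype.ext ?_⟩
  rw [coe_adjoint, h, map_sub, map_smul,
    show epsBracket ε 𝒜 1 = 0 from LinearMap.ext (epsBracket_one_left ε 𝒜), smul_zero, sub_zero]

lemma adjoint_bijective (htr : epsTrace ε φ 1 ≠ 0) : Function.Bijective (adjoint ε 𝒜 φ) := by
  refine bijective_of_homogeneous (L := slEps ε φ) (L' := epsDer ε 𝒜) (slGrading ε 𝒜 φ)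
    (derGrading ε 𝒜) (adjoint ε 𝒜 φ) (fun i a ha => adjoint_mem ε 𝒜 ha) (fun i a ha h => ?_)
    fun i X hX => exists_adjoint_eq 𝒜 htr hX
  obtain ⟨c, hc⟩ := eq_smul_one_of_epsBracket_eq_zero ε 𝒜 φ ha (congrArg Subtype.val h)
  have h1 : epsTrace ε φ (c • 1) = 0 := by
    rw [← hc]
    exact a.2
  rw [map_smul, smul_eq_mul] at h1
  refine Subtype.ext ?_
  change (a : Matrix (Fin D) (Fin D) ℂ) = 0
  rw [show (a : Matrix (Fin D) (Fin D) ℂ) = c • 1 from hc, (mul_eq_zero.mp h1).resolve_right htr,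
    zero_smul]

variable (htr : epsTrace ε φ 1 ≠ 0)

/-- The adjoint representation as an isomorphism. -/
def adjointEquiv : slEps ε φ ≃ₗ[ℂ] epsDer ε 𝒜 :=
  LinearEquiv.ofBijective (adjoint ε 𝒜 φ) (adjoint_bijective 𝒜 htr)

lemma adjointEquiv_apply (a : slEps ε φ) (b : Matrix (Fin D) (Fin D) ℂ) :
    (adjointEquiv 𝒜 htr a : Module.End ℂ (Matrix (Fin D) (Fin D) ℂ)) b =
      epsBracket ε 𝒜 a b := rfl

lemma map_adjointEquiv (i : Γ) : (slGrading ε 𝒜 φ i).map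
    (adjointEquiv 𝒜 htr : slEps ε φ →ₗ[ℂ] epsDer ε 𝒜) = derGrading ε 𝒜 i := by
  refine le_antisymm (Submodule.map_le_iff_le_comap.mpr fun a ha => adjoint_mem ε 𝒜 ha)
    fun X hX => ?_
  obtain ⟨a, ha, rfl⟩ := exists_adjoint_eq 𝒜 htr hX
  exact ⟨a, ha, rfl⟩

variable (ε φ)

lemma slEps_isEpsLieAlgebra : IsEpsLieAlgebra (L := slEps ε φ) ε (slGrading ε 𝒜 φ)
    (slBracket ε 𝒜 φ) where
  mem i j a ha b hb := epsBracket_mem ε 𝒜 ha hb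
  skew i j a ha b hb := Subtype.ext (epsBracket_skew ε 𝒜 ha hb)
  jacobi i j k a ha b hb c hc := Subtype.ext (by
    change epsBracket ε 𝒜 a (epsBracket ε 𝒜 b c) = epsBracket ε 𝒜 (epsBracket ε 𝒜 a b) c +
      (ε i j : ℂ) • epsBracket ε 𝒜 b (epsBracket ε 𝒜 a c)
    have h := epsBracket_bracket ε 𝒜 (a := (a : Matrix (Fin D) (Fin D) ℂ))
      (b := (b : Matrix (Fin D) (Fin D) ℂ)) ha hb c
    exact sub_eq_iff_eq_add.mp h.symm)

/-- The action of `sl_ε(D)` on the matrix algebra by brackets. -/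
def slAction : slEps ε φ →ₗ[ℂ] Matrix (Fin D) (Fin D) ℂ →ₗ[ℂ] Matrix (Fin D) (Fin D) ℂ :=
  epsBracket ε 𝒜 ∘ₗ (slEps ε φ).subtype

lemma slAction_isDerAction : IsDerAction ε Sigma.fst (homBracket (slEps_isEpsLieAlgebra ε 𝒜 φ))
    (homAction (slAction ε 𝒜 φ)) 𝒜 where
  deg_brk _ _ := rfl
  mem X _ _ ha := epsBracket_mem ε 𝒜 X.2.2 ha
  leibniz X _ _ ha b := epsBracket_mul ε 𝒜 X.2.2 ha b
  bracket X Y a := epsBracket_bracket ε 𝒜 X.2.2 Y.2.2 a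

variable {ε φ}

lemma adjointEquiv_isEpsLieIso : IsEpsLieIso (L := slEps ε φ) (L' := epsDer ε 𝒜)
    (slGrading ε 𝒜 φ) (derGrading ε 𝒜) (slBracket ε 𝒜 φ) (derBracket ε 𝒜)
    (adjointEquiv 𝒜 htr) where
  map_grading := map_adjointEquiv 𝒜 htr
  map_bracket a b := by
    induction a using DirectSum.Decomposition.inductionOn (slGrading ε 𝒜 φ) with
    | zero => simp only [map_zero, LinearMap.zero_apply]
    | add a a' ha ha' => simp only [map_add, LinearMap.add_apply, ha, ha']
    | @homogeneous i a =>
      induction b using DirectSum.Decomposition.inductionOn (slGrading ε 𝒜 φ) with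
      | zero => simp only [map_zero]
      | add b b' hb hb' => simp only [map_add, hb, hb']
      | @homogeneous j b =>
        refine Subtype.ext ?_
        change epsBracket ε 𝒜 (epsBracket ε 𝒜 a.1 b.1) =
          epsComm ε (derGrading ε 𝒜) (derComp ε 𝒜) (adjoint ε 𝒜 φ a.1) (adjoint ε 𝒜 φ b.1)
        rw [epsComm_apply ε _ _ (adjoint_mem ε 𝒜 a.2) (adjoint_mem ε 𝒜 b.2)]
        exact LinearMap.ext fun c => epsBracket_bracket ε 𝒜 a.2 b.2 c

/-- Since the `ε`-center consists of the scalars, linearity over it holds automatically. -/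
lemma mem_derForms (φ : Fin D → Γ) [IsElementaryGrading 𝒜 φ] (o : Fin D) {p : ℕ × Γ}
    {ω : MultilinearMap ℂ (fun _ : Fin p.1 => epsDer ε 𝒜) (Matrix (Fin D) (Fin D) ℂ)} :
    ω ∈ derForms ε 𝒜 p ↔ ω ∈ altForms (L := epsDer ε 𝒜) ε 𝒜 (derGrading ε 𝒜) p.1 p.2 := by
  refine ⟨And.left, fun h => ⟨h, fun d X _ i _ j z hz hz' Y hY => ?_⟩⟩
  obtain ⟨c, rfl⟩ := eq_smul_one_of_epsBracket_eq_zero ε 𝒜 φ hz hz'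
  -- a nonzero scalar matrix has degree zero
  have hε : (ε (d i) j : ℂ) * c = c := by
    by_cases h0 : (c • 1 : Matrix (Fin D) (Fin D) ℂ) = 0
    · have hi := congrFun (congrFun h0 o) o
      simp only [Matrix.smul_apply, Matrix.one_apply_eq, smul_eq_mul, mul_one,
        Matrix.zero_apply] at hi
      rw [hi, mul_zero]
    · have hj := DirectSum.degree_eq_of_mem_mem 𝒜 hz
        (Submodule.smul_mem _ c SetLike.GradedOne.one_mem) h0
      rw [hj, factor_zero_right, Units.val_one, one_mul]
  have hY' : Y = c • X i := by
    refine Subtype.ext (LinearMap.ext fun a => ?_)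
    rw [hY, smul_mul_assoc, one_mul, smul_smul, hε]
    rfl
  rw [hY', ω.map_update_smul, Function.update_eq_self, mul_smul_comm, mul_one]

end MatrixDerivations
end EpsGraded

namespace EpsGraded

/-! ### The push-forward of forms along the adjoint representation -/

section Pushforward

variable {Γ : Type*} [AddCommGroup Γ] [DecidableEq Γ] {ε : CommutationFactor Γ ℂ} {D : ℕ}
  (𝒜 : Γ → Submodule ℂ (Matrix (Fin D) (Fin D) ℂ)) {φ : Fin D → Γ} [GradedAlgebra 𝒜]
  [IsElementaryGrading 𝒜 φ] (htr : epsTrace ε φ 1 ≠ 0)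

/-- The pull-back of multilinear maps along the adjoint representation. -/
def pullback (n : ℕ) :
    MultilinearMap ℂ (fun _ : Fin n => epsDer ε 𝒜) (Matrix (Fin D) (Fin D) ℂ) ≃ₗ[ℂ]
      MultilinearMap ℂ (fun _ : Fin n => slEps ε φ) (Matrix (Fin D) (Fin D) ℂ) :=
  LinearEquiv.multilinearMapCongrLeft fun _ => adjointEquiv 𝒜 htr

lemma pullback_apply {n : ℕ}
    (ω : MultilinearMap ℂ (fun _ : Fin n => epsDer ε 𝒜) (Matrix (Fin D) (Fin D) ℂ))
    (x : Fin n → slEps ε φ) : pullback 𝒜 htr n ω x = ω fun i => adjointEquiv 𝒜 htr (x i) := rfl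

/-- Homogeneous `ε`-derivations are the images of homogeneous elements of `sl_ε(D)` of the same
degrees, so that identities between forms on the `ε`-derivations can be tested on the latter. -/
lemma exists_adjointEquiv_tuple {n : ℕ} {d : Fin n → Γ} {X : Fin n → epsDer ε 𝒜}
    (hX : ∀ i, X i ∈ derGrading ε 𝒜 (d i)) : ∃ Y : Fin n → HomElt (slGrading ε 𝒜 φ),
      (fun i => (Y i).1) = d ∧ (fun i => adjointEquiv 𝒜 htr (Y i).val) = X := by
  choose x hx h using fun i => exists_adjoint_eq 𝒜 htr (hX i)
  exact ⟨fun i => ⟨d i, x i, hx i⟩, rfl, funext h⟩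

lemma pullback_mem_altForms {n : ℕ} {k : Γ}
    {ω : MultilinearMap ℂ (fun _ : Fin n => epsDer ε 𝒜) (Matrix (Fin D) (Fin D) ℂ)} :
    pullback 𝒜 htr n ω ∈ altForms (L := slEps ε φ) ε 𝒜 (slGrading ε 𝒜 φ) n k ↔
      ω ∈ altForms (L := epsDer ε 𝒜) ε 𝒜 (derGrading ε 𝒜) n k := by
  constructor
  · intro h d X hX
    obtain ⟨Y, rfl, rfl⟩ := exists_adjointEquiv_tuple 𝒜 htr hX
    exact h _ (fun i => (Y i).val) fun i => (Y i).2.2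
  · intro h d x hx
    exact h d (fun i => adjointEquiv 𝒜 htr (x i)) fun i => adjoint_mem ε 𝒜 (hx i)

/-- The forms on the `ε`-derivations of degree `p` correspond to the forms on `sl_ε(D)` of
degree `p`. -/
def derFormsEquiv (p : ℕ × Γ) :
    derForms ε 𝒜 p ≃ₗ[ℂ] formSpace (L := slEps ε φ) ε 𝒜 (slGrading ε 𝒜 φ) p :=
  (LinearEquiv.ofSubmodules (pullback 𝒜 htr p.1) (derForms ε 𝒜 p)
    (altForms (L := slEps ε φ) ε 𝒜 (slGrading ε 𝒜 φ) p.1 p.2) (by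
      obtain ⟨o⟩ := nonempty_of_epsTrace_ne_zero htr
      ext η
      constructor
      · rintro ⟨ω, hω, rfl⟩
        exact (pullback_mem_altForms 𝒜 htr).mpr ((mem_derForms 𝒜 φ o).mp hω)
      · intro hη
        obtain ⟨ω, rfl⟩ := (pullback 𝒜 htr p.1).surjective η
        exact ⟨ω, (mem_derForms 𝒜 φ o).mpr ((pullback_mem_altForms 𝒜 htr).mp hη), rfl⟩)).trans
    (altFormsEquiv (L := slEps ε φ) ε 𝒜 (slGrading ε 𝒜 φ) p)

lemma derFormsEquiv_apply (p : ℕ × Γ) (ω : derForms ε 𝒜 p) :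
    (derFormsEquiv 𝒜 htr p ω : List (HomElt (slGrading ε 𝒜 φ)) → Matrix (Fin D) (Fin D) ℂ) =
      toList ℂ p.1 (pullback 𝒜 htr p.1 ω.1) := rfl

lemma derFormsEquiv_ofFn (p : ℕ × Γ) (ω : derForms ε 𝒜 p)
    (Y : Fin p.1 → HomElt (slGrading ε 𝒜 φ)) :
    (derFormsEquiv 𝒜 htr p ω).1 (List.ofFn Y) = ω.1 fun i => adjointEquiv 𝒜 htr (Y i).val := by
  rw [derFormsEquiv_apply, toList_ofFn, pullback_apply]

lemma derFormsEquiv_symm_apply (p : ℕ × Γ)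
    (f : formSpace (L := slEps ε φ) ε 𝒜 (slGrading ε 𝒜 φ) p)
    (Y : Fin p.1 → HomElt (slGrading ε 𝒜 φ)) :
    ((derFormsEquiv 𝒜 htr p).symm f).1 (fun i => adjointEquiv 𝒜 htr (Y i).val) =
      f.1 (List.ofFn Y) := by
  rw [← derFormsEquiv_ofFn, LinearEquiv.apply_symm_apply]

/-- The inclusion of the space of forms on the `ε`-derivations of degree `p`. -/
abbrev derOf (p : ℕ × Γ) : derForms ε 𝒜 p →ₗ[ℂ] DerCalculus ε 𝒜 :=
  DirectSum.lof ℂ (ℕ × Γ) (fun p => derForms ε 𝒜 p) p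

/-- The differential calculus based on `ε`-derivations is the space of sums of forms on
`sl_ε(D)`. -/
def derCalculusEquiv :
    Calculus (L := slEps ε φ) ε 𝒜 (slGrading ε 𝒜 φ) ≃ₗ[ℂ] DerCalculus ε 𝒜 :=
  DFinsupp.mapRange.linearEquiv fun p => (derFormsEquiv 𝒜 htr p).symm

lemma derCalculusEquiv_of (p : ℕ × Γ)
    (f : formSpace (L := slEps ε φ) ε 𝒜 (slGrading ε 𝒜 φ) p) :
    derCalculusEquiv 𝒜 htr (calculusOf (L := slEps ε φ) ε 𝒜 (slGrading ε 𝒜 φ) p f) =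
      derOf 𝒜 p ((derFormsEquiv 𝒜 htr p).symm f) :=
  DFinsupp.mapRange_single (hf := fun _ => map_zero _)

lemma derCalculusEquiv_symm_lof (p : ℕ × Γ) (ω : derForms ε 𝒜 p) :
    (derCalculusEquiv 𝒜 htr).symm (derOf 𝒜 p ω) =
      calculusOf (L := slEps ε φ) ε 𝒜 (slGrading ε 𝒜 φ) p (derFormsEquiv 𝒜 htr p ω) := by
  rw [LinearEquiv.symm_apply_eq, derCalculusEquiv_of, LinearEquiv.symm_apply_apply]

lemma lof_component (p : ℕ × Γ) (ω : derForms ε 𝒜 p) :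
    (derOf 𝒜 p ω : DerCalculus ε 𝒜) p = ω :=
  DirectSum.lof_apply (M := fun p => derForms ε 𝒜 p) ℂ p ω

lemma map_derCalculusEquiv (p : ℕ × Γ) :
    (calculusGrading (L := slEps ε φ) ε 𝒜 (slGrading ε 𝒜 φ) p).map
      (derCalculusEquiv 𝒜 htr : Calculus (L := slEps ε φ) ε 𝒜 (slGrading ε 𝒜 φ) →ₗ[ℂ]
        DerCalculus ε 𝒜) = derCalculusGrading ε 𝒜 p := by
  ext x
  constructor
  · rintro ⟨_, ⟨f, rfl⟩, rfl⟩
    exact ⟨_, (derCalculusEquiv_of 𝒜 htr p f).symm⟩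
  · rintro ⟨ω, rfl⟩
    refine ⟨_, ⟨derFormsEquiv 𝒜 htr p ω, rfl⟩, ?_⟩
    rw [LinearEquiv.coe_coe, derCalculusEquiv_of, LinearEquiv.symm_apply_apply]

lemma derCalculusEquiv_one :
    derCalculusEquiv 𝒜 htr (calculusOne (L := slEps ε φ) ε 𝒜 (slGrading ε 𝒜 φ)) =
      derCalculusOne ε 𝒜 := by
  rw [← LinearEquiv.eq_symm_apply, derCalculusOne, derCalculusEquiv_symm_lof, calculusOne]
  congr 1
  refine Subtype.ext ?_
  rw [derFormsEquiv_apply]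
  funext t
  cases t with
  | nil => rfl
  | cons X t => exact (toList_of_length_ne (n := 0) _ (t := X :: t) (by simp)).symm

/-- The differential of forms on `sl_ε(D)` with values in the matrix algebra. -/
abbrev slDif : Calculus (L := slEps ε φ) ε 𝒜 (slGrading ε 𝒜 φ) →ₗ[ℂ]
    Calculus (L := slEps ε φ) ε 𝒜 (slGrading ε 𝒜 φ) :=
  calculusDif 𝒜 (slEps_isEpsLieAlgebra ε 𝒜 φ) (slAction_isDerAction ε 𝒜 φ)

/-- The product of forms on the `ε`-derivations. -/
abbrev derMul : DerCalculus ε 𝒜 →ₗ[ℂ] DerCalculus ε 𝒜 →ₗ[ℂ] DerCalculus ε 𝒜 :=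
  transportMul (derCalculusEquiv 𝒜 htr) (calculusMul (L := slEps ε φ) ε 𝒜 (slGrading ε 𝒜 φ))

/-- The differential of forms on the `ε`-derivations. -/
abbrev derDif : DerCalculus ε 𝒜 →ₗ[ℂ] DerCalculus ε 𝒜 :=
  (derCalculusEquiv 𝒜 htr).conj (slDif 𝒜)

lemma isGradedDiffAlgebraIso_derCalculusEquiv :
    IsGradedDiffAlgebraIso (calculusGrading (L := slEps ε φ) ε 𝒜 (slGrading ε 𝒜 φ))
      (calculusMul (L := slEps ε φ) ε 𝒜 (slGrading ε 𝒜 φ))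
      (calculusOne (L := slEps ε φ) ε 𝒜 (slGrading ε 𝒜 φ)) (slDif 𝒜)
      (derCalculusGrading ε 𝒜) (derMul 𝒜 htr) (derCalculusOne ε 𝒜) (derDif 𝒜 htr)
      (derCalculusEquiv 𝒜 htr) :=
  isGradedDiffAlgebraIso_transport (derCalculusEquiv 𝒜 htr) (map_derCalculusEquiv 𝒜 htr)
    (derCalculusEquiv_one 𝒜 htr)

lemma derCalculus_isGradedDiffAlgebra :
    IsGradedDiffAlgebra ε (derCalculusGrading ε 𝒜) (derMul 𝒜 htr) (derCalculusOne ε 𝒜)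
      (derDif 𝒜 htr) :=
  (calculus_isGradedDiffAlgebra (L := slEps ε φ) 𝒜 (slEps_isEpsLieAlgebra ε 𝒜 φ)
    (slAction_isDerAction ε 𝒜 φ)).of_iso (isGradedDiffAlgebraIso_derCalculusEquiv 𝒜 htr)

lemma derMul_lof (p q : ℕ × Γ) (ω : derForms ε 𝒜 p) (η : derForms ε 𝒜 q) :
    derMul 𝒜 htr (derOf 𝒜 p ω) (derOf 𝒜 q η) =
      derOf 𝒜 (p + q)
        ((derFormsEquiv 𝒜 htr (p + q)).symm
          ⟨formMul ε Sigma.fst q.2 (derFormsEquiv 𝒜 htr p ω).1 (derFormsEquiv 𝒜 htr q η).1,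
            formMul_mem (derFormsEquiv 𝒜 htr p ω).2 (derFormsEquiv 𝒜 htr q η).2⟩) := by
  rw [derMul, transportMul_apply, derCalculusEquiv_symm_lof 𝒜 htr p ω,
    derCalculusEquiv_symm_lof 𝒜 htr q η, calculusMul_of_of, derCalculusEquiv_of]

lemma derDif_lof (p : ℕ × Γ) (ω : derForms ε 𝒜 p) :
    derDif 𝒜 htr (derOf 𝒜 p ω) =
      derOf 𝒜 (p + (1, 0))
        ((derFormsEquiv 𝒜 htr (p + (1, 0))).symm
          ⟨dif ε Sigma.fst (homBracket (slEps_isEpsLieAlgebra ε 𝒜 φ))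
            (homAction (slAction ε 𝒜 φ)) p.2 (derFormsEquiv 𝒜 htr p ω).1,
            dif_mem _ (slAction_isDerAction ε 𝒜 φ) (derFormsEquiv 𝒜 htr p ω).2⟩) := by
  rw [derDif, LinearEquiv.conj_apply_apply, derCalculusEquiv_symm_lof 𝒜 htr p ω, slDif,
    calculusDif_of, derCalculusEquiv_of]

lemma derMul_apply (p q : ℕ × Γ) (ω : derForms ε 𝒜 p) (η : derForms ε 𝒜 q)
    (Y : Fin (p + q).1 → HomElt (slGrading ε 𝒜 φ)) :
    (derMul 𝒜 htr (derOf 𝒜 p ω) (derOf 𝒜 q η) (p + q)).1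
        (fun i => adjointEquiv 𝒜 htr (Y i).val) =
      formMul ε Sigma.fst q.2 (derFormsEquiv 𝒜 htr p ω).1 (derFormsEquiv 𝒜 htr q η).1
        (List.ofFn Y) := by
  rw [derMul_lof, lof_component, derFormsEquiv_symm_apply]

lemma derDif_apply (p : ℕ × Γ) (ω : derForms ε 𝒜 p)
    (Y : Fin (p + (1, 0)).1 → HomElt (slGrading ε 𝒜 φ)) :
    (derDif 𝒜 htr (derOf 𝒜 p ω) (p + (1, 0))).1 (fun i => adjointEquiv 𝒜 htr (Y i).val) =
      dif ε Sigma.fst (homBracket (slEps_isEpsLieAlgebra ε 𝒜 φ)) (homAction (slAction ε 𝒜 φ)) p.2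
        (derFormsEquiv 𝒜 htr p ω).1 (List.ofFn Y) := by
  rw [derDif_lof, lof_component, derFormsEquiv_symm_apply]

lemma mulValue_der (p q : ℕ × Γ) (ω : derForms ε 𝒜 p) (η : derForms ε 𝒜 q)
    (Y : Fin (p.1 + q.1) → HomElt (slGrading ε 𝒜 φ)) :
    mulValue ε q.2 ω.1 η.1 (fun i => (Y i).1) (fun i => adjointEquiv 𝒜 htr (Y i).val) =
      formMul ε Sigma.fst q.2 (derFormsEquiv 𝒜 htr p ω).1 (derFormsEquiv 𝒜 htr q η).1
        (List.ofFn Y) := by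
  have hf := (derFormsEquiv 𝒜 htr p ω).2
  have hg := (derFormsEquiv 𝒜 htr q η).2
  exact mulValue_eq_formMul (val := fun Z : HomElt (slGrading ε 𝒜 φ) =>
    adjointEquiv 𝒜 htr Z.val) hf.2.2.1 hg.2.2.1 hf.1 hg.1 q.2 _ _
    (derFormsEquiv_ofFn 𝒜 htr p ω) (derFormsEquiv_ofFn 𝒜 htr q η) Y

lemma diffValue_der (p : ℕ × Γ) (ω : derForms ε 𝒜 p)
    (Y : Fin (p.1 + 1) → HomElt (slGrading ε 𝒜 φ)) :
    diffValue ε (fun X Y => derBracket ε 𝒜 X Y)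
        (fun X a => (X : Module.End ℂ (Matrix (Fin D) (Fin D) ℂ)) a) p.2 ω.1
        (fun i => (Y i).1) (fun i => adjointEquiv 𝒜 htr (Y i).val) =
      dif ε Sigma.fst (homBracket (slEps_isEpsLieAlgebra ε 𝒜 φ)) (homAction (slAction ε 𝒜 φ)) p.2
        (derFormsEquiv 𝒜 htr p ω).1 (List.ofFn Y) := by
  have hf := (derFormsEquiv 𝒜 htr p ω).2
  have hbr := fun Z W : HomElt (slGrading ε 𝒜 φ) =>
    (adjointEquiv_isEpsLieIso 𝒜 htr).map_bracket Z.val W.val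
  exact diffValue_eq_dif (val := fun Z : HomElt (slGrading ε 𝒜 φ) => adjointEquiv 𝒜 htr Z.val)
    (br := fun X Y => derBracket ε 𝒜 X Y)
    (ρ' := fun X a => (X : Module.End ℂ (Matrix (Fin D) (Fin D) ℂ)) a)
    (slAction_isDerAction ε 𝒜 φ).deg_brk hbr (fun _ _ => rfl) hf.2.2.1 p.2 _
    (derFormsEquiv_ofFn 𝒜 htr p ω) Y

/-- The product and the differential carried over from the forms on `sl_ε(D)` are given by the
explicit formulas on the `ε`-derivations, since all of these are inner. -/
theorem isDerCalculusStructure : IsDerCalculusStructure ε 𝒜 (derMul 𝒜 htr) (derDif 𝒜 htr) where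
  mul_mem := (derCalculus_isGradedDiffAlgebra 𝒜 htr).mul_mem
  mul_apply p q := by
    rintro _ ⟨ω, rfl⟩ _ ⟨η, rfl⟩ e X hX
    obtain ⟨Y, rfl, rfl⟩ := exists_adjointEquiv_tuple 𝒜 htr hX
    rw [lof_component 𝒜 p ω, lof_component 𝒜 q η]
    exact (derMul_apply 𝒜 htr p q ω η Y).trans (mulValue_der 𝒜 htr p q ω η Y).symm
  d_mem := (derCalculus_isGradedDiffAlgebra 𝒜 htr).d_mem
  d_apply p := by
    rintro _ ⟨ω, rfl⟩ e X hX
    obtain ⟨Y, rfl, rfl⟩ := exists_adjointEquiv_tuple 𝒜 htr hX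
    rw [lof_component 𝒜 p ω]
    exact (derDif_apply 𝒜 htr p ω Y).trans (diffValue_der 𝒜 htr p ω Y).symm

/-- The push-forward of forms along the adjoint representation: both algebras are identified with
the algebra of forms on `sl_ε(D)`, viewed as functions of lists. -/
def pushforward : LieForms (A := Matrix (Fin D) (Fin D) ℂ) ε (slGrading ε 𝒜 φ) ≃ₗ[ℂ]
    DerCalculus ε 𝒜 :=
  (lieFormsEquiv (L := slEps ε φ) ε 𝒜 (slGrading ε 𝒜 φ)).symm.trans (derCalculusEquiv 𝒜 htr)

/-- The push-forward of `ω` is the form on the `ε`-derivations which is pulled back by the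
adjoint representation to the evaluation of `ω`. -/
lemma isPushforward_pushforward : IsPushforward (L := slEps ε φ) ε 𝒜 (slGrading ε 𝒜 φ)
    (adjointEquiv 𝒜 htr) (pushforward 𝒜 htr) := by
  intro p ω hω
  have h : pushforward 𝒜 htr ω = derOf 𝒜 p
      ((derFormsEquiv 𝒜 htr p).symm
        (evalEquiv (L := slEps ε φ) ε 𝒜 (slGrading ε 𝒜 φ) p ⟨ω, hω⟩)) := by
    have h0 := lieFormsEquiv_symm (L := slEps ε φ) ε 𝒜 (slGrading ε 𝒜 φ) hω
    exact (congrArg (derCalculusEquiv 𝒜 htr) h0).trans (derCalculusEquiv_of 𝒜 htr p _)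
  refine ⟨⟨_, h.symm⟩, fun X => ?_⟩
  have h1 : pullback 𝒜 htr p.1 ((derFormsEquiv 𝒜 htr p).symm
      (evalEquiv (L := slEps ε φ) ε 𝒜 (slGrading ε 𝒜 φ) p ⟨ω, hω⟩)).1 =
        eval ε (slGrading ε 𝒜 φ) p.1 ω := by
    refine toList_injective (K := ℂ) (ℒ := slGrading ε 𝒜 φ) p.1 ?_
    rw [← derFormsEquiv_apply, LinearEquiv.apply_symm_apply, evalEquiv_apply]
  rw [h, lof_component, ← pullback_apply 𝒜 htr, h1]

end Pushforward
end EpsGraded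

end

theorem mainTheorem2 {Γ : Type*} [AddCommGroup Γ] [DecidableEq Γ]
    (ε : EpsGraded.CommutationFactor Γ ℂ) (D : ℕ)
    (𝒜 : Γ → Submodule ℂ (Matrix (Fin D) (Fin D) ℂ)) [GradedAlgebra 𝒜]
    (φ : Fin D → Γ) [EpsGraded.IsElementaryGrading 𝒜 φ]
    (htr : EpsGraded.epsTrace ε φ 1 ≠ 0) :
    -- the adjoint representation is an isomorphism of `ε`-Lie algebras
    ∃ ad : EpsGraded.slEps ε φ ≃ₗ[ℂ] EpsGraded.epsDer ε 𝒜,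
      (∀ (a : EpsGraded.slEps ε φ) (b : Matrix (Fin D) (Fin D) ℂ),
        (ad a : Module.End ℂ (Matrix (Fin D) (Fin D) ℂ)) b = EpsGraded.epsBracket ε 𝒜 a b) ∧
      EpsGraded.IsEpsLieAlgebra (L := EpsGraded.slEps ε φ) ε
        (EpsGraded.slGrading ε 𝒜 φ) (EpsGraded.slBracket ε 𝒜 φ) ∧
      EpsGraded.IsEpsLieAlgebra (L := EpsGraded.epsDer ε 𝒜) ε
        (EpsGraded.derGrading ε 𝒜) (EpsGraded.derBracket ε 𝒜) ∧
      EpsGraded.IsEpsLieIso (L := EpsGraded.slEps ε φ) (L' := EpsGraded.epsDer ε 𝒜)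
        (EpsGraded.slGrading ε 𝒜 φ) (EpsGraded.derGrading ε 𝒜)
        (EpsGraded.slBracket ε 𝒜 φ) (EpsGraded.derBracket ε 𝒜) ad ∧
      -- evaluation identifies the component of degree `(n, k)` of `M_D ⊗ Λ_ε(sl_ε(D)*)` with
      -- the `ε`-alternating `n`-linear maps of degree `k` on `sl_ε(D)`
      (∀ p : ℕ × Γ, Set.BijOn
        (EpsGraded.eval (A := Matrix (Fin D) (Fin D) ℂ) ε (EpsGraded.slGrading ε 𝒜 φ) p.1)
        (EpsGraded.lieFormsGrading ε 𝒜 (EpsGraded.slGrading ε 𝒜 φ) p)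
        (EpsGraded.altForms ε 𝒜 (EpsGraded.slGrading ε 𝒜 φ) p.1 p.2)) ∧
      -- the products and differentials of the two graded differential algebras
      ∃ mul d mul' d',
        EpsGraded.IsLieFormsStructure ε 𝒜 (EpsGraded.slGrading ε 𝒜 φ)
          (fun a b => EpsGraded.slBracket ε 𝒜 φ a b) (fun a b => EpsGraded.epsBracket ε 𝒜 a b)
          mul d ∧
        EpsGraded.IsGradedDiffAlgebra ε
          (EpsGraded.lieFormsGrading ε 𝒜 (EpsGraded.slGrading ε 𝒜 φ)) mul (1 ⊗ₜ[ℂ] 1) d ∧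
        EpsGraded.IsDerCalculusStructure ε 𝒜 mul' d' ∧
        EpsGraded.IsGradedDiffAlgebra ε
          (EpsGraded.derCalculusGrading ε 𝒜) mul' (EpsGraded.derCalculusOne ε 𝒜) d' ∧
        -- the push-forward of `ad` is an isomorphism between them
        ∃ adStar : EpsGraded.LieForms (A := Matrix (Fin D) (Fin D) ℂ) ε
            (EpsGraded.slGrading ε 𝒜 φ) ≃ₗ[ℂ] EpsGraded.DerCalculus ε 𝒜,
          EpsGraded.IsPushforward ε 𝒜 (EpsGraded.slGrading ε 𝒜 φ) ad adStar ∧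
          EpsGraded.IsGradedDiffAlgebraIso
            (EpsGraded.lieFormsGrading ε 𝒜 (EpsGraded.slGrading ε 𝒜 φ)) mul (1 ⊗ₜ[ℂ] 1) d
            (EpsGraded.derCalculusGrading ε 𝒜) mul' (EpsGraded.derCalculusOne ε 𝒜) d'
            adStar := by
  have hL := EpsGraded.slEps_isEpsLieAlgebra ε 𝒜 φ
  have hρ := EpsGraded.slAction_isDerAction ε 𝒜 φ
  exact ⟨EpsGraded.adjointEquiv 𝒜 htr, EpsGraded.adjointEquiv_apply 𝒜 htr, hL,
    hL.of_iso ε (EpsGraded.adjointEquiv_isEpsLieIso 𝒜 htr),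
    EpsGraded.adjointEquiv_isEpsLieIso 𝒜 htr, EpsGraded.bijOn_eval ε 𝒜 _,
    _, _, _, _, EpsGraded.isLieFormsStructure_transport 𝒜 hL hρ,
    EpsGraded.lieForms_isGradedDiffAlgebra 𝒜 hL hρ,
    EpsGraded.isDerCalculusStructure 𝒜 htr, EpsGraded.derCalculus_isGradedDiffAlgebra 𝒜 htr,
    EpsGraded.pushforward 𝒜 htr, EpsGraded.isPushforward_pushforward 𝒜 htr,
    (EpsGraded.isGradedDiffAlgebraIso_lieFormsEquiv 𝒜 hL hρ).symm_trans
      (EpsGraded.isGradedDiffAlgebraIso_derCalculusEquiv 𝒜 htr)⟩
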